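/- Let $N\in\mathbb{Z}_{\ge 0}$. For real $s$ and $\nu,\xi\in\mathbb{C}$ let $(s-x)^\nu$ denote the usual power for $x\le s$ and $e^{-\pi i\nu}|x-s|^\nu$ for $x>s$, and put $\theta_{\xi,s}(x)=1-\xi$ if $x>s$ and $\theta_{\xi,s}(x)=1$ if $x\le s$. Up to normalisation constants independent of $s$ (which play no role below), define $$\tilde E^{\rm J}_N(s;a,b,\nu;\xi)=\int_{[0,1]^N}\prod_{l=1}^N\theta_{\xi,s}(x_l)\,x_l^a(1-x_l)^b(s-x_l)^\nu\prod_{j<k}(x_k-x_j)^2\,dx,$$ $$\tilde E^{\rm Cy}_N(s;(\eta_1,\eta_2),\nu;\xi)=\int_{\mathbb{R}^N}\prod_{l=1}^N\frac{\theta_{\xi,s}(x_l)\,(s-x_l)^\nu}{(1+ix_l)^{\eta_1+i\eta_2}(1-ix_l)^{\eta_1-i\eta_2}}\prod_{j<k}(x_k-x_j)^2\,dx .$$ For $\mathbf b=(b_1,b_2,b_3,b_4)$ write $e_2[\mathbf b]=\sum_{j<k}b_jb_k$ and $e_2'[\mathbf b]=b_1b_3+b_1b_4+b_3b_4$. With $\hat{\mathbf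 b}=\big(\tfrac{a+b}2+N,\tfrac{b-a}2,-\tfrac{a+b}2,-\tfrac{a+b}2-N-\nu\big)$ and $\mathbf b=(N-\eta_1,i\eta_2,\eta_1,-\nu+\eta_1-N)$ set $$U^{\rm J}_N(t;a,b,\nu;\xi)=e_2'[\hat{\mathbf b}]\,t-\tfrac12e_2[\hat{\mathbf b}]+t(t-1)\frac{d}{dt}\log\tilde E^{\rm J}_N(t;a,b,\nu;\xi),$$ $$U^{\rm Cy}_N(t;(\eta_1,\eta_2),\nu;\xi)=(t^2+1)\frac{d}{dt}\log\Big((it-1)^{e_2'[\mathbf b]-\frac12e_2[\mathbf b]}(it+1)^{\frac12e_2[\mathbf b]}\,\tilde E^{\rm Cy}_N(t;(\eta_1,\eta_2),\nu;\xi)\Big).$$ **Jacobi case.** Let $a,b,\mu,\xi\in\mathbb{C}$ and $t\in\mathbb{R}\setminus\{0,1\}$ with $\mathrm{Re}\,a>-1$; with $\mathrm{Re}\,b>-1$ unless $\xi=1$ and $t<1$; and with $\mathrm{Re}\,\mu>0$ if $0<t<1$. Then for $\nu=\mu-1,\mu,\mu+1,\mu+2$ the integral $\tilde E^{\rm J}_N(t;a,b,\nu;\xi)$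 converges absolutely and is differentiable in its first argument at $t$. If these four values are nonzero, then, writing $U_k=U^{\rm J}_N(t;a,b,\mu+k;\xi)$, $$\begin{aligned} &\big[(N+a+\mu+1)U_0-(N+a+\mu)U_1+\tfrac14(a-b)^2t-\tfrac14(a^2+b^2)-\tfrac14(a+b)N\big]\\ &\times\big[(N+b+\mu+1)U_0-(N+b+\mu)U_1+\tfrac14(a-b)^2t+\tfrac12ab+\tfrac14(a+b)N\big]\\ &\times\big[U_1-U_{-1}+(2N+2\mu+a+b)(t-\tfrac12)\big]\big[U_2-U_0+(2N+2\mu+2+a+b)(t-\tfrac12)\big]\\ &=t(t-1)\big[(N+a+\mu)(N+b+\mu)(U_1-U_{-1})-(2N+2\mu+a+b)U_0\\ &\qquad-\tfrac14(a-b)^2(2N+2\mu+a+b)t+\tfrac14(b-a)(2Nb+(b-a)\mu+b(a+b))\big]\\ &\times\big[(N+a+\mu+1)(N+b+\mu+1)(U_2-U_0)-(2N+2\mu+2+a+b)U_1\\ &\qquad-\tfrac14(a-b)^2(2N+2\mu+2+a+b)t+\tfrac14(b-a)(2Nb+(b-a)(\mu+1)+b(a+b))\big]. \end{aligned}$$ **Cauchy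 case.** Let $\eta_1,\eta_2,t\in\mathbb{R}$ and $\mu,\xi\in\mathbb{C}$ with $\mathrm{Re}\,\mu>0$ and $\mathrm{Re}\,\mu+2N+1<2\eta_1$. Then for $\nu=\mu-1,\mu,\mu+1,\mu+2$ the integral $\tilde E^{\rm Cy}_N(t;(\eta_1,\eta_2),\nu;\xi)$ converges absolutely and is differentiable in its first argument at $t$. If these four values are nonzero, then, writing $U_k=U^{\rm Cy}_N(t;(\eta_1,\eta_2),\mu+k;\xi)$, $$\begin{aligned} &\big[(N+\mu+1-2\eta_1)U_0-(N+\mu-2\eta_1)U_1+\eta_1^2t+\eta_2(N-\eta_1)\big]\\ &\times\big[(N+\mu+1)U_0-(N+\mu)U_1+\eta_1^2t-\eta_2(N-\eta_1)\big]\\ &\times\big[U_1-U_{-1}+2(N+\mu-\eta_1)t\big]\big[U_2-U_0+2(N+\mu+1-\eta_1)t\big]\\ &=(1+t^2)\big[(N+\mu)(N+\mu-2\eta_1)(U_1-U_{-1})-2(N+\mu-\eta_1)U_0-2\eta_1^2(N+\mu-\eta_1)t-2\eta_1\eta_2(N-\eta_1)\big]\\ &\times\big[(N+\mu+1)(N+\mu+1-2\eta_1)(U_2-U_0)-2(N+\mu+1-\eta_1)U_1-2\eta_1^2(N+\mu+1-\eta_1)t-2\eta_1\eta_2(N-\eta_1)\big].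 \end{aligned}$$ **Complex $t$.** Under the stated parameter conditions at a real point $t_0$, the same equations persist under analytic continuation in $t$: if $\Omega\subset\mathbb{C}$ is open and connected, $t_0\in\Omega$, and $E_k$ ($k=-1,0,1,2$) are holomorphic on $\Omega$ and agree with the average at parameter $\mu+k$ for real arguments near $t_0$, then at every $t\in\Omega$ (with $t^2+1\ne0$ in the Cauchy case) at which all four $E_k(t)$ are nonzero, the equation holds with the $U_k$ formed from the $E_k$. -/

import Mathlib

open MeasureTheory Filter Topology Complex

noncomputable section

/-- The squared Vandermonde product `∏_{j<k} (x_k - x_j)^2`. -/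
def vandermondeSq (N : ℕ) (x : Fin N → ℝ) : ℂ :=
  ∏ j : Fin N, ∏ k ∈ Finset.Ioi j, ((x k - x j : ℝ) : ℂ) ^ 2

/-- The integrand `∏_l w(x_l) ∏_{j<k} (x_k - x_j)^2` of a unitary ensemble average. -/
def ensembleIntegrand (N : ℕ) (w : ℝ → ℂ) (x : Fin N → ℝ) : ℂ :=
  (∏ l, w (x l)) * vandermondeSq N x

/-- The factor `(s - x)^μ` for real `s`, `x`, in the branch which is real (for real `μ`) for
`x < s` and equals `e^{-πiμ} |x - s|^μ` for `x > s`. -/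
def branchPow (s x : ℝ) (μ : ℂ) : ℂ :=
  if x ≤ s then ((s - x : ℝ) : ℂ) ^ μ
  else Complex.exp (-(Real.pi * I * μ)) * ((x - s : ℝ) : ℂ) ^ μ

/-- The factor `1 - ξ χ_{(s,∞)}(x)`, which realises `∫ - ξ ∫_s`. -/
def thinning (ξ : ℂ) (s x : ℝ) : ℂ := if s < x then 1 - ξ else 1

/-- The one-variable weight `(1 - ξ χ_{x > s}) x^a (1-x)^b (s-x)^μ` on `(0,1)`, extended by zero. -/
def jacobiWeight (a b μ ξ : ℂ) (s x : ℝ) : ℂ :=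
  if 0 < x ∧ x < 1 then
    thinning ξ s x * ((x : ℂ) ^ a * ((1 - x : ℝ) : ℂ) ^ b * branchPow s x μ)
  else 0

/-- The one-variable weight
`(1 - ξ χ_{x > s}) (s-x)^μ (1+ix)^{-(η₁+iη₂)} (1-ix)^{-(η₁-iη₂)}` on the real line
(principal powers; `1 ± ix` lies in the right half plane). -/
def cauchyWeight (η₁ η₂ : ℝ) (μ ξ : ℂ) (s x : ℝ) : ℂ :=
  thinning ξ s x * (branchPow s x μ * (1 + I * x) ^ (-((η₁ : ℂ) + I * η₂)) *
    (1 - I * x) ^ (-((η₁ : ℂ) - I * η₂)))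

/-- The JUE average, up to the normalisation constant (independent of `s`), which does not
affect logarithmic derivatives in `s`. -/
def jacobiAverage (N : ℕ) (a b μ ξ : ℂ) (s : ℝ) : ℂ :=
  ∫ x : Fin N → ℝ, ensembleIntegrand N (jacobiWeight a b μ ξ s) x

/-- The CyUE average, up to the normalisation constant (independent of `s`). -/
def cauchyAverage (N : ℕ) (η₁ η₂ : ℝ) (μ ξ : ℂ) (s : ℝ) : ℂ :=
  ∫ x : Fin N → ℝ, ensembleIntegrand N (cauchyWeight η₁ η₂ μ ξ s) x

/-- The second elementary symmetric function of `b₁, b₂, b₃, b₄`. -/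
def esymTwo (b₁ b₂ b₃ b₄ : ℂ) : ℂ :=
  b₁ * b₂ + b₁ * b₃ + b₁ * b₄ + b₂ * b₃ + b₂ * b₄ + b₃ * b₄

/-- The second elementary symmetric function of `b₁, b₃, b₄`. -/
def esymTwo' (b₁ b₃ b₄ : ℂ) : ℂ := b₁ * b₃ + b₁ * b₄ + b₃ * b₄

/-- `e₂'[b] t - e₂[b]/2 + t(t-1) L` with
`b = ((a+b)/2+N, (b-a)/2, -(a+b)/2, -(a+b)/2-N-μ)`; here `L` stands for the value at `t` of the
logarithmic derivative of the average. -/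
def jacobiSigma (N : ℕ) (a b μ t L : ℂ) : ℂ :=
  esymTwo' ((a + b) / 2 + N) (-(a + b) / 2) (-(a + b) / 2 - N - μ) * t
    - 1 / 2 * esymTwo ((a + b) / 2 + N) ((b - a) / 2) (-(a + b) / 2) (-(a + b) / 2 - N - μ)
    + t * (t - 1) * L

/-- `(t²+1) d/dt log ((it-1)^{e₂'[b]-e₂[b]/2} (it+1)^{e₂[b]/2} E(t))` with
`b = (N-η₁, iη₂, η₁, -μ+η₁-N)`, written out with `L` for the value at `t` of the
logarithmic derivative of `E`. -/
def cauchySigma (N : ℕ) (η₁ η₂ : ℝ) (μ t L : ℂ) : ℂ :=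
  let e := esymTwo (N - η₁) (I * η₂) η₁ (-μ + η₁ - N)
  let e' := esymTwo' (N - η₁) η₁ (-μ + η₁ - N)
  (t ^ 2 + 1) * ((e' - 1 / 2 * e) * (I / (I * t - 1)) + 1 / 2 * e * (I / (I * t + 1)) + L)

/-- The σ-function `U_N^J(t;a,b,μ;ξ)`. -/
def UJ (N : ℕ) (a b μ ξ : ℂ) (t : ℝ) : ℂ :=
  jacobiSigma N a b μ t (logDeriv (fun s : ℝ => jacobiAverage N a b μ ξ s) t)

/-- The σ-function `U_N^Cy(t;(η₁,η₂),μ;ξ)`. -/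
def UCy (N : ℕ) (η₁ η₂ : ℝ) (μ ξ : ℂ) (t : ℝ) : ℂ :=
  cauchySigma N η₁ η₂ μ t (logDeriv (fun s : ℝ => cauchyAverage N η₁ η₂ μ ξ s) t)

/-- The difference equation of the Jacobi case, relating the values `Ud, U, U₁, U₂` of the
σ-function at `μ-1, μ, μ+1, μ+2`. -/
def JacobiRecurrence (N : ℕ) (a b μ t Ud U U₁ U₂ : ℂ) : Prop :=
  ((N + a + μ + 1) * U - (N + a + μ) * U₁ + 1 / 4 * (a - b) ^ 2 * t
      - 1 / 4 * (a ^ 2 + b ^ 2) - 1 / 4 * (a + b) * N)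
    * ((N + b + μ + 1) * U - (N + b + μ) * U₁ + 1 / 4 * (a - b) ^ 2 * t
      + 1 / 2 * a * b + 1 / 4 * (a + b) * N)
    * (U₁ - Ud + (2 * N + 2 * μ + a + b) * (t - 1 / 2))
    * (U₂ - U + (2 * N + 2 * μ + 2 + a + b) * (t - 1 / 2))
  = t * (t - 1)
    * ((N + a + μ) * (N + b + μ) * (U₁ - Ud) - (2 * N + 2 * μ + a + b) * U
      - 1 / 4 * (a - b) ^ 2 * (2 * N + 2 * μ + a + b) * t
      + 1 / 4 * (b - a) * (2 * N * b + (b - a) * μ + b * (a + b)))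
    * ((N + a + μ + 1) * (N + b + μ + 1) * (U₂ - U) - (2 * N + 2 * μ + 2 + a + b) * U₁
      - 1 / 4 * (a - b) ^ 2 * (2 * N + 2 * μ + 2 + a + b) * t
      + 1 / 4 * (b - a) * (2 * N * b + (b - a) * (μ + 1) + b * (a + b)))

/-- The difference equation of the Cauchy case, relating the values `Ud, U, U₁, U₂` of the
σ-function at `μ-1, μ, μ+1, μ+2`. -/
def CauchyRecurrence (N : ℕ) (η₁ η₂ : ℝ) (μ t Ud U U₁ U₂ : ℂ) : Prop :=
  ((N + μ + 1 - 2 * η₁) * U - (N + μ - 2 * η₁) * U₁ + η₁ ^ 2 * t + η₂ * (N - η₁))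
    * ((N + μ + 1) * U - (N + μ) * U₁ + η₁ ^ 2 * t - η₂ * (N - η₁))
    * (U₁ - Ud + 2 * (N + μ - η₁) * t)
    * (U₂ - U + 2 * (N + μ + 1 - η₁) * t)
  = (1 + t ^ 2)
    * ((N + μ) * (N + μ - 2 * η₁) * (U₁ - Ud) - 2 * (N + μ - η₁) * U
      - 2 * η₁ ^ 2 * (N + μ - η₁) * t - 2 * η₁ * η₂ * (N - η₁))
    * ((N + μ + 1) * (N + μ + 1 - 2 * η₁) * (U₂ - U) - 2 * (N + μ + 1 - η₁) * U₁
      - 2 * η₁ ^ 2 * (N + μ + 1 - η₁) * t - 2 * η₁ * η₂ * (N - η₁))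

/-- The parameter values `μ-1, μ, μ+1, μ+2`. -/
def shifts (μ : ℂ) : Set ℂ := {μ - 1, μ, μ + 1, μ + 2}

end

/-! In the variable `u = s - x`, the average is `N!` times a Hankel determinant of moments
(Andréief). The weight is a product of powers with branch points `0`, `c₁ = s - γ₁`, `c₂ = s - γ₂`,
where `γ` is `0, 1` (Jacobi) or `I, -I` (Cauchy). Raising `ν` by one multiplies the weight by `u`,
which is a Christoffel transformation. The four averages are therefore four consecutive members of
one Christoffel chain, with `n = N - 1`.

Integrating the total derivative of the weight times `(x - γ₁)(x - γ₂)(s - x)` gives a Pearson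
equation, that is, a three-term recurrence of the moments. Two consequences carry the proof. The
derivative in `s` of each Hankel matrix is a combination of the matrix and its shift, so the
logarithmic derivative of the determinant is an affine function of the subleading coefficient of the
monic orthogonal polynomial (`trace_adjugate_hankel`). Also, the orthogonal polynomial `P` and the
dual polynomial `R` satisfy a 2×2 linear differential system in `u` (`exists_lax_row_one`,
`exists_lax_row_two`) whose matrix has the three branch points as singularities.

At each singular point the system matrix kills the nonzero vector `(P(c), R(c))`, so its determinant
vanishes there. At `0`, moreover, its kernel and range are given by the data of the next and of the
previous step of the chain (`kernel`, `range`). The determinants at `0, c₁, c₂` then give a relation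
between three consecutive levels (`three_term`). Comparing two consecutive systems at `c₁` and `c₂`
gives relations between two levels (`two_term`). Eliminating the auxiliary unknowns `y₁, y₂, w`
(`exists_isSystem`, `mul_relation`) leaves the stated equation, in the same way for both ensembles.

The analysis supplies convergence, the recurrence and differentiability of the moments. For small
real part of `ν` one cannot differentiate under the integral; the recurrence then expresses the
moment through two smoother ones (`hasMomentDeriv_of_eventually`). In the Cauchy case the last
recurrence may involve a divergent moment. A defect `ε` in the top degree absorbs it, and it affects
only the expression for the fourth logarithmic derivative, in a way that matches the algebra.
Complex `t` follows from the identity theorem for meromorphic functions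
(`relation_of_isPreconnected`). -/

noncomputable section

namespace UnitaryEnsemble

/-! ### Moment functionals and orthogonal pairs. -/

section Algebra

open Polynomial

variable {K : Type*} [Field K]

/-- The moment functional after multiplication of the weight by the variable. -/
def christoffel (L : K[X] →ₗ[K] K) : K[X] →ₗ[K] K := L ∘ₗ LinearMap.mulLeft K X

@[simp] lemma christoffel_apply (L : K[X] →ₗ[K] K) (f : K[X]) : christoffel L f = L (X * f) := rfl

lemma map_C_mul (L : K[X] →ₗ[K] K) (a : K) (f : K[X]) : L (C a * f) = a * L f := by
  rw [← smul_eq_C_mul, map_smul, smul_eq_mul]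

/-- `P` is the monic orthogonal polynomial of degree `n + 1` of the functional `L`, and `R` is the
polynomial of degree at most `n` which represents the coefficient of `X ^ n`. -/
structure IsOrthPair (n : ℕ) (L : K[X] →ₗ[K] K) (P R : K[X]) : Prop where
  monic : P.coeff (n + 1) = 1
  natDegree_le : P.natDegree ≤ n + 1
  natDegree_dual_le : R.natDegree ≤ n
  orth : ∀ f : K[X], f.natDegree ≤ n → L (P * f) = 0
  dual : ∀ f : K[X], f.natDegree ≤ n → L (R * f) = f.coeff n

/-- The functional `L` is nondegenerate on the polynomials of degree at most `n`. -/
def IsNondeg (n : ℕ) (L : K[X] →ₗ[K] K) : Prop :=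
  ∀ f : K[X], f.natDegree ≤ n → (∀ j ≤ n, L (f * X ^ j) = 0) → f = 0

/-- The Pearson polynomial of the weight with exponents `ν`, `a₁`, `a₂` at `0`, `c₁`, `c₂`. -/
def pearson (c₁ c₂ a₁ a₂ ν : K) : K[X] :=
  C (ν + 3 + a₁ + a₂) * X ^ 2
    - C ((ν + 1) * (c₁ + c₂) + (a₁ + 1) * c₂ + (a₂ + 1) * c₁) * X + C ((ν + 1) * (c₁ * c₂))

/-- The Pearson equation on polynomials of degree at most `d`, with defect `ε` at the top. -/
def IsPearson (c₁ c₂ a₁ a₂ ν ε : K) (d : ℕ) (L : K[X] →ₗ[K] K) : Prop :=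
  ∀ f : K[X], f.natDegree ≤ d →
    L (X * (X - C c₁) * (X - C c₂) * derivative f + pearson c₁ c₂ a₁ a₂ ν * f) = ε * f.coeff d

lemma X_mul_derivative_X_pow (j : ℕ) :
    (X : K[X]) * derivative (X ^ j) = C (j : K) * X ^ j := by
  cases j with
  | zero => simp
  | succ j => simp; ring

lemma coeff_X_mul_derivative (P : K[X]) (m : ℕ) :
    (X * derivative P).coeff m = m * P.coeff m := by
  cases m with
  | zero => simp
  | succ m => simp [coeff_X_mul, coeff_derivative]; ring

variable {n : ℕ} {L : K[X] →ₗ[K] K} {P R : K[X]}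

lemma natDegree_sub_C_mul_le {f Q : K[X]} {m : ℕ} (hf : f.natDegree ≤ m + 1)
    (hQ : Q.natDegree ≤ m + 1) (h1 : Q.coeff (m + 1) = 1) :
    (f - C (f.coeff (m + 1)) * Q).natDegree ≤ m := by
  rw [natDegree_le_iff_coeff_eq_zero]
  intro i hi
  rcases Nat.lt_or_ge (m + 1) i with h | h
  · simp [coeff_eq_zero_of_natDegree_lt (hf.trans_lt h),
      coeff_eq_zero_of_natDegree_lt (hQ.trans_lt h)]
  · obtain rfl : i = m + 1 := by omega
    simp [h1]

namespace IsOrthPair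

lemma orth_succ (H : IsOrthPair n L P R) {f : K[X]} (hf : f.natDegree ≤ n + 1) :
    L (P * f) = f.coeff (n + 1) * L (P * X ^ (n + 1)) := by
  have h := H.orth _ (natDegree_sub_C_mul_le hf (Q := X ^ (n + 1)) (by simp) (by simp))
  rw [mul_sub, map_sub, mul_left_comm, map_C_mul] at h
  linear_combination h

lemma dual_succ (H : IsOrthPair n L P R) {f : K[X]} (hf : f.natDegree ≤ n + 1) :
    L (R * f) = f.coeff n - P.coeff n * f.coeff (n + 1) := by
  have h := H.dual _ (natDegree_sub_C_mul_le hf H.natDegree_le H.monic)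
  have h2 := H.orth R H.natDegree_dual_le
  rw [mul_sub, map_sub, mul_left_comm, map_C_mul, mul_comm R P, h2, coeff_sub, coeff_C_mul] at h
  linear_combination h

/-- Subtracting a multiple of the monic `X * P` lowers the degree to that of `dual_succ`; the
subtracted term is `L (P * (X * R))`, which `orth_succ` evaluates. -/
lemma dual_succ_succ (H : IsOrthPair n L P R) {f : K[X]} (hf : f.natDegree ≤ n + 2) :
    L (R * f) = f.coeff n - P.coeff n * f.coeff (n + 1)
      + (R.coeff n * L (P * X ^ (n + 1)) + P.coeff n ^ 2 - (X * P).coeff n) * f.coeff (n + 2) := by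
  have hd : (X * P).natDegree ≤ n + 2 := by
    refine natDegree_mul_le.trans ?_
    have := H.natDegree_le
    have := natDegree_X_le (R := K)
    omega
  have h := H.dual_succ (natDegree_sub_C_mul_le (m := n + 1) hf hd (by simp [H.monic]))
  have h2 := H.orth_succ (f := X * R) (by
    refine natDegree_mul_le.trans ?_
    have := H.natDegree_dual_le
    have := natDegree_X_le (R := K)
    omega)
  rw [coeff_X_mul] at h2
  rw [mul_sub, map_sub, mul_left_comm, map_C_mul, show R * (X * P) = P * (X * R) by ring, h2] at h
  simp only [coeff_sub, coeff_C_mul, coeff_X_mul, show n + 1 + 1 = n + 2 from rfl] at h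
  linear_combination h

/-- The two members of an orthogonal pair have no common zero. -/
lemma no_common_zero (H : IsOrthPair n L P R) (c : K) (hP : P.eval c = 0) (hR : R.eval c = 0) :
    False := by
  obtain ⟨S, hS⟩ := dvd_iff_isRoot.2 hP
  obtain ⟨T, hT⟩ := dvd_iff_isRoot.2 hR
  have hP0 : P ≠ 0 := fun h => by simpa [h] using H.monic
  have hS0 : S ≠ 0 := fun h => hP0 (by simp [hS, h])
  have hSd : S.natDegree ≤ n := by
    have := H.natDegree_le
    rw [hS, natDegree_mul (X_sub_C_ne_zero c) hS0, natDegree_X_sub_C] at this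
    omega
  have hSc : S.coeff n = 1 := by
    have := H.monic
    rw [hS, sub_mul, coeff_sub, coeff_X_mul, coeff_C_mul,
      coeff_eq_zero_of_natDegree_lt (n := n + 1) (by omega)] at this
    simpa using this
  have hTd : T.natDegree ≤ n := by
    by_cases hT0 : T = 0
    · simp [hT0]
    have := H.natDegree_dual_le
    rw [hT, natDegree_mul (X_sub_C_ne_zero c) hT0, natDegree_X_sub_C] at this
    omega
  have h1 := H.dual S hSd
  have h2 := H.orth T hTd
  -- With `P = (X - c) S` and `R = (X - c) T`, the number `L (P * T) = L (R * S)` is `0` by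
  -- orthogonality and `1` by duality.
  rw [hS, show (X - C c) * S * T = R * S by rw [hT]; ring, h1, hSc] at h2
  exact one_ne_zero h2

end IsOrthPair

/-! ### The 2×2 differential system of an orthogonal pair. -/

section Lax

variable {c₁ c₂ a₁ a₂ ν ε : K}

/-- Completes `σ Q' X ^ j` to the Pearson operator applied to `Q * X ^ j`, so that pairings of
derivatives reduce to pairings of `Q` with powers. -/
lemma map_sigma_derivative (Q : K[X]) (j : ℕ) (a₁ a₂ ν c₁ c₂ : K) :
    L (X * (X - C c₁) * (X - C c₂) * derivative Q * X ^ j)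
      = L (X * (X - C c₁) * (X - C c₂) * derivative (Q * X ^ j)
          + pearson c₁ c₂ a₁ a₂ ν * (Q * X ^ j))
        - ((j + (ν + 3 + a₁ + a₂)) * L (Q * X ^ (j + 2))
          - (j * (c₁ + c₂) + ((ν + 1) * (c₁ + c₂) + (a₁ + 1) * c₂ + (a₂ + 1) * c₁))
            * L (Q * X ^ (j + 1))
          + (j * (c₁ * c₂) + (ν + 1) * (c₁ * c₂)) * L (Q * X ^ j)) := by
  simp only [← map_C_mul, ← map_sub, ← map_add]
  congr 1
  rw [derivative_mul]
  have h := X_mul_derivative_X_pow (K := K) j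
  simp only [pearson, C_add, C_mul]
  linear_combination (-(X - C c₁) * (X - C c₂) * Q) * h

lemma coeff_sigma_derivative (Q : K[X]) (m : ℕ) :
    (X * (X - C c₁) * (X - C c₂) * derivative Q).coeff (m + 2)
      = m * Q.coeff m - (c₁ + c₂) * ((m + 1) * Q.coeff (m + 1))
        + c₁ * c₂ * ((m + 2) * Q.coeff (m + 2)) := by
  have : X * (X - C c₁) * (X - C c₂) * derivative Q
      = X * (X * (X * derivative Q)) - C (c₁ + c₂) * (X * (X * derivative Q))
        + C (c₁ * c₂) * (X * derivative Q) := by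
    simp only [C_add, C_mul]; ring
  rw [this, coeff_add, coeff_sub, coeff_C_mul, coeff_C_mul, coeff_X_mul, coeff_X_mul, coeff_X_mul,
    coeff_X_mul_derivative, coeff_X_mul_derivative, coeff_X_mul_derivative]
  push_cast
  ring

lemma coeff_sigma_derivative_one (Q : K[X]) :
    (X * (X - C c₁) * (X - C c₂) * derivative Q).coeff 1 = c₁ * c₂ * Q.coeff 1 := by
  have : X * (X - C c₁) * (X - C c₂) * derivative Q
      = X * (X * (X * derivative Q)) - C (c₁ + c₂) * (X * (X * derivative Q))
        + C (c₁ * c₂) * (X * derivative Q) := by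
    simp only [C_add, C_mul]; ring
  rw [this, coeff_add, coeff_sub, coeff_C_mul, coeff_C_mul, coeff_X_mul_derivative, coeff_X_mul,
    coeff_X_mul, mul_coeff_zero, mul_coeff_zero, coeff_X_zero]
  simp

/-- The first row of the differential system satisfied by an orthogonal pair. -/
lemma exists_lax_row_one (H : IsOrthPair n L P R) (hL : IsNondeg n L)
    (hP : IsPearson c₁ c₂ a₁ a₂ ν ε (2 * n) L) :
    ∃ b₀ : K, X * (X - C c₁) * (X - C c₂) * derivative P
      = (C ((n : K) + 1) * X ^ 2 - C (P.coeff n + (n + 1) * (c₁ + c₂)) * X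
          + C (-2 * (X * P).coeff n + (c₁ + c₂) * P.coeff n + c₁ * c₂ * (n + 1) + P.coeff n ^ 2
            - (ε - (2 * n + 3 + a₁ + a₂ + ν) * L (P * X ^ (n + 1))) * R.coeff n)) * P
        + (C (ε - (2 * n + 3 + a₁ + a₂ + ν) * L (P * X ^ (n + 1))) * X + C b₀) * R := by
  set p := P.coeff n
  set r := R.coeff n
  set h := L (P * X ^ (n + 1))
  -- The coefficient of index `n - 1` in `P`, written so that it is zero for `n = 0`.
  set p₂ := (X * P).coeff n with hp₂
  set b₁ := ε - (2 * n + 3 + a₁ + a₂ + ν) * h with hb₁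
  set y := -2 * p₂ + (c₁ + c₂) * p + c₁ * c₂ * (n + 1) + p ^ 2 - b₁ * r with hy
  -- The coefficients of `X ^ 2 * P` and `X * P` remove degrees `n + 3` and `n + 2`, `y` removes
  -- degree `n + 1`, and `b₁` removes the pairing with `X ^ (n - 1)`. What is left must be a
  -- multiple of `R`.
  set F := X * (X - C c₁) * (X - C c₂) * derivative P
    - (C ((n : K) + 1) * X ^ 2 - C (p + (n + 1) * (c₁ + c₂)) * X + C y) * P - C b₁ * X * R with hF
  have hF' : F = X * (X - C c₁) * (X - C c₂) * derivative P - C ((n : K) + 1) * (X ^ 2 * P)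
      + C (p + (n + 1) * (c₁ + c₂)) * (X * P) - C y * P - C b₁ * (X * R) := by
    rw [hF]; ring
  clear_value F y
  -- `P * X ^ n` has degree `2 n + 1`, beyond the range of the Pearson equation, so this one pairing
  -- stays unknown; it is the multiple of `R`.
  refine ⟨L (F * X ^ n), ?_⟩
  have hPz : ∀ i, n + 1 < i → P.coeff i = 0 := fun i hi =>
    coeff_eq_zero_of_natDegree_lt (H.natDegree_le.trans_lt hi)
  have hRz : ∀ i, n < i → R.coeff i = 0 := fun i hi =>
    coeff_eq_zero_of_natDegree_lt (H.natDegree_dual_le.trans_lt hi)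
  have hFc : ∀ m, F.coeff (m + 2) = m * P.coeff m - (c₁ + c₂) * ((m + 1) * P.coeff (m + 1))
        + c₁ * c₂ * ((m + 2) * P.coeff (m + 2)) - ((n + 1) * P.coeff m
        - (p + (n + 1) * (c₁ + c₂)) * P.coeff (m + 1) + y * P.coeff (m + 2))
        - b₁ * R.coeff (m + 1) := by
    intro m
    rw [hF', coeff_sub, coeff_sub, coeff_add, coeff_sub, coeff_sigma_derivative,
      coeff_C_mul, coeff_C_mul, coeff_C_mul, coeff_C_mul, coeff_X_pow_mul, coeff_X_mul, coeff_X_mul]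
    ring
  have hdeg : (F - C (L (F * X ^ n)) * R).natDegree ≤ n := by
    rw [natDegree_le_iff_coeff_eq_zero]
    intro i hi
    rw [coeff_sub, coeff_C_mul, hRz i hi, mul_zero, sub_zero]
    rcases Nat.lt_or_ge i (n + 2) with h1 | h1
    · obtain rfl : i = n + 1 := by omega
      rcases Nat.eq_zero_or_pos n with h0 | h0
      · subst h0
        have e1 : p₂ = 0 := by simp [hp₂]
        have e2 : P.coeff 1 = 1 := H.monic
        have e3 : (X ^ 2 * P).coeff 1 = 0 := by
          rw [pow_two, mul_assoc]; exact (coeff_X_mul _ 0).trans (by simp)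
        rw [hF', coeff_sub, coeff_sub, coeff_add, coeff_sub, zero_add, coeff_sigma_derivative_one,
          coeff_C_mul, coeff_C_mul, coeff_C_mul, coeff_C_mul, e3, coeff_X_mul, coeff_X_mul, e2, hy,
          e1]
        simp only [Nat.cast_zero]
        change _ - _ + _ * p - _ - b₁ * r = 0
        ring
      · obtain ⟨k, rfl⟩ := Nat.exists_eq_add_of_le' h0
        have e1 : P.coeff k = p₂ := by rw [hp₂, coeff_X_mul]
        rw [hFc, show P.coeff (k + 2) = 1 from H.monic, e1, hy]
        change _ - (c₁ + c₂) * ((k + 1) * p) + _ - (_ - _ * p + _) - b₁ * r = 0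
        push_cast
        ring
    · obtain ⟨k, rfl⟩ := Nat.exists_eq_add_of_le' (show 2 ≤ i by omega)
      rw [hFc, hRz _ (by omega), hPz (k + 2) (by omega)]
      rcases Nat.lt_or_ge k (n + 1) with h2 | h2
      · obtain rfl : k = n := by omega
        rw [H.monic]
        change k * p - _ + _ - (_ * p - _ + _) - _ = 0
        ring
      · rw [hPz (k + 1) (by omega)]
        rcases Nat.lt_or_ge k (n + 2) with h3 | h3
        · obtain rfl : k = n + 1 := by omega
          push_cast; ring
        · rw [hPz k (by omega)]; ring
  have hu : ∀ i ≤ n, L (P * X ^ i) = 0 := fun i hi => H.orth _ (by simpa using hi)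
  have hv : ∀ i < n, L (R * X ^ i) = 0 := fun i hi => by
    rw [H.dual _ (by simpa using hi.le), coeff_X_pow, if_neg (by omega)]
  have hvn : L (R * X ^ n) = 1 := by rw [H.dual _ (by simp), coeff_X_pow, if_pos rfl]
  have key : ∀ j < n, L (F * X ^ j) = 0 := by
    intro j hj
    have e1 : L (F * X ^ j) = L (X * (X - C c₁) * (X - C c₂) * derivative P * X ^ j)
        - ((n + 1) * L (P * X ^ (j + 2)) - (p + (n + 1) * (c₁ + c₂)) * L (P * X ^ (j + 1))
          + y * L (P * X ^ j)) - b₁ * L (R * X ^ (j + 1)) := by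
      simp only [← map_C_mul, ← map_sub, ← map_add]
      congr 1
      rw [hF]
      ring
    have hd : (P * X ^ j).natDegree ≤ 2 * n := by
      refine natDegree_mul_le.trans ?_
      have := H.natDegree_le
      have := natDegree_X_pow_le (R := K) j
      omega
    rw [e1, map_sigma_derivative P j a₁ a₂ ν, hP _ hd, coeff_mul_X_pow', if_pos (by omega),
      hu j (by omega), hu (j + 1) (by omega)]
    rcases Nat.lt_or_ge (j + 1) n with h2 | h2
    · rw [hu (j + 2) (by omega), hv _ h2, hPz _ (by omega)]
      ring
    -- The only index at which `P * X ^ j` reaches the top degree `2 n`, hence the only place where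
    -- the defect `ε` enters.
    · obtain rfl : n = j + 1 := by omega
      rw [hvn, show 2 * (j + 1) - j = j + 1 + 1 by omega, H.monic, hb₁]
      push_cast
      change _ - (_ * h - _ + _) - (_ * h - _ + _) - _ = 0
      ring
  have := hL _ hdeg (fun j hj => by
    rw [sub_mul, map_sub, mul_assoc, map_C_mul]
    rcases Nat.lt_or_ge j n with h2 | h2
    · rw [key j h2, hv j h2, mul_zero, sub_zero]
    · obtain rfl : j = n := by omega
      rw [hvn, mul_one, sub_self])
  linear_combination this - hF

/-- The second row of the differential system satisfied by an orthogonal pair. -/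
lemma exists_lax_row_two (H : IsOrthPair n L P R) (hL : IsNondeg n L)
    (hP : IsPearson c₁ c₂ a₁ a₂ ν ε (2 * n) L) :
    ∃ d₀ : K, X * (X - C c₁) * (X - C c₂) * derivative R
      = (C ((2 * n + 1 + a₁ + a₂ + ν) * R.coeff n) * X + C d₀) * P
        + (-(C ν * (X - C c₁) * (X - C c₂) + C a₁ * X * (X - C c₂) + C a₂ * X * (X - C c₁))
          - (C ((n : K) + 1) * X ^ 2 - C (P.coeff n + (n + 1) * (c₁ + c₂)) * X
          + C (-2 * (X * P).coeff n + (c₁ + c₂) * P.coeff n + c₁ * c₂ * (n + 1) + P.coeff n ^ 2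
            - (ε - (2 * n + 3 + a₁ + a₂ + ν) * L (P * X ^ (n + 1))) * R.coeff n))) * R := by
  set p := P.coeff n
  set r := R.coeff n
  set h := L (P * X ^ (n + 1))
  set p₂ := (X * P).coeff n with hp₂
  set b₁ := ε - (2 * n + 3 + a₁ + a₂ + ν) * h with hb₁
  set y := -2 * p₂ + (c₁ + c₂) * p + c₁ * c₂ * (n + 1) + p ^ 2 - b₁ * r with hy
  set g := (2 * n + 1 + a₁ + a₂ + ν) * r with hg
  set F := X * (X - C c₁) * (X - C c₂) * derivative R - C g * X * P
    - (-(C ν * (X - C c₁) * (X - C c₂) + C a₁ * X * (X - C c₂) + C a₂ * X * (X - C c₁))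
      - (C ((n : K) + 1) * X ^ 2 - C (p + (n + 1) * (c₁ + c₂)) * X + C y)) * R with hF
  set d₂ := ν + a₁ + a₂ + n + 1 with hd₂
  set d₁ := ν * (c₁ + c₂) + a₁ * c₂ + a₂ * c₁ + p + (n + 1) * (c₁ + c₂) with hd₁
  set d₀ := ν * (c₁ * c₂) + y with hd₀
  have hF' : F = X * (X - C c₁) * (X - C c₂) * derivative R - C g * (X * P)
      + C d₂ * (X ^ 2 * R) - C d₁ * (X * R) + C d₀ * R := by
    rw [hF, hd₀, hd₁, hd₂]
    simp only [C_add, C_mul, map_one]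
    ring
  clear_value F d₂ d₁ d₀
  -- In this row the free constant multiplies the monic `P`, so it is read off from a coefficient
  -- instead of a pairing.
  refine ⟨F.coeff (n + 1), ?_⟩
  have hPz : ∀ i, n + 1 < i → P.coeff i = 0 := fun i hi =>
    coeff_eq_zero_of_natDegree_lt (H.natDegree_le.trans_lt hi)
  have hRz : ∀ i, n < i → R.coeff i = 0 := fun i hi =>
    coeff_eq_zero_of_natDegree_lt (H.natDegree_dual_le.trans_lt hi)
  have hFc : ∀ m, F.coeff (m + 2) = m * R.coeff m - (c₁ + c₂) * ((m + 1) * R.coeff (m + 1))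
        + c₁ * c₂ * ((m + 2) * R.coeff (m + 2)) - g * P.coeff (m + 1)
        + d₂ * R.coeff m - d₁ * R.coeff (m + 1) + d₀ * R.coeff (m + 2) := by
    intro m
    rw [hF', coeff_add, coeff_sub, coeff_add, coeff_sub, coeff_sigma_derivative,
      coeff_C_mul, coeff_C_mul, coeff_C_mul, coeff_C_mul,
      coeff_X_pow_mul, coeff_X_mul, coeff_X_mul]
  have hdeg : (F - C (F.coeff (n + 1)) * P).natDegree ≤ n := by
    refine natDegree_sub_C_mul_le ?_ H.natDegree_le H.monic
    rw [natDegree_le_iff_coeff_eq_zero]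
    intro i hi
    obtain ⟨k, rfl⟩ := Nat.exists_eq_add_of_le' (show 2 ≤ i by omega)
    rw [hFc, hRz (k + 1) (by omega), hRz (k + 2) (by omega)]
    rcases Nat.lt_or_ge k (n + 1) with h2 | h2
    · obtain rfl : k = n := by omega
      rw [H.monic]
      change k * r - _ + _ - _ + _ * r - _ + _ = 0
      rw [hd₂, hg]; ring
    · rw [hPz (k + 1) (by omega), hRz k (by omega)]
      ring
  have hu : ∀ i ≤ n, L (P * X ^ i) = 0 := fun i hi => H.orth _ (by simpa using hi)
  have hv : ∀ i < n, L (R * X ^ i) = 0 := fun i hi => by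
    rw [H.dual _ (by simpa using hi.le), coeff_X_pow, if_neg (by omega)]
  have hvn : L (R * X ^ n) = 1 := by rw [H.dual _ (by simp), coeff_X_pow, if_pos rfl]
  have hvn1 : L (R * X ^ (n + 1)) = -p := by
    rw [H.dual_succ (by simp), coeff_X_pow, if_neg (by omega), coeff_X_pow, if_pos rfl]
    ring
  have hvn2 : L (R * X ^ (n + 2)) = r * h + p ^ 2 - p₂ := by
    rw [H.dual_succ_succ (by simp), coeff_X_pow, if_neg (by omega), coeff_X_pow,
      if_neg (by omega), coeff_X_pow, if_pos rfl]
    ring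
  have := hL _ hdeg (fun j hj => by
    have e1 : L ((F - C (F.coeff (n + 1)) * P) * X ^ j)
        = L (X * (X - C c₁) * (X - C c₂) * derivative R * X ^ j)
        - g * L (P * X ^ (j + 1)) + d₂ * L (R * X ^ (j + 2)) - d₁ * L (R * X ^ (j + 1))
        + d₀ * L (R * X ^ j) - F.coeff (n + 1) * L (P * X ^ j) := by
      simp only [← map_C_mul, ← map_sub, ← map_add]
      congr 1
      linear_combination X ^ j * hF'
    have hd : (R * X ^ j).natDegree ≤ 2 * n := by
      refine natDegree_mul_le.trans ?_
      have := H.natDegree_dual_le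
      have := natDegree_X_pow_le (R := K) j
      omega
    rw [e1, map_sigma_derivative R j a₁ a₂ ν, hP _ hd, coeff_mul_X_pow', if_pos (by omega),
      hu j hj]
    rcases Nat.lt_or_ge j n with h2 | h2
    · rw [hu (j + 1) h2, hv j h2, hRz _ (by omega)]
      rcases Nat.lt_or_ge (j + 1) n with h3 | h3
      · rw [hv _ h3]
        rcases Nat.lt_or_ge (j + 2) n with h4 | h4
        · rw [hv _ h4]; ring
        · obtain rfl : n = j + 2 := by omega
          rw [hvn, hd₂]
          push_cast
          ring
      · obtain rfl : n = j + 1 := by omega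
        rw [hvn, hvn1, hd₂, hd₁]
        push_cast
        ring
    -- No constant is free here: the pairing vanishes because `y` is the one of the first row. This
    -- is what fixes the trace of the system matrix.
    · obtain rfl : j = n := by omega
      rw [hvn, hvn1, hvn2, show 2 * j - j = j by omega, hd₂, hd₁, hd₀, hy, hb₁, hg]
      change ε * r - _ - _ * h + _ - _ + _ - _ = 0
      ring)
  linear_combination this - hF

end Lax

end Algebra

/-! ### The Christoffel transformation and its compatibility with the system. -/

section Algebra

open Polynomial

variable {K : Type*} [Field K] {n : ℕ} {L : K[X] →ₗ[K] K} {P R P₁ R₁ : K[X]}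

/-- The Pearson operator for `ν` applied to `X * f` is `X` times the operator for `ν + 1` applied to
`f`. One degree is lost and the defect is kept. -/
lemma IsPearson.christoffel {c₁ c₂ a₁ a₂ ν ε : K} {d : ℕ}
    (h : IsPearson c₁ c₂ a₁ a₂ ν ε (d + 1) L) :
    IsPearson c₁ c₂ a₁ a₂ (ν + 1) ε d (christoffel L) := by
  intro f hf
  have := h (X * f) (by
    refine natDegree_mul_le.trans ?_
    have := natDegree_X_le (R := K)
    omega)
  rw [coeff_X_mul] at this
  rw [← this, christoffel_apply]
  congr 1
  simp only [pearson, derivative_mul, derivative_X, C_add, C_mul, map_one]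
  ring

namespace IsOrthPair

variable (H : IsOrthPair n L P R) (H₁ : IsOrthPair n (christoffel L) P₁ R₁)

include H H₁

/-- `X * R₁` and `R` have the same pairings under `L` with degree at most `n`; the multiple of `P`
corrects the top coefficient without changing them. -/
lemma X_mul_dual (hL : IsNondeg n L) : X * R₁ = R + C (R₁.coeff n) * P := by
  have hd : (X * R₁ - R).natDegree ≤ n + 1 := by
    refine (natDegree_sub_le _ _).trans (max_le ?_ (H.natDegree_dual_le.trans n.le_succ))
    refine natDegree_mul_le.trans ?_
    have := H₁.natDegree_dual_le
    have := natDegree_X_le (R := K)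
    omega
  have hc : (X * R₁ - R).coeff (n + 1) = R₁.coeff n := by
    rw [coeff_sub, coeff_X_mul,
      coeff_eq_zero_of_natDegree_lt (H.natDegree_dual_le.trans_lt n.lt_succ_self), sub_zero]
  have hd' := natDegree_sub_C_mul_le hd H.natDegree_le H.monic
  rw [hc] at hd'
  have := hL _ hd' (fun j hj => by
    have hj' : (X ^ j : K[X]).natDegree ≤ n := by simpa using hj
    have e1 := H₁.dual _ hj'
    rw [christoffel_apply] at e1
    rw [sub_mul, sub_mul, mul_assoc, mul_assoc, map_sub, map_sub, map_C_mul, e1, H.dual _ hj',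
      H.orth _ hj']
    ring)
  linear_combination this

/-- `P - P₁` has degree at most `n`, and under the shifted functional it sees only `X ^ n`, as a
multiple of `R₁` does. -/
lemma orth_step (hL : IsNondeg n (UnitaryEnsemble.christoffel L)) :
    P₁ = P - C (L (P * X ^ (n + 1))) * R₁ := by
  have hd : (P - P₁ - C (L (P * X ^ (n + 1))) * R₁).natDegree ≤ n := by
    refine (natDegree_sub_le _ _).trans (max_le ?_ ((natDegree_C_mul_le _ _).trans
      H₁.natDegree_dual_le))
    have := natDegree_sub_C_mul_le H.natDegree_le H₁.natDegree_le H₁.monic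
    rwa [H.monic, C_1, one_mul] at this
  have := hL _ hd (fun j hj => by
    have hj' : (X ^ j : K[X]).natDegree ≤ n := by simpa using hj
    have e2 : christoffel L (P * X ^ j) = L (P * X ^ (j + 1)) := by
      rw [christoffel_apply]; congr 1; ring
    rw [sub_mul, sub_mul, mul_assoc, map_sub, map_sub, map_C_mul, H₁.dual _ hj', H₁.orth _ hj', e2,
      coeff_X_pow]
    rcases Nat.lt_or_ge j n with h | h
    · rw [H.orth _ (by simpa using h), if_neg (by omega)]; ring
    · obtain rfl : j = n := by omega
      rw [if_pos rfl]; ring)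
  linear_combination -this

lemma eval_zero_dual (hL : IsNondeg n L) : R.eval 0 = -(R₁.coeff n * P.eval 0) := by
  have := congrArg (eval 0) (H.X_mul_dual H₁ hL)
  simp only [eval_mul, eval_X, zero_mul, eval_add, eval_C] at this
  linear_combination -this

lemma eval_zero_ne_zero (hL : IsNondeg n L) : P.eval 0 ≠ 0 := fun h =>
  H.no_common_zero 0 h (by rw [H.eval_zero_dual H₁ hL, h, mul_zero, neg_zero])

-- Split `P` into its constant term and a multiple of `X` in `L (P * R₁) = 0`; the second part is a
-- pairing of the dual `R₁` with the monic `P.divX`.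
omit H₁ in
lemma map_dual_mul (R₁ : K[X]) (H₁ : IsOrthPair n (UnitaryEnsemble.christoffel L) P₁ R₁) :
    P.eval 0 * L R₁ = -1 := by
  have h1 := H.orth R₁ H₁.natDegree_dual_le
  have hd : P.divX.natDegree ≤ n := by
    have := H.natDegree_le
    rw [natDegree_divX_eq_natDegree_tsub_one]; omega
  have h2 := H₁.dual _ hd
  rw [christoffel_apply, coeff_divX, H.monic] at h2
  have h3 : P * R₁ = C (P.eval 0) * R₁ + X * (R₁ * P.divX) := by
    conv_lhs => rw [← X_mul_divX_add P]
    rw [coeff_zero_eq_eval_zero]; ring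
  rw [h3, map_add, map_C_mul, h2] at h1
  linear_combination h1

lemma map_dual_ne_zero : L R₁ ≠ 0 := fun h => by
  have := H.map_dual_mul R₁ H₁
  rw [h, mul_zero] at this
  exact one_ne_zero (neg_eq_zero.1 this.symm)

lemma map_next (hL : IsNondeg n (UnitaryEnsemble.christoffel L)) :
    L P₁ = -(L (P * X ^ (n + 1)) * L R₁) := by
  have h := H.orth 1 (by simp)
  rw [mul_one] at h
  rw [H.orth_step H₁ hL, map_sub, map_C_mul, h, zero_sub]

end IsOrthPair

/-- The differential system satisfied by an orthogonal pair. -/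
structure IsLax (n : ℕ) (c₁ c₂ a₁ a₂ ν b₁ b₀ g d₀ y : K) (P R : K[X]) : Prop where
  row_one : X * (X - C c₁) * (X - C c₂) * derivative P
      = (C ((n : K) + 1) * X ^ 2 - C (P.coeff n + (n + 1) * (c₁ + c₂)) * X + C y) * P
        + (C b₁ * X + C b₀) * R
  row_two : X * (X - C c₁) * (X - C c₂) * derivative R = (C g * X + C d₀) * P
        + (-(C ν * (X - C c₁) * (X - C c₂) + C a₁ * X * (X - C c₂) + C a₂ * X * (X - C c₁))
          - (C ((n : K) + 1) * X ^ 2 - C (P.coeff n + (n + 1) * (c₁ + c₂)) * X + C y)) * R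

lemma IsOrthPair.exists_isLax {c₁ c₂ a₁ a₂ ν ε : K} (H : IsOrthPair n L P R)
    (hL : IsNondeg n L) (hP : IsPearson c₁ c₂ a₁ a₂ ν ε (2 * n) L) :
    ∃ y b₀ d₀, IsLax n c₁ c₂ a₁ a₂ ν (ε - (2 * n + 3 + a₁ + a₂ + ν) * L (P * X ^ (n + 1))) b₀
      ((2 * n + 1 + a₁ + a₂ + ν) * R.coeff n) d₀ y P R := by
  obtain ⟨b₀, h1⟩ := exists_lax_row_one H hL hP
  obtain ⟨d₀, h2⟩ := exists_lax_row_two H hL hP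
  exact ⟨_, b₀, d₀, h1, h2⟩

namespace IsLax

variable {c₁ c₂ a₁ a₂ ν ε b₁ b₀ g d₀ y : K}

lemma eval_row_one (h : IsLax n c₁ c₂ a₁ a₂ ν b₁ b₀ g d₀ y P R) {c : K}
    (hc : c * (c - c₁) * (c - c₂) = 0) :
    ((n + 1) * c ^ 2 - (P.coeff n + (n + 1) * (c₁ + c₂)) * c + y) * P.eval c
      + (b₁ * c + b₀) * R.eval c = 0 := by
  have := congrArg (eval c) h.row_one
  simp only [eval_mul, eval_add, eval_sub, eval_X, eval_C, eval_pow] at this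
  rw [hc, zero_mul] at this
  exact this.symm

lemma eval_row_two (h : IsLax n c₁ c₂ a₁ a₂ ν b₁ b₀ g d₀ y P R) {c : K}
    (hc : c * (c - c₁) * (c - c₂) = 0) :
    (g * c + d₀) * P.eval c
      + (-(ν * (c - c₁) * (c - c₂) + a₁ * c * (c - c₂) + a₂ * c * (c - c₁))
        - ((n + 1) * c ^ 2 - (P.coeff n + (n + 1) * (c₁ + c₂)) * c + y)) * R.eval c = 0 := by
  have := congrArg (eval c) h.row_two
  simp only [eval_mul, eval_add, eval_sub, eval_X, eval_C, eval_pow, eval_neg] at this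
  rw [hc, zero_mul] at this
  exact this.symm

lemma _root_.UnitaryEnsemble.det_eq_zero_of_kernel {a b c d u v : K} (h1 : a * u + b * v = 0)
    (h2 : c * u + d * v = 0) (h : ¬(u = 0 ∧ v = 0)) : a * d = b * c := by
  by_cases hu : u = 0
  · have hv : v ≠ 0 := fun hv => h ⟨hu, hv⟩
    refine mul_right_cancel₀ hv ?_
    linear_combination a * h2 - c * h1
  · refine mul_right_cancel₀ hu ?_
    linear_combination d * h1 - b * h2

/-- At a zero of the cubic the derivatives drop out, and `(P(c), R(c))` is a nonzero kernel vector
of the system matrix. -/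
lemma det (h : IsLax n c₁ c₂ a₁ a₂ ν b₁ b₀ g d₀ y P R) (H : IsOrthPair n L P R) {c : K}
    (hc : c * (c - c₁) * (c - c₂) = 0) :
    ((n + 1) * c ^ 2 - (P.coeff n + (n + 1) * (c₁ + c₂)) * c + y)
      * (-(ν * (c - c₁) * (c - c₂) + a₁ * c * (c - c₂) + a₂ * c * (c - c₁))
        - ((n + 1) * c ^ 2 - (P.coeff n + (n + 1) * (c₁ + c₂)) * c + y))
      = (b₁ * c + b₀) * (g * c + d₀) :=
  det_eq_zero_of_kernel (h.eval_row_one hc) (h.eval_row_two hc)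
    fun h0 => H.no_common_zero c h0.1 h0.2

/-- Evaluation of the system at the zero of the variable: the kernel. -/
lemma kernel (h : IsLax n c₁ c₂ a₁ a₂ ν b₁ b₀ g d₀ y P R) (H : IsOrthPair n L P R)
    (H₁ : IsOrthPair n (christoffel L) P₁ R₁) (hL : IsNondeg n L) :
    y = R₁.coeff n * b₀ ∧ d₀ = -(R₁.coeff n * (ν * (c₁ * c₂) + y)) := by
  have h0 := H.eval_zero_ne_zero H₁ hL
  have h1 := h.eval_row_one (c := 0) (by ring)
  have h2 := h.eval_row_two (c := 0) (by ring)
  rw [H.eval_zero_dual H₁ hL] at h1 h2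
  constructor
  · refine mul_right_cancel₀ h0 ?_
    linear_combination h1
  · refine mul_right_cancel₀ h0 ?_
    linear_combination h2

/-- Evaluation of the system at the zero of the variable: the range. -/
lemma range (h : IsLax n c₁ c₂ a₁ a₂ ν (ε - (2 * n + 3 + a₁ + a₂ + ν)
      * christoffel L (P₁ * X ^ (n + 1))) b₀ g d₀ y P₁ R₁) (H : IsOrthPair n L P R)
    (H₁ : IsOrthPair n (christoffel L) P₁ R₁) (hL₁ : IsNondeg n (christoffel L))
    (hP : IsPearson c₁ c₂ a₁ a₂ (ν - 1) ε (2 * n + 1) L) :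
    y = -(L (P * X ^ (n + 1)) * d₀) ∧ b₀ = L (P * X ^ (n + 1)) * (ν * (c₁ * c₂) + y) := by
  have h0 := H.map_dual_ne_zero H₁
  have hm := H.map_next H₁ hL₁
  set h' := L (P * X ^ (n + 1))
  set h₁ := christoffel L (P₁ * X ^ (n + 1)) with hh₁
  set p := P₁.coeff n with hp
  -- The functional `L`, of exponent `ν - 1`, is applied to both rows of the system of the next
  -- level. Terms divisible by `X` are evaluated by orthogonality for `christoffel L`; the rest
  -- involves only `L P₁` and `L R₁`, whose ratio is `-h'`.
  have hlin : ∀ a b : K, (C a * X + C b).natDegree ≤ 1 := fun a b => by compute_degree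
  have hlc : ∀ a b : K, ∀ m, (C a * X + C b).coeff m
      = if m = 0 then b else if m = 1 then a else 0 := by
    intro a b m
    rcases m with _ | _ | m
    · simp
    · simp [coeff_C]
    · rw [if_neg (by omega), if_neg (by omega)]
      exact coeff_eq_zero_of_natDegree_lt ((hlin a b).trans_lt (by omega))
  constructor
  · have e1 := hP R₁ (H₁.natDegree_dual_le.trans (by omega))
    rw [coeff_eq_zero_of_natDegree_lt (H₁.natDegree_dual_le.trans_lt (by omega)), mul_zero,
      h.row_two] at e1
    have e2 := H₁.dual_succ (f := C (1 - (n : K)) * X + C (p + n * (c₁ + c₂)))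
      ((hlin _ _).trans (by omega))
    have e3 := H₁.orth 1 (by simp)
    have e4 : (C g * X + C d₀) * P₁
        + (-(C ν * (X - C c₁) * (X - C c₂) + C a₁ * X * (X - C c₂) + C a₂ * X * (X - C c₁))
          - (C ((n : K) + 1) * X ^ 2 - C (p + (n + 1) * (c₁ + c₂)) * X + C y)) * R₁
        + pearson c₁ c₂ a₁ a₂ (ν - 1) * R₁ = C g * (X * (P₁ * 1)) + C d₀ * P₁
          + X * (R₁ * (C (1 - (n : K)) * X + C (p + n * (c₁ + c₂)))) - C y * R₁ := by
      simp only [pearson, C_add, C_mul, C_sub, map_one, map_natCast, map_ofNat]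
      ring
    rw [e4, map_sub, map_add, map_add, map_C_mul, map_C_mul, map_C_mul, hm] at e1
    rw [christoffel_apply] at e2 e3
    rw [e2, e3, hlc, hlc] at e1
    refine mul_right_cancel₀ h0 ?_
    rcases n with _ | _ | n
    · simp at e1; linear_combination -e1
    · simp at e1; linear_combination -e1
    · simp at e1; linear_combination -e1
  · have e1 := hP P₁ (H₁.natDegree_le.trans (by omega))
    rw [h.row_one] at e1
    have e2 := H₁.orth_succ (f := C (n + 3 + a₁ + a₂ + ν : K) * X + C (-(p + (n + 1) * (c₁ + c₂))
      - (ν * (c₁ + c₂) + (a₁ + 1) * c₂ + (a₂ + 1) * c₁))) ((hlin _ _).trans (by omega))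
    have e3 := H₁.dual 1 (by simp)
    have e4 : (C ((n : K) + 1) * X ^ 2 - C (p + (n + 1) * (c₁ + c₂)) * X + C y) * P₁
        + (C (ε - (2 * n + 3 + a₁ + a₂ + ν) * h₁) * X + C b₀) * R₁
        + pearson c₁ c₂ a₁ a₂ (ν - 1) * P₁ = X * (P₁ * (C (n + 3 + a₁ + a₂ + ν : K) * X
          + C (-(p + (n + 1) * (c₁ + c₂)) - (ν * (c₁ + c₂) + (a₁ + 1) * c₂ + (a₂ + 1) * c₁))))
          + C (ε - (2 * n + 3 + a₁ + a₂ + ν) * h₁) * (X * (R₁ * 1)) + C b₀ * R₁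
          + C (ν * (c₁ * c₂) + y) * P₁ := by
      simp only [pearson, C_add, C_mul, C_sub, C_neg, map_one, map_natCast, map_ofNat]
      ring
    rw [e4, map_add, map_add, map_add, map_C_mul, map_C_mul, map_C_mul, hm] at e1
    rw [christoffel_apply] at e2 e3
    rw [e2, e3, hlc, ← hh₁] at e1
    refine mul_right_cancel₀ h0 ?_
    -- For `n = 0` the polynomial `P₁` has the top degree `2 n + 1 = 1`, so the defect `ε`
    -- contributes, and it cancels against the one in `b₁`.
    rcases n with _ | n
    · have := H₁.monic
      simp at e1 this
      rw [this] at e1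
      linear_combination e1
    · rw [coeff_eq_zero_of_natDegree_lt (H₁.natDegree_le.trans_lt (by omega))] at e1
      simp [coeff_one] at e1
      linear_combination e1

/-- The relation between three consecutive values of the exponent `ν`. -/
lemma three_term (h : IsLax n c₁ c₂ a₁ a₂ ν b₁ b₀ g d₀ y P R) (H : IsOrthPair n L P R)
    (hc₁ : c₁ ≠ 0) (hc₂ : c₂ ≠ 0) (hc : c₁ ≠ c₂) {r h' : K}
    (hr : y = r * b₀ ∧ d₀ = -(r * (ν * (c₁ * c₂) + y)))
    (hh : y = -(h' * d₀) ∧ b₀ = h' * (ν * (c₁ * c₂) + y)) :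
    (ν * (c₁ * c₂) + y) * (b₁ * r - g * h') + 2 * y * (P.coeff n + (n + 1) * (c₁ + c₂))
      - c₁ * c₂ * (2 * P.coeff n * (n + 1) + (n + 1) ^ 2 * (c₁ + c₂))
      + (a₁ * c₂ + a₂ * c₁) * (y - (n + 1) * (c₁ * c₂)) - P.coeff n * (c₁ * c₂) * (a₁ + a₂)
      + ν * (c₁ + c₂) * y = 0 := by
  have e1 := h.det H (c := c₁) (by ring)
  have e2 := h.det H (c := c₂) (by ring)
  have e0 := h.det H (c := 0) (by ring)
  have hne : c₁ * c₂ * (c₂ - c₁) ≠ 0 := mul_ne_zero (mul_ne_zero hc₁ hc₂) (sub_ne_zero.2 hc.symm)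
  -- The weights `c₂ ^ 2` and `c₁ ^ 2` on the determinants at `c₁` and `c₂`, relative to that at
  -- `0`, eliminate `b₁ * g`. The products `b₁ * d₀` and `g * b₀` are then expressed through `r` and
  -- `h'`.
  refine mul_right_cancel₀ hne ?_
  linear_combination (c₁ * c₂ * (c₂ - c₁)) * (b₁ * hr.2 + g * hh.2)
    - c₂ ^ 2 * (e0 - e1) + c₁ ^ 2 * (e0 - e2)

/-- The relation between two consecutive values of the exponent `ν`. -/
lemma two_term {h₁ b₀' d₀' b₁' y' : K}
    (h : IsLax n c₁ c₂ a₁ a₂ ν (-(2 * n + 3 + a₁ + a₂ + ν) * h₁) b₀ g d₀ y P R)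
    (h' : IsLax n c₁ c₂ a₁ a₂ (ν + 1) b₁' b₀' ((2 * n + 2 + a₁ + a₂ + ν) * R₁.coeff n) d₀' y' P₁ R₁)
    (H₁ : IsOrthPair n (christoffel L) P₁ R₁)
    (hX : X * R₁ = R + C (R₁.coeff n) * P) (hP : P₁ = P - C h₁ * R₁)
    (hy : y = R₁.coeff n * b₀) (hy' : y' = -(h₁ * d₀')) {c a c' : K} (hc0 : c ≠ 0)
    (hc : c = c₁ ∧ c' = c₂ ∧ a = a₁ ∨ c = c₂ ∧ c' = c₁ ∧ a = a₂) :
    b₀ * d₀' + ((2 * n + 3 + a₁ + a₂ + ν) * y' + (2 * n + 2 + a₁ + a₂ + ν) * y) * c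
      + (2 * n + 2 + a₁ + a₂ + ν) * (2 * n + 3 + a₁ + a₂ + ν)
        * (P₁.coeff n - P.coeff n) * c ^ 2
      = -(c * ((n + 1) * c - P.coeff n - (n + 1) * (c₁ + c₂)
          - (2 * n + 3 + a₁ + a₂ + ν) * (P₁.coeff n - P.coeff n))
        * ((n + 1) * c - P.coeff n - (n + 1) * (c₁ + c₂)
          - (2 * n + 3 + a₁ + a₂ + ν) * (P₁.coeff n - P.coeff n) + a * (c - c'))) := by
  have hs : c * (c - c₁) * (c - c₂) = 0 := by
    rcases hc with ⟨rfl, -, -⟩ | ⟨rfl, -, -⟩ <;> ring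
  have e1 := h.eval_row_one hs
  have e2 := h'.eval_row_two hs
  have eX := congrArg (eval c) hX
  have eP := congrArg (eval c) hP
  have ep : P₁.coeff n = P.coeff n - h₁ * R₁.coeff n := by
    conv_lhs => rw [hP, coeff_sub, coeff_C_mul]
  simp only [eval_mul, eval_add, eval_sub, eval_X, eval_C] at eX eP
  -- Both the first row at this level and the second row at the next level are written on the common
  -- vector `(P(c), R₁(c))`.
  have hR : R.eval c = c * R₁.eval c - R₁.coeff n * P.eval c := by linear_combination -eX
  rw [hR] at e1
  rw [eP, ep] at e2
  rw [ep]
  generalize R₁.coeff n = r at *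
  have f1 : ((n + 1) * c - P.coeff n - (n + 1) * (c₁ + c₂)
        + r * (2 * n + 3 + a₁ + a₂ + ν) * h₁) * P.eval c
      + (-(2 * n + 3 + a₁ + a₂ + ν) * h₁ * c + b₀) * R₁.eval c = 0 := by
    refine mul_left_cancel₀ hc0 ?_
    linear_combination e1 - P.eval c * hy
  -- Two linear forms, from different levels, kill the same nonzero vector, so their 2×2 determinant
  -- is zero.
  have f2 := det_eq_zero_of_kernel f1 (c := (2 * n + 2 + a₁ + a₂ + ν) * r * c + d₀')
    (d := -a * c * (c - c') - c * ((n + 1) * c - P.coeff n - (n + 1) * (c₁ + c₂)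
        + r * (2 * n + 3 + a₁ + a₂ + ν) * h₁)) (by
      have : (ν + 1) * (c - c₁) * (c - c₂) + a₁ * c * (c - c₂) + a₂ * c * (c - c₁)
          = a * c * (c - c') := by
        rcases hc with ⟨rfl, rfl, rfl⟩ | ⟨rfl, rfl, rfl⟩ <;> ring
      rw [this] at e2
      linear_combination e2 + R₁.eval c * hy') (fun h0 => H₁.no_common_zero c (by
        rw [eP, h0.1, h0.2]; ring) h0.2)
  linear_combination -f2 + (2 * n + 3 + a₁ + a₂ + ν) * c * hy' + (2 * n + 2 + a₁ + a₂ + ν) * c * hy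

end IsLax

end Algebra

/-! ### Hankel matrices and traces. -/

section Hankel

open Polynomial Matrix

variable {K : Type*} [Field K]

/-- The linear functional on polynomials with the moments `m`. -/
def momentFunctional (m : ℕ → K) : K[X] →ₗ[K] K := (basisMonomials K).constr K m

lemma momentFunctional_X_pow (m : ℕ → K) (j : ℕ) : momentFunctional m (X ^ j) = m j := by
  simpa only [momentFunctional, coe_basisMonomials, ← X_pow_eq_monomial] using (basisMonomials K).constr_basis K m j

lemma momentFunctional_mul_X_pow (m : ℕ → K) {f : K[X]} {d : ℕ} (hf : f.natDegree ≤ d) (j : ℕ) :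
    momentFunctional m (f * X ^ j) = ∑ i ∈ Finset.range (d + 1), f.coeff i * m (i + j) := by
  conv_lhs => rw [f.as_sum_range_C_mul_X_pow' (Nat.lt_succ_of_le hf)]
  rw [Finset.sum_mul, map_sum]
  refine Finset.sum_congr rfl fun i _ => ?_
  rw [mul_assoc, map_C_mul, ← pow_add, momentFunctional_X_pow]

lemma christoffel_momentFunctional (m : ℕ → K) :
    christoffel (momentFunctional m) = momentFunctional fun j => m (j + 1) := by
  refine (basisMonomials K).ext fun j => ?_
  simp only [coe_basisMonomials, ← X_pow_eq_monomial]
  rw [christoffel_apply, ← pow_succ',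
    momentFunctional_X_pow, momentFunctional_X_pow]

/-- The Hankel matrix of the moments `m`. -/
def hankel (m : ℕ → K) (N : ℕ) : Matrix (Fin N) (Fin N) K := Matrix.of fun i j => m (i + j)

omit [Field K] in
lemma hankel_transpose (m : ℕ → K) (N : ℕ) : (hankel m N)ᵀ = hankel m N := by
  ext i j; simp [hankel, add_comm]

variable {m : ℕ → K} {n : ℕ}

lemma momentFunctional_mul_X_pow_fin (m : ℕ → K) {f : K[X]} (hf : f.natDegree ≤ n)
    (j : Fin (n + 1)) : momentFunctional m (f * X ^ (j : ℕ))
      = (hankel m (n + 1) *ᵥ fun i => f.coeff i) j := by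
  rw [momentFunctional_mul_X_pow m hf, Finset.sum_range]
  simp only [mulVec, dotProduct, hankel, of_apply]
  exact Finset.sum_congr rfl fun i _ => by rw [mul_comm, add_comm (j : ℕ)]

lemma isNondeg_of_det_ne_zero (h : (hankel m (n + 1)).det ≠ 0) :
    IsNondeg n (momentFunctional m) := by
  intro f hf hj
  have h0 : (hankel m (n + 1) *ᵥ fun i => f.coeff i) = 0 := by
    ext j
    rw [← momentFunctional_mul_X_pow_fin m hf, hj j (by omega), Pi.zero_apply]
  have h1 := eq_zero_of_mulVec_eq_zero h h0
  ext i
  rcases Nat.lt_or_ge i (n + 1) with hi | hi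
  · exact congrFun h1 ⟨i, hi⟩
  · rw [coeff_eq_zero_of_natDegree_lt (by omega), coeff_zero]

lemma exists_coeff_fin (x : Fin (n + 1) → K) :
    ∃ f : K[X], f.natDegree ≤ n ∧ ∀ i : Fin (n + 1), f.coeff i = x i := by
  refine ⟨∑ i : Fin (n + 1), C (x i) * X ^ (i : ℕ), ?_, fun i => ?_⟩
  · exact natDegree_sum_le_of_forall_le _ _ fun i _ => (natDegree_C_mul_X_pow_le _ _).trans (by omega)
  · simp [coeff_X_pow, Fin.val_inj]

lemma map_mul_eq_of_X_pow (L : K[X] →ₗ[K] K) {Q : K[X]} {v : ℕ → K}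
    (h : ∀ j ≤ n, L (Q * X ^ j) = v j) {f : K[X]} (hf : f.natDegree ≤ n) :
    L (Q * f) = ∑ i ∈ Finset.range (n + 1), f.coeff i * v i := by
  conv_lhs => rw [f.as_sum_range_C_mul_X_pow' (Nat.lt_succ_of_le hf)]
  rw [Finset.mul_sum, map_sum]
  refine Finset.sum_congr rfl fun i hi => ?_
  rw [mul_left_comm, map_C_mul, h i (Finset.mem_range_succ_iff.1 hi)]

/-- The coefficients solve linear systems with the Hankel matrix. Only the determinant of size `n +
1` has to be nonzero, which is all that a nonvanishing average gives; a dual polynomial `R` in place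
of a monic one of degree `n` avoids the determinant of size `n`. -/
lemma exists_isOrthPair (h : (hankel m (n + 1)).det ≠ 0) :
    ∃ P R : K[X], IsOrthPair n (momentFunctional m) P R := by
  have hu : IsUnit (hankel m (n + 1)).det := h.isUnit
  obtain ⟨f, hf, hfc⟩ := exists_coeff_fin ((hankel m (n + 1))⁻¹ *ᵥ fun j => -m (n + 1 + j))
  obtain ⟨R, hR, hRc⟩ := exists_coeff_fin ((hankel m (n + 1))⁻¹ *ᵥ Pi.single (Fin.last n) 1)
  refine ⟨X ^ (n + 1) + f, R, ?_, ?_, hR, ?_, ?_⟩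
  · rw [coeff_add, coeff_X_pow_self, coeff_eq_zero_of_natDegree_lt (by omega), add_zero]
  · exact (natDegree_add_le _ _).trans (max_le (by simp) (by omega))
  · intro g hg
    rw [map_mul_eq_of_X_pow _ (v := fun _ => 0) _ hg]
    · simp
    intro j hj
    have := momentFunctional_mul_X_pow_fin m hf ⟨j, by omega⟩
    rw [funext hfc, mulVec_mulVec, mul_nonsing_inv _ hu, one_mulVec] at this
    rw [add_mul, map_add, ← pow_add, momentFunctional_X_pow, this, add_neg_cancel]
  · intro g hg
    rw [map_mul_eq_of_X_pow _ (v := fun j => if j = n then 1 else 0) _ hg]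
    · simp
    intro j hj
    have := momentFunctional_mul_X_pow_fin m hR ⟨j, by omega⟩
    rw [funext hRc, mulVec_mulVec, mul_nonsing_inv _ hu, one_mulVec] at this
    rw [this, Pi.single_apply]
    exact if_congr (by simp [Fin.ext_iff]) rfl rfl

/-- The logarithmic derivative of a Hankel determinant, when the moments satisfy a first order
differential system, in terms of the orthogonal polynomial. -/
lemma trace_adjugate_hankel {P R : K[X]} (h : (hankel m (n + 1)).det ≠ 0)
    (H : IsOrthPair n (momentFunctional m) P R) (M : Matrix (Fin (n + 1)) (Fin (n + 1)) K)
    (k e g ε : K) (hM : ∀ i j, M i j = -(k + i + j) * m (i + j + 1) + (e * (i + j) + g) * m (i + j)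
      + if i = Fin.last n ∧ j = Fin.last n then ε else 0) :
    ((hankel m (n + 1)).adjugate * M).trace = (hankel m (n + 1)).det *
      ((k + 2 * n) * P.coeff n + e * (n * (n + 1)) + (n + 1) * g + ε * R.coeff n) := by
  set A := hankel m (n + 1) with hA
  have hu : IsUnit A.det := h.isUnit
  -- The companion matrix of `P`: by orthogonality, right multiplication by it shifts the Hankel
  -- matrix by one moment.
  set F : Matrix (Fin (n + 1)) (Fin (n + 1)) K :=
    Matrix.of fun i j => if j = Fin.last n then -P.coeff i else if (i : ℕ) = j + 1 then 1 else 0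
    with hF
  set D : Matrix (Fin (n + 1)) (Fin (n + 1)) K := Matrix.diagonal fun i => ((i : ℕ) : K) with hD
  have hAF : A * F = Matrix.of fun i j : Fin (n + 1) => m (i + j + 1) := by
    ext i j
    rw [mul_apply, of_apply]
    by_cases hj : j = Fin.last n
    · subst hj
      have h1 := H.orth (X ^ (i : ℕ)) (by simpa using Nat.lt_succ_iff.1 i.2)
      rw [momentFunctional_mul_X_pow m H.natDegree_le, Finset.sum_range_succ, H.monic,
        Finset.sum_range] at h1
      simp only [hF, of_apply, if_true, hA, hankel, mul_neg, Finset.sum_neg_distrib, Fin.val_last]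
      rw [show (i : ℕ) + n + 1 = n + 1 + i by ring]
      rw [eq_neg_of_add_eq_zero_left (a := ∑ x : Fin (n + 1), m (i + x) * P.coeff x)
        (b := m (n + 1 + i))]
      · ring
      · rw [one_mul] at h1
        rw [← h1]
        congr 1
        exact Finset.sum_congr rfl fun x _ => by rw [mul_comm, add_comm (i : ℕ)]
    · have hj' : (j : ℕ) + 1 < n + 1 := by
        have := Fin.val_ne_of_ne hj
        have := j.2
        simp only [Fin.val_last] at *
        omega
      rw [Finset.sum_eq_single (⟨j + 1, hj'⟩ : Fin (n + 1))]
      · simp [hF, hA, hankel, hj, add_assoc]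
      · intro b _ hb
        have : ¬((b : ℕ) = j + 1) := fun h => hb (Fin.ext h)
        simp [hF, hj, this]
      · simp
  have hAt : Aᵀ = A := hankel_transpose m _
  have hFA : Fᵀ * A = A * F := by
    conv_lhs => rw [← hAt]
    rw [← transpose_mul, hAF]
    ext i j
    simp [add_comm]
  have hMe : M = -(k • (A * F) + D * (A * F) + A * F * D) + e • (D * A + A * D) + g • A
      + ε • Matrix.single (Fin.last n) (Fin.last n) 1 := by
    ext i j
    rw [hM, hAF]
    simp only [hD, hA, hankel, Matrix.add_apply, Matrix.neg_apply, Matrix.smul_apply, diagonal_mul, mul_diagonal,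
      of_apply, smul_eq_mul, single_apply]
    rw [mul_ite, mul_one, mul_zero]
    rw [if_congr (show i = Fin.last n ∧ j = Fin.last n ↔ Fin.last n = i ∧ Fin.last n = j by
      constructor <;> rintro ⟨rfl, rfl⟩ <;> simp) rfl rfl]
    ring
  have hadj : A.adjugate = A.det • A⁻¹ := by
    rw [Matrix.inv_def, smul_smul, Ring.mul_inverse_cancel _ hu, one_smul]
  have hW : A⁻¹ * A = 1 := nonsing_inv_mul _ hu
  have hW' : A * A⁻¹ = 1 := mul_nonsing_inv _ hu
  have hsum : ∀ f : ℕ → K, ∑ i : Fin (n + 1), F i i * f i = -(P.coeff n * f n) := by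
    intro f
    rw [Fin.sum_univ_castSucc, Finset.sum_eq_zero]
    · simp [hF]
    · intro i _
      simp [hF, (Fin.castSucc_lt_last i).ne]
  have t1 : F.trace = -P.coeff n := by
    have := hsum fun _ => 1
    simpa [trace] using this
  have t2 : (F * D).trace = -(P.coeff n * n) := by
    rw [← hsum fun i => (i : K)]
    simp [trace, hD]
  -- The shifted Hankel matrix is symmetric, so `Fᵀ * A = A * F` moves `F` past `A` and the
  -- conjugation by `A` disappears under the trace.
  have t3 : (A⁻¹ * (D * (A * F))).trace = -(P.coeff n * n) := by
    rw [← hFA, ← Matrix.mul_assoc, ← Matrix.mul_assoc, trace_mul_comm, ← Matrix.mul_assoc,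
      ← Matrix.mul_assoc, hW', Matrix.one_mul, ← t2, ← trace_transpose, transpose_mul,
      transpose_transpose, hD, diagonal_transpose]
  have t4 : (A⁻¹ * (A * F * D)).trace = -(P.coeff n * n) := by
    rw [Matrix.mul_assoc, ← Matrix.mul_assoc, hW, Matrix.one_mul, t2]
  have t5 : D.trace = ∑ i ∈ Finset.range (n + 1), (i : K) := by
    rw [Finset.sum_range]; simp [trace, hD]
  have t6 : 2 * D.trace = n * (n + 1) := by
    rw [t5]
    clear * -
    induction n with
    | zero => simp
    | succ n ih => rw [Finset.sum_range_succ, mul_add, ih]; push_cast; ring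
  have t7 : (A⁻¹ * (D * A)).trace = D.trace := by
    rw [trace_mul_comm, Matrix.mul_assoc, hW', Matrix.mul_one]
  have t8 : (A⁻¹ * (A * D)).trace = D.trace := by
    rw [← Matrix.mul_assoc, hW, Matrix.one_mul]
  -- The last column of `A⁻¹` is the coefficient vector of `R`, by duality.
  have t9 : (A⁻¹ * Matrix.single (Fin.last n) (Fin.last n) 1).trace = R.coeff n := by
    have h1 : (A *ᵥ fun i => R.coeff i) = Pi.single (Fin.last n) 1 := by
      ext j
      rw [← momentFunctional_mul_X_pow_fin m H.natDegree_dual_le, H.dual _ (by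
        simpa using Nat.lt_succ_iff.1 j.2), coeff_X_pow, Pi.single_apply]
      exact if_congr (by simp [Fin.ext_iff, eq_comm]) rfl rfl
    have h2 : (fun i : Fin (n + 1) => R.coeff i) = A⁻¹ *ᵥ Pi.single (Fin.last n) 1 := by
      rw [← h1, mulVec_mulVec, hW, one_mulVec]
    have h3 := congrFun h2 (Fin.last n)
    rw [Fin.val_last] at h3
    rw [h3, mulVec_single_one, trace_mul_comm]
    simp [trace, Matrix.mul_apply, Matrix.single_apply, ite_and]
  have t10 : (A⁻¹ * (A * F)).trace = -P.coeff n := by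
    rw [← Matrix.mul_assoc, hW, Matrix.one_mul, t1]
  have t11 : (A⁻¹ * A).trace = n + 1 := by
    rw [hW, trace_one, Fintype.card_fin]; push_cast; rfl
  rw [hadj, smul_mul, trace_smul, smul_eq_mul, hMe]
  congr 1
  simp only [Matrix.mul_add, Matrix.mul_neg, Matrix.mul_smul, trace_add, trace_neg, trace_smul,
    smul_eq_mul, t3, t4, t7, t8, t9, t10, t11]
  linear_combination e * t6

end Hankel

/-! ### Jacobi's formula for the derivative of a determinant. -/

section Deriv

open Matrix

variable {ι : Type*} [Fintype ι] [DecidableEq ι]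

lemma hasDerivAt_det {A : ℝ → Matrix ι ι ℂ} {A' : Matrix ι ι ℂ} {t : ℝ}
    (h : ∀ i j, HasDerivAt (fun s => A s i j) (A' i j) t) :
    HasDerivAt (fun s => (A s).det) ((A t).adjugate * A').trace t := by
  have h1 : HasDerivAt (fun s => (A s).det) (∑ σ : Equiv.Perm ι, ((Equiv.Perm.sign σ : ℤ) : ℂ) *
      ∑ i, (∏ j ∈ Finset.univ.erase i, A t (σ j) j) • A' (σ i) i) t := by
    simp only [det_apply']
    refine HasDerivAt.fun_sum fun σ _ => HasDerivAt.const_mul _ ?_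
    exact HasDerivAt.fun_finsetProd fun i _ => h (σ i) i
  convert h1 using 1
  simp only [Finset.mul_sum]
  rw [Finset.sum_comm, trace]
  refine Finset.sum_congr rfl fun i _ => ?_
  rw [diag_apply, mul_apply]
  have h2 : ∑ k, (A t).adjugate i k * A' k i = ((A t).updateCol i fun k => A' k i).det := by
    rw [← cramer_apply, cramer_eq_adjugate_mulVec]
    rfl
  rw [h2, det_apply']
  refine Finset.sum_congr rfl fun σ _ => ?_
  rw [← Finset.mul_prod_erase _ _ (Finset.mem_univ i), updateCol_self, smul_eq_mul,
    mul_comm (A' _ _)]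
  congr 2
  refine Finset.prod_congr rfl fun j hj => ?_
  rw [updateCol_ne (Finset.ne_of_mem_erase hj)]

end Deriv

/-! ### The algebraic system for four consecutive exponents. -/

section Algebra

open Polynomial

variable {K : Type*} [Field K]

lemma IsPearson.of_succ {c₁ c₂ a₁ a₂ ν ε : K} {d : ℕ} {L : K[X] →ₗ[K] K}
    (h : IsPearson c₁ c₂ a₁ a₂ ν ε (d + 1) L) : IsPearson c₁ c₂ a₁ a₂ ν 0 d L := by
  intro f hf
  rw [h f (by omega), coeff_eq_zero_of_natDegree_lt (by omega), mul_zero, zero_mul]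

/-- The Pearson equation on `X ^ j` is the three-term recurrence of the moments; linearity does the
rest. -/
lemma isPearson_momentFunctional {c₁ c₂ a₁ a₂ ν ε : K} {d : ℕ} {m : ℕ → K}
    (h : ∀ j ≤ d, (ν + 3 + a₁ + a₂ + j) * m (j + 2)
      - ((ν + 1 + j) * (c₁ + c₂) + (a₁ + 1) * c₂ + (a₂ + 1) * c₁) * m (j + 1)
      + (ν + 1 + j) * (c₁ * c₂) * m j = if j = d then ε else 0) :
    IsPearson c₁ c₂ a₁ a₂ ν ε d (momentFunctional m) := by
  intro f hf
  conv_lhs => rw [f.as_sum_range_C_mul_X_pow' (Nat.lt_succ_of_le hf)]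
  rw [derivative_sum, Finset.mul_sum, Finset.mul_sum, ← Finset.sum_add_distrib, map_sum,
    Finset.sum_congr rfl (g := fun i => f.coeff i * if i = d then ε else 0)]
  · simp [mul_comm]
  intro i hi
  rw [← h i (Finset.mem_range_succ_iff.1 hi), ← momentFunctional_X_pow m i,
    ← momentFunctional_X_pow m (i + 1), ← momentFunctional_X_pow m (i + 2)]
  simp only [← map_C_mul, ← map_sub, ← map_add]
  congr 1
  have hX := X_mul_derivative_X_pow (K := K) i
  rw [derivative_C_mul]
  simp only [pearson, C_add, C_mul]
  linear_combination (X - C c₁) * (X - C c₂) * C (f.coeff i) * hX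

/-- The value of `e₂` times the logarithmic derivative of a Hankel determinant with exponent `ν`. -/
def hankelSigma (N e₁ σ₀ σ₁ ν q : K) : K :=
  q + N * (N * e₁ + ν * e₁ + σ₀ * e₁ - σ₁)

/-- The relations between the logarithmic derivatives at four consecutive exponents, in terms of
the symmetric functions `e₁ = c₁ + c₂`, `e₂ = c₁ c₂`, `σ₀ = a₁ + a₂`, `σ₁ = a₁ c₁ + a₂ c₂`. -/
structure IsSystem (N e₁ e₂ σ₀ σ₁ μ q₀ q₁ q₂ q₃ p₁ p₂ y₁ y₂ w : K) : Prop where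
  q_one : q₁ = (2 * N + σ₀ + μ) * p₁
  q_two : q₂ = (2 * N + σ₀ + μ + 1) * p₂
  three_one : (μ * e₂ + y₁) * (q₂ - q₀ - 2 * p₁) + 2 * y₁ * (p₁ + N * e₁)
      - e₂ * (2 * p₁ * N + N ^ 2 * e₁) + (σ₀ * e₁ - σ₁) * (y₁ - N * e₂) - p₁ * e₂ * σ₀
      + μ * e₁ * y₁ = 0
  three_two : ((μ + 1) * e₂ + y₂) * (q₃ - q₁ - 2 * p₂) + 2 * y₂ * (p₂ + N * e₁)
      - e₂ * (2 * p₂ * N + N ^ 2 * e₁) + (σ₀ * e₁ - σ₁) * (y₂ - N * e₂) - p₂ * e₂ * σ₀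
      + (μ + 1) * e₁ * y₂ = 0
  mul_eq : y₁ * y₂ = (p₂ - p₁) * w
  sum_eq : (2 * N + σ₀ + μ + 1) * y₂ + (2 * N + σ₀ + μ) * y₁
      + (2 * N + σ₀ + μ) * (2 * N + σ₀ + μ + 1) * (p₂ - p₁) * e₁
      = -(N ^ 2 * (e₁ ^ 2 - e₂) - 2 * N * (p₁ + N * e₁ + (2 * N + σ₀ + μ + 1) * (p₂ - p₁)) * e₁
        + (p₁ + N * e₁ + (2 * N + σ₀ + μ + 1) * (p₂ - p₁)) ^ 2
        + N * (e₁ * σ₁ - e₂ * σ₀)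
        - (p₁ + N * e₁ + (2 * N + σ₀ + μ + 1) * (p₂ - p₁)) * σ₁)
  w_eq : w = e₂ * ((2 * N + σ₀ + μ) * (2 * N + σ₀ + μ + 1) * (p₂ - p₁)
      + N * (N * e₁ - 2 * (p₁ + N * e₁ + (2 * N + σ₀ + μ + 1) * (p₂ - p₁))) + N * σ₁
      - (p₁ + N * e₁ + (2 * N + σ₀ + μ + 1) * (p₂ - p₁)) * σ₀)

/-- The matrix `M` is `e₂` times the derivative of the Hankel matrix of the moments `m` of a weight
with exponent `ν`, up to a defect `ε` in the last entry. -/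
def IsHankelDeriv (c₁ c₂ a₁ a₂ ν ε : K) (m : ℕ → K) {N : ℕ} (M : Matrix (Fin N) (Fin N) K) : Prop :=
  ∀ i j : Fin N, M i j = -(ν + a₁ + a₂ + 2 + i + j) * m (i + j + 1)
    + ((c₁ + c₂) * (ν + i + j) + (a₁ + 1) * c₂ + (a₂ + 1) * c₁) * m (i + j)
    + if (i : ℕ) + 1 = N ∧ (j : ℕ) + 1 = N then ε else 0

lemma IsHankelDeriv.trace_eq {c₁ c₂ a₁ a₂ ν ε : K} {m : ℕ → K} {n : ℕ} {P R : K[X]}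
    (h : (hankel m (n + 1)).det ≠ 0) (H : IsOrthPair n (momentFunctional m) P R)
    {M : Matrix (Fin (n + 1)) (Fin (n + 1)) K} (hM : IsHankelDeriv c₁ c₂ a₁ a₂ ν ε m M) :
    ((hankel m (n + 1)).adjugate * M).trace = (hankel m (n + 1)).det *
      hankelSigma ((n : K) + 1) (c₁ + c₂) (a₁ + a₂) (a₁ * c₁ + a₂ * c₂) ν
        ((2 * (n + 1) + (a₁ + a₂) + ν) * P.coeff n + ε * R.coeff n) := by
  rw [trace_adjugate_hankel h H M (ν + a₁ + a₂ + 2) (c₁ + c₂)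
    (ν * (c₁ + c₂) + (a₁ + 1) * c₂ + (a₂ + 1) * c₁) ε]
  · unfold hankelSigma; ring
  · intro i j
    rw [hM]
    congr 1
    · ring
    · exact if_congr (by simp [Fin.ext_iff]) rfl rfl

/-- Each Christoffel step uses up one degree of the Pearson equation, so `2 n + 2` at the first
level leaves `2 n` at the third, just enough for its system. The system is needed only at the two
middle levels; the outer ones enter through kernel and range at `0`. -/
theorem exists_isSystem {n : ℕ} {m : ℕ → K} {c₁ c₂ a₁ a₂ μ ε : K} (hc₁ : c₁ ≠ 0) (hc₂ : c₂ ≠ 0)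
    (hc : c₁ ≠ c₂)
    (hm : ∀ j ≤ 2 * (n + 1), (μ - 1 + 3 + a₁ + a₂ + j) * m (j + 2)
      - ((μ - 1 + 1 + j) * (c₁ + c₂) + (a₁ + 1) * c₂ + (a₂ + 1) * c₁) * m (j + 1)
      + (μ - 1 + 1 + j) * (c₁ * c₂) * m j = if j = 2 * (n + 1) then ε else 0)
    (h0 : (hankel m (n + 1)).det ≠ 0)
    (h1 : (hankel (fun j => m (j + 1)) (n + 1)).det ≠ 0)
    (h2 : (hankel (fun j => m (j + 2)) (n + 1)).det ≠ 0)
    (h3 : (hankel (fun j => m (j + 3)) (n + 1)).det ≠ 0)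
    {M₀ M₁ M₂ M₃ : Matrix (Fin (n + 1)) (Fin (n + 1)) K}
    (hM₀ : IsHankelDeriv c₁ c₂ a₁ a₂ (μ - 1) 0 m M₀)
    (hM₁ : IsHankelDeriv c₁ c₂ a₁ a₂ μ 0 (fun j => m (j + 1)) M₁)
    (hM₂ : IsHankelDeriv c₁ c₂ a₁ a₂ (μ + 1) 0 (fun j => m (j + 2)) M₂)
    (hM₃ : IsHankelDeriv c₁ c₂ a₁ a₂ (μ + 2) ε (fun j => m (j + 3)) M₃) :
    ∃ q₀ q₁ q₂ q₃ p₁ p₂ y₁ y₂ w : K,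
      IsSystem ((n : K) + 1) (c₁ + c₂) (c₁ * c₂) (a₁ + a₂) (a₁ * c₁ + a₂ * c₂) μ
        q₀ q₁ q₂ q₃ p₁ p₂ y₁ y₂ w ∧
      ((hankel m (n + 1)).adjugate * M₀).trace = (hankel m (n + 1)).det *
        hankelSigma ((n : K) + 1) (c₁ + c₂) (a₁ + a₂) (a₁ * c₁ + a₂ * c₂) (μ - 1) q₀ ∧
      ((hankel (fun j => m (j + 1)) (n + 1)).adjugate * M₁).trace =
        (hankel (fun j => m (j + 1)) (n + 1)).det *
        hankelSigma ((n : K) + 1) (c₁ + c₂) (a₁ + a₂) (a₁ * c₁ + a₂ * c₂) μ q₁ ∧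
      ((hankel (fun j => m (j + 2)) (n + 1)).adjugate * M₂).trace =
        (hankel (fun j => m (j + 2)) (n + 1)).det *
        hankelSigma ((n : K) + 1) (c₁ + c₂) (a₁ + a₂) (a₁ * c₁ + a₂ * c₂) (μ + 1) q₂ ∧
      ((hankel (fun j => m (j + 3)) (n + 1)).adjugate * M₃).trace =
        (hankel (fun j => m (j + 3)) (n + 1)).det *
        hankelSigma ((n : K) + 1) (c₁ + c₂) (a₁ + a₂) (a₁ * c₁ + a₂ * c₂) (μ + 2) q₃ := by
  obtain ⟨P₀, R₀, H₀⟩ := exists_isOrthPair h0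
  obtain ⟨P₁, R₁, H₁⟩ := exists_isOrthPair h1
  obtain ⟨P₂, R₂, H₂⟩ := exists_isOrthPair h2
  obtain ⟨P₃, R₃, H₃⟩ := exists_isOrthPair h3
  have t0 := IsHankelDeriv.trace_eq h0 H₀ hM₀
  have t1 := IsHankelDeriv.trace_eq h1 H₁ hM₁
  have t2 := IsHankelDeriv.trace_eq h2 H₂ hM₂
  have t3 := IsHankelDeriv.trace_eq h3 H₃ hM₃
  have N0 := isNondeg_of_det_ne_zero h0
  have N1 := isNondeg_of_det_ne_zero h1
  have N2 := isNondeg_of_det_ne_zero h2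
  have N3 := isNondeg_of_det_ne_zero h3
  have E1 : momentFunctional (fun j => m (j + 1)) = christoffel (momentFunctional m) :=
    (christoffel_momentFunctional m).symm
  have E2 : momentFunctional (fun j => m (j + 2)) = christoffel (christoffel (momentFunctional m)) := by
    rw [← E1, christoffel_momentFunctional]
  have E3 : momentFunctional (fun j => m (j + 3))
      = christoffel (christoffel (christoffel (momentFunctional m))) := by
    rw [← E2, christoffel_momentFunctional]
  rw [E1] at H₁ N1
  rw [E2] at H₂ N2
  rw [E3] at H₃ N3
  have L0 : IsPearson c₁ c₂ a₁ a₂ (μ - 1) ε (2 * n + 1 + 1) (momentFunctional m) :=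
    isPearson_momentFunctional hm
  have L1 := L0.christoffel
  have L2 := L1.christoffel
  rw [sub_add_cancel] at L1 L2
  generalize momentFunctional m = L at *
  have O1 := H₀.orth_step H₁ N1
  have O2 := H₁.orth_step H₂ N2
  have O3 := H₂.orth_step H₃ N3
  obtain ⟨y₁, b, d, X1⟩ := H₁.exists_isLax N1 L1.of_succ
  obtain ⟨y₂, b', d', X2⟩ := H₂.exists_isLax N2 L2
  have K1 := X1.kernel H₁ H₂ N1
  have K2 := X2.kernel H₂ H₃ N2
  have G1 := X1.range H₀ H₁ N1 L0.of_succ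
  have G2 := X2.range H₁ H₂ N2 (by rwa [add_sub_cancel_right])
  have T1 := X1.three_term H₁ hc₁ hc₂ hc K1 G1
  have T2 := X2.three_term H₂ hc₁ hc₂ hc K2 G2
  rw [show (0 : K) - (2 * n + 3 + a₁ + a₂ + μ) * christoffel L (P₁ * X ^ (n + 1))
    = -(2 * n + 3 + a₁ + a₂ + μ) * christoffel L (P₁ * X ^ (n + 1)) by ring] at X1
  rw [show (2 * n + 1 + a₁ + a₂ + (μ + 1) : K) = 2 * n + 2 + a₁ + a₂ + μ by ring] at X2
  have S1 := X1.two_term X2 H₂ (H₁.X_mul_dual H₂ N1) O2 K1.1 G2.1 hc₁ (Or.inl ⟨rfl, rfl, rfl⟩)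
  have S2 := X1.two_term X2 H₂ (H₁.X_mul_dual H₂ N1) O2 K1.1 G2.1 hc₂ (Or.inr ⟨rfl, rfl, rfl⟩)
  have p1 : P₁.coeff n = P₀.coeff n - L (P₀ * X ^ (n + 1)) * R₁.coeff n := by
    conv_lhs => rw [O1, coeff_sub, coeff_C_mul]
  have p2 : P₂.coeff n = P₁.coeff n - christoffel L (P₁ * X ^ (n + 1)) * R₂.coeff n := by
    conv_lhs => rw [O2, coeff_sub, coeff_C_mul]
  have p3 : P₃.coeff n = P₂.coeff n - christoffel (christoffel L) (P₂ * X ^ (n + 1))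
      * R₃.coeff n := by
    conv_lhs => rw [O3, coeff_sub, coeff_C_mul]
  have hne : c₁ - c₂ ≠ 0 := sub_ne_zero.2 hc
  -- The first four witnesses are read off from `t0` to `t3`. Only the fourth contains `ε`,
  -- multiplied by `R₃.coeff n`, which is exactly how `ε` enters `T2` through `b₁`.
  refine ⟨_, _, _, _, P₁.coeff n, P₂.coeff n, y₁, y₂, b * d', ⟨?_, ?_, ?_, ?_, ?_, ?_, ?_⟩,
    t0, t1, t2, t3⟩
  · ring
  · ring
  · rw [p2]
    have p1' : P₀.coeff n = P₁.coeff n + L (P₀ * X ^ (n + 1)) * R₁.coeff n := by rw [p1]; ring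
    rw [p1']
    linear_combination T1
  · rw [p3]
    have p2' : P₁.coeff n = P₂.coeff n + christoffel L (P₁ * X ^ (n + 1)) * R₂.coeff n := by
      rw [p2]; ring
    rw [p2']
    linear_combination T2
  · rw [K1.1, G2.1, p2]; ring
  -- The relations at `c₁` and `c₂` share the term `b * d'`. Their difference removes it; the
  -- crosswise combination used for `w_eq` isolates it.
  · refine mul_right_cancel₀ hne ?_
    linear_combination S1 - S2
  · refine mul_right_cancel₀ hne ?_
    linear_combination c₁ * S2 - c₂ * S1

end Algebra

/-! ### Elimination: from the system to the difference equations. -/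

section Recurrences

/-- The shape of the elimination. `F₀` and `F₁` belong to the two middle levels; each three-term
relation contains one of them, and the two-level relations give their product. -/
lemma mul_relation {X Y C₀ C₁ D₀ D₁ F₀ F₁ e : ℂ} (he : e ≠ 0) (hXY : e * (X * Y) = F₀ * F₁)
    (h₀ : e * D₀ = C₀ * F₀) (h₁ : e * D₁ = C₁ * F₁) : X * Y * C₀ * C₁ = e * D₀ * D₁ := by
  refine mul_left_cancel₀ he ?_
  linear_combination C₀ * C₁ * hXY - C₁ * F₁ * h₀ - e * D₀ * h₁

/-- The Jacobi recurrence follows from the algebraic system. -/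
lemma jacobiRecurrence_of_isSystem {N : ℕ} {a b μ t q₀ q₁ q₂ q₃ p₁ p₂ y₁ y₂ w L₀ L₁ L₂ L₃ : ℂ}
    (ht : t * (t - 1) ≠ 0)
    (h : IsSystem (N : ℂ) (2 * t - 1) (t * (t - 1)) (a + b) (a * t + b * (t - 1)) μ
      q₀ q₁ q₂ q₃ p₁ p₂ y₁ y₂ w)
    (h₀ : t * (t - 1) * L₀ = hankelSigma (N : ℂ) (2 * t - 1) (a + b) (a * t + b * (t - 1)) (μ - 1) q₀)
    (h₁ : t * (t - 1) * L₁ = hankelSigma (N : ℂ) (2 * t - 1) (a + b) (a * t + b * (t - 1)) μ q₁)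
    (h₂ : t * (t - 1) * L₂ = hankelSigma (N : ℂ) (2 * t - 1) (a + b) (a * t + b * (t - 1)) (μ + 1) q₂)
    (h₃ : t * (t - 1) * L₃ = hankelSigma (N : ℂ) (2 * t - 1) (a + b) (a * t + b * (t - 1)) (μ + 2) q₃) :
    JacobiRecurrence N a b μ t (jacobiSigma N a b (μ - 1) t L₀) (jacobiSigma N a b μ t L₁)
      (jacobiSigma N a b (μ + 1) t L₂) (jacobiSigma N a b (μ + 2) t L₃) := by
  obtain ⟨hq₁, hq₂, hT₁, hT₂, hw, hS, hW⟩ := h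
  subst hq₁ hq₂
  unfold JacobiRecurrence jacobiSigma
  rw [h₀, h₁, h₂, h₃]
  unfold esymTwo esymTwo' hankelSigma
  refine mul_relation ht (F₀ := (N + a) * (N + b) * (t * (t - 1)) - (2 * N + (a + b) + μ) * y₁)
    (F₁ := (N + a) * (N + b) * (t * (t - 1)) - (2 * N + (a + b) + μ + 1) * y₂) ?_ ?_ ?_
  · linear_combination (N + a) * (N + b) * (t * (t - 1)) * hS
      - (2 * N + (a + b) + μ) * (2 * N + (a + b) + μ + 1) * (hw + (p₂ - p₁) * hW)
  · linear_combination (2 * N + (a + b) + μ) * hT₁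
  · linear_combination (2 * N + (a + b) + μ + 1) * hT₂

/-- The factor `t ^ 2 + 1` cancels the poles at `±I`, leaving `t - I` and `t + I`. -/
lemma cauchySigma_eq {N : ℕ} {η₁ η₂ : ℝ} {μ t L : ℂ} (ht : t ^ 2 + 1 ≠ 0) :
    cauchySigma N η₁ η₂ μ t L = esymTwo' (N - η₁) η₁ (-μ + η₁ - N) * t - η₂ * (η₁ - μ)
      + (t ^ 2 + 1) * L := by
  have h : (I * t - 1) * (I * t + 1) = -(t ^ 2 + 1) := by linear_combination t ^ 2 * I_sq
  have h1 : I * t - 1 ≠ 0 := fun h0 => ht (by rw [h0, zero_mul] at h; linear_combination h)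
  have h2 : I * t + 1 ≠ 0 := fun h0 => ht (by rw [h0, mul_zero] at h; linear_combination h)
  have e1 : (t ^ 2 + 1) * (I / (I * t - 1)) = t - I := by
    rw [← mul_div_assoc, div_eq_iff h1]; linear_combination t * I_sq
  have e2 : (t ^ 2 + 1) * (I / (I * t + 1)) = t + I := by
    rw [← mul_div_assoc, div_eq_iff h2]; linear_combination -t * I_sq
  have e3 : esymTwo (N - η₁) (I * η₂) η₁ (-μ + η₁ - N)
      = esymTwo' (N - η₁) η₁ (-μ + η₁ - N) + I * η₂ * (η₁ - μ) := by
    unfold esymTwo esymTwo'; ring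
  simp only [cauchySigma]
  rw [e3]
  generalize esymTwo' (N - η₁ : ℂ) η₁ (-μ + η₁ - N) = e'
  linear_combination (e' - 1 / 2 * (e' + I * η₂ * (η₁ - μ))) * e1
    + 1 / 2 * (e' + I * η₂ * (η₁ - μ)) * e2 + η₂ * (η₁ - μ) * I_sq

/-- The Cauchy recurrence follows from the algebraic system. -/
lemma cauchyRecurrence_of_isSystem {N : ℕ} {η₁ η₂ : ℝ}
    {μ t q₀ q₁ q₂ q₃ p₁ p₂ y₁ y₂ w L₀ L₁ L₂ L₃ : ℂ} (ht : t ^ 2 + 1 ≠ 0)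
    (h : IsSystem (N : ℂ) (2 * t) (t ^ 2 + 1) (-2 * η₁) (-2 * (η₁ * t + η₂)) μ
      q₀ q₁ q₂ q₃ p₁ p₂ y₁ y₂ w)
    (h₀ : (t ^ 2 + 1) * L₀ = hankelSigma (N : ℂ) (2 * t) (-2 * η₁) (-2 * (η₁ * t + η₂)) (μ - 1) q₀)
    (h₁ : (t ^ 2 + 1) * L₁ = hankelSigma (N : ℂ) (2 * t) (-2 * η₁) (-2 * (η₁ * t + η₂)) μ q₁)
    (h₂ : (t ^ 2 + 1) * L₂ = hankelSigma (N : ℂ) (2 * t) (-2 * η₁) (-2 * (η₁ * t + η₂)) (μ + 1) q₂)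
    (h₃ : (t ^ 2 + 1) * L₃ = hankelSigma (N : ℂ) (2 * t) (-2 * η₁) (-2 * (η₁ * t + η₂)) (μ + 2) q₃) :
    CauchyRecurrence N η₁ η₂ μ t (cauchySigma N η₁ η₂ (μ - 1) t L₀) (cauchySigma N η₁ η₂ μ t L₁)
      (cauchySigma N η₁ η₂ (μ + 1) t L₂) (cauchySigma N η₁ η₂ (μ + 2) t L₃) := by
  obtain ⟨hq₁, hq₂, hT₁, hT₂, hw, hS, hW⟩ := h
  subst hq₁ hq₂
  unfold CauchyRecurrence
  rw [cauchySigma_eq ht, cauchySigma_eq ht, cauchySigma_eq ht, cauchySigma_eq ht, h₀, h₁, h₂, h₃,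
    add_comm 1 (t ^ 2)]
  unfold esymTwo' hankelSigma
  refine mul_relation ht (F₀ := N * (N - 2 * η₁) * (t ^ 2 + 1) - (2 * N - 2 * η₁ + μ) * y₁)
    (F₁ := N * (N - 2 * η₁) * (t ^ 2 + 1) - (2 * N - 2 * η₁ + μ + 1) * y₂) ?_ ?_ ?_
  · linear_combination N * (N - 2 * η₁) * (t ^ 2 + 1) * hS
      - (2 * N - 2 * η₁ + μ) * (2 * N - 2 * η₁ + μ + 1) * (hw + (p₂ - p₁) * hW)
  · linear_combination (2 * N - 2 * η₁ + μ) * hT₁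
  · linear_combination (2 * N - 2 * η₁ + μ + 1) * hT₂

end Recurrences

/-! ### Andréief's identity. -/

section Andreief

variable {N : ℕ} {w : ℝ → ℂ} {s : ℝ}

/-- Differences change only sign under `x ↦ s - x`, so the moments may be taken in the variable in
which `ν` shifts. -/
lemma vandermondeSq_eq (x : Fin N → ℝ) (s : ℝ) :
    vandermondeSq N x = (Matrix.vandermonde fun l => ((s - x l : ℝ) : ℂ)).det ^ 2 := by
  rw [Matrix.det_vandermonde, vandermondeSq, ← Finset.prod_pow]
  refine Finset.prod_congr rfl fun j _ => ?_
  rw [← Finset.prod_pow]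
  refine Finset.prod_congr rfl fun k _ => ?_
  push_cast
  ring

lemma ensembleIntegrand_eq (x : Fin N → ℝ) (s : ℝ) :
    ensembleIntegrand N w x = ∑ σ : Equiv.Perm (Fin N), ∑ τ : Equiv.Perm (Fin N),
      (((Equiv.Perm.sign σ : ℤ) : ℂ) * ((Equiv.Perm.sign τ : ℤ) : ℂ)) *
        ∏ l, w (x l) * ((s - x l : ℝ) : ℂ) ^ ((σ l : ℕ) + τ l) := by
  rw [ensembleIntegrand, vandermondeSq_eq x s, pow_two, ← Matrix.det_transpose, Matrix.det_apply',
    Finset.sum_mul_sum, Finset.mul_sum]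
  refine Finset.sum_congr rfl fun σ _ => ?_
  rw [Finset.mul_sum]
  refine Finset.sum_congr rfl fun τ _ => ?_
  simp only [Matrix.transpose_apply, Matrix.vandermonde_apply, pow_add, Finset.prod_mul_distrib]
  ring

lemma integrable_ensembleIntegrand
    (h : ∀ i j : Fin N, Integrable fun y : ℝ => w y * ((s - y : ℝ) : ℂ) ^ ((i : ℕ) + j)) :
    Integrable (ensembleIntegrand N w) := by
  rw [show ensembleIntegrand N w = fun x => _ from funext fun x => ensembleIntegrand_eq x s]
  refine integrable_finsetSum _ fun σ _ => integrable_finsetSum _ fun τ _ => Integrable.const_mul ?_ _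
  exact Integrable.fintype_prod fun l => h (σ l) (τ l)

/-- Andréief's identity for the ensemble averages. -/
lemma integral_ensembleIntegrand
    (h : ∀ i j : Fin N, Integrable fun y : ℝ => w y * ((s - y : ℝ) : ℂ) ^ ((i : ℕ) + j)) :
    ∫ x, ensembleIntegrand N w x
      = N.factorial * (hankel (fun k => ∫ y, w y * ((s - y : ℝ) : ℂ) ^ k) N).det := by
  set m : ℕ → ℂ := fun k => ∫ y, w y * ((s - y : ℝ) : ℂ) ^ k with hm
  simp only [fun x => ensembleIntegrand_eq (w := w) x s]
  have hi : ∀ σ τ : Equiv.Perm (Fin N), Integrable fun x : Fin N → ℝ =>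
      (((Equiv.Perm.sign σ : ℤ) : ℂ) * ((Equiv.Perm.sign τ : ℤ) : ℂ)) *
        ∏ l, w (x l) * ((s - x l : ℝ) : ℂ) ^ ((σ l : ℕ) + τ l) := fun σ τ =>
    Integrable.const_mul (Integrable.fintype_prod
      (f := fun l y => w y * ((s - y : ℝ) : ℂ) ^ ((σ l : ℕ) + τ l)) fun l => h (σ l) (τ l)) _
  rw [integral_finsetSum _ fun σ _ => integrable_finsetSum _ fun τ _ => hi σ τ]
  simp only [integral_finsetSum _ fun τ _ => hi _ τ, integral_const_mul]
  have hp : ∀ σ τ : Equiv.Perm (Fin N),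
      ∫ x : Fin N → ℝ, ∏ l, w (x l) * ((s - x l : ℝ) : ℂ) ^ ((σ l : ℕ) + τ l)
        = ∏ l, m (σ l + τ l) := fun σ τ =>
    integral_fintype_prod_volume_eq_prod fun l y => w y * ((s - y : ℝ) : ℂ) ^ ((σ l : ℕ) + τ l)
  simp only [hp]
  rw [Finset.sum_comm]
  have hτ : ∀ τ : Equiv.Perm (Fin N), ∑ σ : Equiv.Perm (Fin N),
      (((Equiv.Perm.sign σ : ℤ) : ℂ) * ((Equiv.Perm.sign τ : ℤ) : ℂ)) * ∏ l, m (σ l + τ l)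
        = (hankel m N).det := by
    intro τ
    -- Substituting `σ = ρ * τ` makes the sum over `σ` independent of `τ`; the `N!` values of `τ`
    -- give the factorial.
    rw [Matrix.det_apply', ← Equiv.sum_comp (Equiv.mulRight τ)]
    refine Finset.sum_congr rfl fun ρ _ => ?_
    have hs : (((Equiv.Perm.sign τ : ℤ) : ℂ) * ((Equiv.Perm.sign τ : ℤ) : ℂ)) = 1 := by
      rw [← Int.cast_mul, ← Units.val_mul, Int.units_mul_self]; simp
    rw [Equiv.coe_mulRight, Equiv.Perm.sign_mul, Units.val_mul, Int.cast_mul, mul_assoc, mul_assoc,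
      ← mul_assoc ((Equiv.Perm.sign τ : ℤ) : ℂ), hs, one_mul]
    exact congrArg _ (Equiv.prod_comp τ fun l => m (ρ l + l))
  simp only [hτ]
  rw [Finset.sum_const, Finset.card_univ, Fintype.card_perm, Fintype.card_fin, nsmul_eq_mul]

end Andreief

/-! ### The thinned power as a function of one real variable. -/

section Kernel

/-- The thinned branch of the power `u ^ ν`, as a function of `u = s - x`. -/
def branchKernel (ξ ν : ℂ) (u : ℝ) : ℂ :=
  if 0 ≤ u then (u : ℂ) ^ ν
  else (1 - ξ) * Complex.exp (-(Real.pi * I * ν)) * ((-u : ℝ) : ℂ) ^ ν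

lemma thinning_mul_branchPow (ξ ν : ℂ) (s x : ℝ) :
    thinning ξ s x * branchPow s x ν = branchKernel ξ ν (s - x) := by
  unfold thinning branchPow branchKernel
  by_cases h : x ≤ s
  · rw [if_neg h.not_gt, if_pos h, if_pos (sub_nonneg.2 h), one_mul]
  · rw [if_pos (not_le.1 h), if_neg h, if_neg (by linarith), neg_sub]
    ring

lemma branchKernel_of_pos {ξ ν : ℂ} {u : ℝ} (hu : 0 < u) : branchKernel ξ ν u = (u : ℂ) ^ ν :=
  if_pos hu.le

lemma branchKernel_of_neg {ξ ν : ℂ} {u : ℝ} (hu : u < 0) : branchKernel ξ ν u =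
    (1 - ξ) * Complex.exp (-(Real.pi * I * ν)) * ((-u : ℝ) : ℂ) ^ ν :=
  if_neg hu.not_ge

lemma branchKernel_zero {ξ ν : ℂ} (hν : ν ≠ 0) : branchKernel ξ ν 0 = 0 := by
  simp [branchKernel, hν]

lemma branchKernel_one_of_neg {ν : ℂ} {u : ℝ} (hu : u < 0) : branchKernel 1 ν u = 0 := by
  rw [branchKernel_of_neg hu]; simp

/-- The phase `e^{-πi} = -1` turns `|u|` into `u` on the negative side. At `u = 0` the identity
fails for `ν = -1`, since `0 ^ 0 = 1`. -/
lemma branchKernel_add_one {ξ ν : ℂ} {u : ℝ} (hu : u ≠ 0) :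
    branchKernel ξ (ν + 1) u = u * branchKernel ξ ν u := by
  rcases hu.lt_or_gt with h | h
  · rw [branchKernel_of_neg h, branchKernel_of_neg h, cpow_add _ _ (by
      simpa using hu), cpow_one, show -(Real.pi * I * (ν + 1)) = -(Real.pi * I * ν) - Real.pi * I by
      ring, Complex.exp_sub, Complex.exp_pi_mul_I]
    push_cast
    ring
  · rw [branchKernel_of_pos h, branchKernel_of_pos h, cpow_add _ _ (by simpa using hu), cpow_one,
      mul_comm]

lemma branchKernel_add_natCast {ξ ν : ℂ} {u : ℝ} (hu : u ≠ 0) (j : ℕ) :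
    branchKernel ξ (ν + j) u = branchKernel ξ ν u * (u : ℂ) ^ j := by
  induction j with
  | zero => simp
  | succ j ih =>
    rw [Nat.cast_succ, ← add_assoc, branchKernel_add_one hu, ih]; ring

lemma norm_branchKernel_le (ξ ν : ℂ) (u : ℝ) :
    ‖branchKernel ξ ν u‖ ≤ (1 + ‖1 - ξ‖ * Real.exp (Real.pi * ν.im)) * |u| ^ ν.re := by
  have hE : 0 ≤ ‖1 - ξ‖ * Real.exp (Real.pi * ν.im) := by positivity
  rcases lt_trichotomy u 0 with h | h | h
  · rw [branchKernel_of_neg h, norm_mul, norm_mul, norm_cpow_eq_rpow_re_of_pos (by linarith),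
      abs_of_neg h, Complex.norm_exp]
    have : (-(Real.pi * I * ν)).re = Real.pi * ν.im := by simp
    rw [this]
    have : 0 ≤ (-u) ^ ν.re := Real.rpow_nonneg (by linarith) _
    nlinarith
  · subst h
    by_cases h0 : ν = 0
    · subst h0; simp [branchKernel]
    · rw [branchKernel_zero h0, norm_zero]
      positivity
  · rw [branchKernel_of_pos h, norm_cpow_eq_rpow_re_of_pos h, abs_of_pos h]
    have : 0 ≤ u ^ ν.re := Real.rpow_nonneg h.le _
    nlinarith

lemma hasDerivAt_ofReal_cpow_of_pos {ν : ℂ} {u : ℝ} (hu : 0 < u) :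
    HasDerivAt (fun v : ℝ => (v : ℂ) ^ ν) (ν * (u : ℂ) ^ (ν - 1)) u := by
  have h := (hasDerivAt_id (u : ℂ)).cpow_const (c := ν) (Or.inl (by simpa using hu))
  simpa using h.comp_ofReal

lemma hasDerivAt_branchKernel_of_ne {ξ ν : ℂ} {u : ℝ} (hu : u ≠ 0) :
    HasDerivAt (branchKernel ξ ν) (ν * branchKernel ξ (ν - 1) u) u := by
  rcases hu.lt_or_gt with h | h
  · have h1 := ((hasDerivAt_ofReal_cpow_of_pos (ν := ν) (u := -u) (by linarith)).scomp u
      (hasDerivAt_neg u)).const_mul ((1 - ξ) * Complex.exp (-(Real.pi * I * ν)))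
    refine (h1.congr_of_eventuallyEq ?_).congr_deriv ?_
    · filter_upwards [gt_mem_nhds h] with v hv
      rw [branchKernel_of_neg hv]; rfl
    · rw [branchKernel_of_neg h, show -(Real.pi * I * (ν - 1)) = -(Real.pi * I * ν) + Real.pi * I by
        ring, Complex.exp_add, Complex.exp_pi_mul_I]
      simp
      ring
  · rw [branchKernel_of_pos h]
    refine (hasDerivAt_ofReal_cpow_of_pos h).congr_of_eventuallyEq ?_
    filter_upwards [lt_mem_nhds h] with v hv
    rw [branchKernel_of_pos hv]

/-- At the branch point the kernel is bounded by a multiple of `|u| ^ ν.re`, which is `o(u)` when `1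
< ν.re`. -/
lemma hasDerivAt_branchKernel {ξ ν : ℂ} {u : ℝ} (hu : u ≠ 0 ∨ 1 < ν.re) :
    HasDerivAt (branchKernel ξ ν) (ν * branchKernel ξ (ν - 1) u) u := by
  by_cases h0 : u = 0
  swap
  · exact hasDerivAt_branchKernel_of_ne h0
  have hν : 1 < ν.re := hu.resolve_left (not_not.2 h0)
  subst h0
  have n1 : ν ≠ 0 := fun h => by rw [h] at hν; norm_num at hν
  have n2 : ν - 1 ≠ 0 := fun h => by
    rw [sub_eq_zero.1 h] at hν; norm_num at hν
  rw [branchKernel_zero n2, mul_zero, hasDerivAt_iff_isLittleO_nhds_zero]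
  set c := 1 + ‖1 - ξ‖ * Real.exp (Real.pi * ν.im)
  have h1 : (fun h : ℝ => branchKernel ξ ν (0 + h) - branchKernel ξ ν 0 - h • (0 : ℂ))
      =O[𝓝 0] fun h : ℝ => |h| ^ ν.re := by
    refine Asymptotics.IsBigO.of_bound c (Eventually.of_forall fun h => ?_)
    rw [branchKernel_zero n1, zero_add, smul_zero, sub_zero, sub_zero, Real.norm_eq_abs,
      abs_of_nonneg (Real.rpow_nonneg (abs_nonneg h) _)]
    exact norm_branchKernel_le ξ ν h
  refine h1.trans_isLittleO ?_
  rw [Asymptotics.isLittleO_iff]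
  intro ε hε
  have hc : ContinuousAt (fun h : ℝ => |h| ^ (ν.re - 1)) 0 :=
    continuousAt_id.abs.rpow_const (Or.inr (by linarith))
  have := hc.tendsto
  rw [abs_zero, Real.zero_rpow (by linarith)] at this
  filter_upwards [this.eventually (gt_mem_nhds hε)] with h hh
  by_cases h0 : h = 0
  · simp [h0, Real.zero_rpow (by linarith : ν.re ≠ 0)]
  have h2 : |h| ^ ν.re = |h| ^ (ν.re - 1) * |h| := by
    rw [← Real.rpow_add_one (abs_ne_zero.2 h0)]; ring_nf
  rw [Real.norm_eq_abs, abs_of_nonneg (Real.rpow_nonneg (abs_nonneg h) _), h2, Real.norm_eq_abs]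
  gcongr

lemma continuous_branchKernel {ξ ν : ℂ} (hν : 0 < ν.re) : Continuous (branchKernel ξ ν) := by
  unfold branchKernel
  refine Continuous.if_le ?_ ?_ continuous_const continuous_id ?_
  · exact continuous_ofReal_cpow_const hν
  · exact continuous_const.mul ((continuous_ofReal_cpow_const hν).comp continuous_neg)
  · rintro x rfl
    have : ν ≠ 0 := fun h => by rw [h] at hν; norm_num at hν
    simp [this]

lemma measurable_branchKernel (ξ ν : ℂ) : Measurable (branchKernel ξ ν) := by
  unfold branchKernel
  refine Measurable.ite measurableSet_Ici ?_ ?_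
  · exact (measurable_ofReal).pow_const _
  · exact ((measurable_ofReal.comp measurable_neg).pow_const _).const_mul _

lemma intervalIntegrable_branchKernel {ξ ν : ℂ} (hν : -1 < ν.re) (a b : ℝ) :
    IntervalIntegrable (branchKernel ξ ν) volume a b := by
  have h : ∀ c : ℝ, IntervalIntegrable (fun u : ℝ => |u| ^ ν.re) volume 0 c := by
    have h0 : ∀ c : ℝ, 0 ≤ c → IntervalIntegrable (fun u : ℝ => |u| ^ ν.re) volume 0 c := by
      intro c hc
      refine (intervalIntegral.intervalIntegrable_rpow' hν).congr fun u hu => ?_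
      rw [Set.uIoc_of_le hc] at hu
      simp only [abs_of_pos hu.1]
    intro c
    rcases le_total 0 c with hc | hc
    · exact h0 c hc
    · have := (IntervalIntegrable.iff_comp_neg (f := fun u : ℝ => |u| ^ ν.re)).1 (h0 (-c) (by linarith))
      simpa using this
  refine (((h a).symm.trans (h b)).const_mul
    (1 + ‖1 - ξ‖ * Real.exp (Real.pi * ν.im))).mono_fun
    (measurable_branchKernel ξ ν).aestronglyMeasurable (Eventually.of_forall fun u => ?_)
  exact (norm_branchKernel_le ξ ν u).trans (le_abs_self _)

end Kernel

/-! ### Moments of the thinned power. -/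

section Moments

/-- The moment `∫ g(x) (s - x) ^ ν dx` with the thinned branch of the power. -/
def branchMoment (g : ℝ → ℂ) (ξ ν : ℂ) (s : ℝ) : ℂ := ∫ x, g x * branchKernel ξ ν (s - x)

lemma aestronglyMeasurable_mul_branchKernel {g : ℝ → ℂ} (hg : AEStronglyMeasurable g) (ξ ν : ℂ)
    (s : ℝ) : AEStronglyMeasurable (fun x => g x * branchKernel ξ ν (s - x)) :=
  hg.mul ((measurable_branchKernel ξ ν).comp (measurable_const.sub measurable_id)).aestronglyMeasurable

lemma integrable_mul_branchKernel {g : ℝ → ℂ} {ξ ν : ℂ} {t δ : ℝ} (hν : -1 < ν.re)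
    (hδ : 0 < δ) (hc : ContinuousOn g (Set.Icc (t - δ) (t + δ)))
    (h : IntegrableOn (fun x => g x * branchKernel ξ ν (t - x)) (Set.Icc (t - δ) (t + δ))ᶜ) :
    Integrable fun x => g x * branchKernel ξ ν (t - x) := by
  rw [← integrableOn_univ, ← Set.union_compl_self (Set.Icc (t - δ) (t + δ))]
  refine IntegrableOn.union ?_ h
  have h1 := (intervalIntegrable_branchKernel (ξ := ξ) hν (-δ) δ).comp_sub_left t
  rw [sub_neg_eq_add] at h1
  have hle : t - δ ≤ t + δ := by linarith
  have h2 := (h1.symm.mul_continuousOn (by rwa [Set.uIcc_of_le hle]))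
  rw [intervalIntegrable_iff_integrableOn_Icc_of_le hle] at h2
  exact h2.congr_fun (fun x _ => mul_comm _ _) measurableSet_Icc

/-- Differentiation of the moments under the integral sign. -/
lemma hasDerivAt_branchMoment {g : ℝ → ℂ} {ξ ν : ℂ} {t δ : ℝ} (hδ : 0 < δ)
    (hg : AEStronglyMeasurable g) {b : ℝ → ℝ} (hb : Integrable b)
    (hle : ∀ s ∈ Metric.ball t δ, ∀ x, ‖g x * branchKernel ξ (ν - 1) (s - x)‖ ≤ b x)
    (hi : Integrable fun x => g x * branchKernel ξ ν (t - x))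
    (hd : ∀ s ∈ Metric.ball t δ, ∀ x, g x ≠ 0 → s ≠ x ∨ 1 < ν.re) :
    HasDerivAt (branchMoment g ξ ν) (ν * branchMoment g ξ (ν - 1) t) t := by
  have h := (hasDerivAt_integral_of_dominated_loc_of_deriv_le (𝕜 := ℝ) (μ := volume)
    (F := fun s x => g x * branchKernel ξ ν (s - x))
    (F' := fun s x => g x * (ν * branchKernel ξ (ν - 1) (s - x))) (bound := fun x => ‖ν‖ * b x)
    (x₀ := t) (Metric.ball_mem_nhds t hδ)
    (Eventually.of_forall fun s => aestronglyMeasurable_mul_branchKernel hg ξ ν s) hi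
    (by
      have := (aestronglyMeasurable_mul_branchKernel hg ξ (ν - 1) t).const_mul ν
      refine this.congr (Eventually.of_forall fun x => ?_)
      simp only; ring)
    (Eventually.of_forall fun x s hs => by
      rw [mul_left_comm, norm_mul]
      exact mul_le_mul_of_nonneg_left (hle s hs x) (norm_nonneg _)) (hb.const_mul _)
    (Eventually.of_forall fun x s hs => by
      by_cases hx : g x = 0
      · simp only [hx, zero_mul]; exact hasDerivAt_const _ _
      refine HasDerivAt.const_mul _ ?_
      have h1 : s - x ≠ 0 ∨ 1 < ν.re := (hd s hs x hx).imp_left sub_ne_zero.2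
      have := (hasDerivAt_branchKernel (ξ := ξ) h1).comp_sub_const s x
      exact this)).2
  refine h.congr_deriv ?_
  rw [branchMoment, ← integral_const_mul]
  congr 1
  ext x
  ring

end Moments

/-! ### The three-term recurrence and derivatives of the moments. -/

section IntegrationByParts

lemma integral_eq_zero_of_hasDerivAt_off_countable {F F' : ℝ → ℂ} {S : Set ℝ} (hS : S.Countable)
    (hF : Continuous F) (hd : ∀ x ∉ S, HasDerivAt F (F' x) x) (hi : Integrable F')
    (hbot : Tendsto F atBot (𝓝 0)) (htop : Tendsto F atTop (𝓝 0)) : ∫ x, F' x = 0 := by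
  have h1 := intervalIntegral_tendsto_integral hi tendsto_neg_atTop_atBot (tendsto_id (α := ℝ))
  have h2 : Tendsto (fun r : ℝ => F r - F (-r)) atTop (𝓝 (0 - 0)) :=
    htop.sub (hbot.comp tendsto_neg_atTop_atBot)
  rw [sub_zero] at h2
  refine tendsto_nhds_unique (h1.congr fun r => ?_) h2
  exact integral_eq_of_hasDerivAt_off_countable F F' hS hF.continuousOn
    (fun x hx => hd x hx.2) hi.intervalIntegrable

variable {g : ℝ → ℂ} {ξ γ₁ γ₂ a₁ a₂ ν : ℂ}

/-- The three-term recurrence for the moments of a weight `g` with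
`g' / g = a₁ / (x - γ₁) + a₂ / (x - γ₂)`. -/
def MomentRecurrence (g : ℝ → ℂ) (ξ γ₁ γ₂ a₁ a₂ ν : ℂ) (s : ℝ) : Prop :=
  (ν + 3 + a₁ + a₂) * branchMoment g ξ (ν + 2) s
    - ((ν + 1) * ((s - γ₁) + (s - γ₂)) + (a₁ + 1) * (s - γ₂) + (a₂ + 1) * (s - γ₁))
      * branchMoment g ξ (ν + 1) s
    + (ν + 1) * ((s - γ₁) * (s - γ₂)) * branchMoment g ξ ν s = 0

/-- The integral of the derivative of `(x - γ₁)(x - γ₂) g(x) (s - x)^{ν+1}` is zero. Continuity of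
this product lets its derivative fail on a countable set, such as the ends of the support and `s`.
-/
lemma momentRecurrence {s : ℝ} {S : Set ℝ} (hS : S.Countable)
    (hg : ∀ x ∉ S, x ≠ s → ∃ d, HasDerivAt g d x ∧
      (x - γ₁) * (x - γ₂) * d = (a₁ * (x - γ₂) + a₂ * (x - γ₁)) * g x)
    (hF : Continuous fun x : ℝ => (x - γ₁) * (x - γ₂) * g x * branchKernel ξ (ν + 1) (s - x))
    (hbot : Tendsto (fun x : ℝ => (x - γ₁) * (x - γ₂) * g x * branchKernel ξ (ν + 1) (s - x))
      atBot (𝓝 0))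
    (htop : Tendsto (fun x : ℝ => (x - γ₁) * (x - γ₂) * g x * branchKernel ξ (ν + 1) (s - x))
      atTop (𝓝 0))
    (h0 : Integrable fun x => g x * branchKernel ξ ν (s - x))
    (h1 : Integrable fun x => g x * branchKernel ξ (ν + 1) (s - x))
    (h2 : Integrable fun x => g x * branchKernel ξ (ν + 2) (s - x)) :
    MomentRecurrence g ξ γ₁ γ₂ a₁ a₂ ν s := by
  set A : ℂ := ν + 3 + a₁ + a₂
  set B : ℂ := (ν + 1) * ((s - γ₁) + (s - γ₂)) + (a₁ + 1) * (s - γ₂) + (a₂ + 1) * (s - γ₁)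
    with hB
  set C : ℂ := (ν + 1) * ((s - γ₁) * (s - γ₂)) with hC
  have hi := ((h2.const_mul A).sub (h1.const_mul B)).add (h0.const_mul C)
  have hz : ∫ x, -(A * (g x * branchKernel ξ (ν + 2) (s - x))
      - B * (g x * branchKernel ξ (ν + 1) (s - x)) + C * (g x * branchKernel ξ ν (s - x))) = 0 := by
    refine integral_eq_zero_of_hasDerivAt_off_countable (hS.union (Set.countable_singleton s)) hF
      (fun x hx => ?_) hi.neg hbot htop
    have hxs : x ≠ s := fun h => hx (Or.inr h)
    obtain ⟨d, hd, hd'⟩ := hg x (fun h => hx (Or.inl h)) hxs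
    have hu : s - x ≠ 0 := sub_ne_zero.2 hxs.symm
    have hx1 : ∀ γ : ℂ, HasDerivAt (fun x : ℝ => (x : ℂ) - γ) 1 x := fun γ =>
      (ofRealCLM.hasDerivAt (x := x)).sub_const γ
    have hk : HasDerivAt (fun x => branchKernel ξ (ν + 1) (s - x))
        (-((ν + 1) * branchKernel ξ (ν + 1 - 1) (s - x))) x := by
      have := (hasDerivAt_branchKernel_of_ne (ξ := ξ) (ν := ν + 1) hu).comp_const_sub s x
      exact this
    refine ((((hx1 γ₁).mul (hx1 γ₂)).mul hd).mul hk).congr_deriv ?_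
    have k1 : branchKernel ξ (ν + 1) (s - x) = ((s - x : ℝ) : ℂ) * branchKernel ξ ν (s - x) :=
      branchKernel_add_one hu
    have k2 : branchKernel ξ (ν + 2) (s - x)
        = ((s - x : ℝ) : ℂ) * branchKernel ξ (ν + 1) (s - x) := by
      rw [← branchKernel_add_one hu]; ring_nf
    rw [add_sub_cancel_right, k2, k1, hB, hC]
    simp only [Pi.mul_apply]
    push_cast
    linear_combination ((s : ℂ) - x) * branchKernel ξ ν (s - x) * hd'
  rw [integral_neg, neg_eq_zero, integral_add (by exact (h2.const_mul A).sub (h1.const_mul B))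
    (h0.const_mul C), integral_sub (h2.const_mul A) (h1.const_mul B), integral_const_mul,
    integral_const_mul, integral_const_mul] at hz
  exact hz

/-- The moment of exponent `ν` is differentiable at `t` with the derivative prescribed by the
recurrence. -/
def HasMomentDeriv (g : ℝ → ℂ) (ξ γ₁ γ₂ a₁ a₂ ν ε : ℂ) (t : ℝ) : Prop :=
  ∃ D, HasDerivAt (branchMoment g ξ ν) D t ∧
    ((t - γ₁) * (t - γ₂)) * D = -(ν + a₁ + a₂ + 2) * branchMoment g ξ (ν + 1) t
      + (((t - γ₁) + (t - γ₂)) * ν + (a₁ + 1) * (t - γ₂) + (a₂ + 1) * (t - γ₁))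
        * branchMoment g ξ ν t + ε

lemma MomentRecurrence.hasMomentDeriv {t : ℝ}
    (hR : MomentRecurrence g ξ γ₁ γ₂ a₁ a₂ (ν - 1) t)
    (hD : HasDerivAt (branchMoment g ξ ν) (ν * branchMoment g ξ (ν - 1) t) t) :
    HasMomentDeriv g ξ γ₁ γ₂ a₁ a₂ ν 0 t := by
  refine ⟨_, hD, ?_⟩
  rw [MomentRecurrence, show ν - 1 + 2 = ν + 1 by ring, show ν - 1 + 1 = ν by ring] at hR
  linear_combination hR

/-- Differentiability is transported to smaller exponents by the recurrence. -/
lemma hasMomentDeriv_of_eventually {t : ℝ} (hν : ν ≠ -1) (hγ₁ : (t : ℂ) ≠ γ₁) (hγ₂ : (t : ℂ) ≠ γ₂)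
    (hR : ∀ᶠ s in 𝓝 t, MomentRecurrence g ξ γ₁ γ₂ a₁ a₂ ν s)
    (h1 : HasDerivAt (branchMoment g ξ (ν + 1)) ((ν + 1) * branchMoment g ξ ν t) t)
    (h2 : HasDerivAt (branchMoment g ξ (ν + 2)) ((ν + 2) * branchMoment g ξ (ν + 1) t) t) :
    HasMomentDeriv g ξ γ₁ γ₂ a₁ a₂ ν 0 t := by
  have hν' : ν + 1 ≠ 0 := fun h => hν (eq_neg_of_add_eq_zero_left h)
  have hx : ∀ γ : ℂ, HasDerivAt (fun x : ℝ => (x : ℂ) - γ) 1 t := fun γ =>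
    (ofRealCLM.hasDerivAt (x := t)).sub_const γ
  have hne : (ν + 1) * (((t : ℂ) - γ₁) * (t - γ₂)) ≠ 0 :=
    mul_ne_zero hν' (mul_ne_zero (sub_ne_zero.2 hγ₁) (sub_ne_zero.2 hγ₂))
  have hn : HasDerivAt (fun s : ℝ => ((ν + 1) * ((s - γ₁) + (s - γ₂)) + (a₁ + 1) * (s - γ₂)
        + (a₂ + 1) * (s - γ₁)) * branchMoment g ξ (ν + 1) s
      - (ν + 3 + a₁ + a₂) * branchMoment g ξ (ν + 2) s)
      ((ν + 1) * (-(ν + 2 + a₁ + a₂) * branchMoment g ξ (ν + 1) t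
        + ((ν + 1) * ((t - γ₁) + (t - γ₂)) + (a₁ + 1) * (t - γ₂)
        + (a₂ + 1) * (t - γ₁)) * branchMoment g ξ ν t)) t :=
    (((((((hx γ₁).add (hx γ₂)).const_mul (ν + 1)).add ((hx γ₂).const_mul (a₁ + 1))).add
      ((hx γ₁).const_mul (a₂ + 1))).mul h1).sub (h2.const_mul (ν + 3 + a₁ + a₂))).congr_deriv (by
        simp only [Pi.add_apply]; ring)
  have hd : HasDerivAt (fun s : ℝ => (ν + 1) * (((s : ℂ) - γ₁) * (s - γ₂)))
      ((ν + 1) * ((t - γ₁) + (t - γ₂))) t :=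
    (((hx γ₁).mul (hx γ₂)).const_mul (ν + 1)).congr_deriv (by ring)
  -- The recurrence, solved for the moment of exponent `ν`, is a quotient of differentiable
  -- functions. No moment of exponent `ν - 1`, which may diverge, appears.
  have hq := hn.div hd hne
  refine ⟨_, hq.congr_of_eventuallyEq ?_, ?_⟩
  · filter_upwards [hR, hd.continuousAt.eventually_ne hne] with s hs hs0
    rw [MomentRecurrence] at hs
    rw [Pi.div_apply, eq_div_iff hs0]
    linear_combination hs
  · have ht := hR.self_of_nhds
    rw [MomentRecurrence] at ht
    rw [← mul_div_assoc, div_eq_iff (pow_ne_zero 2 hne)]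
    generalize (t : ℂ) - γ₁ = c₁ at *
    generalize (t : ℂ) - γ₂ = c₂ at *
    linear_combination ((c₁ + c₂) * (ν + 1) * c₁ * c₂) * ht

end IntegrationByParts

/-! ### From moments of a weight to the system for the averages. -/

section Averages

variable {g : ℝ → ℂ} {ξ γ₁ γ₂ a₁ a₂ ν μ ε : ℂ} {s t : ℝ} {N : ℕ}

lemma mul_branchKernel_mul_pow_ae (g : ℝ → ℂ) (ξ ν : ℂ) (s : ℝ) (k : ℕ) :
    (fun y : ℝ => g y * branchKernel ξ ν (s - y) * ((s - y : ℝ) : ℂ) ^ k)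
      =ᵐ[volume] fun y => g y * branchKernel ξ (ν + k) (s - y) := by
  filter_upwards [compl_mem_ae_iff.2 (measure_singleton s)] with y hy
  rw [branchKernel_add_natCast (sub_ne_zero.2 (Ne.symm hy)), mul_assoc]

lemma ensemble_of_integrable (h : ∀ k, k + 2 ≤ 2 * N →
      Integrable fun x => g x * branchKernel ξ (ν + k) (s - x)) :
    Integrable (ensembleIntegrand N fun x => g x * branchKernel ξ ν (s - x)) ∧
    ∫ x, ensembleIntegrand N (fun x => g x * branchKernel ξ ν (s - x)) x
      = N.factorial * (hankel (fun k => branchMoment g ξ (ν + k) s) N).det := by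
  have h' : ∀ i j : Fin N, Integrable fun y : ℝ =>
      g y * branchKernel ξ ν (s - y) * ((s - y : ℝ) : ℂ) ^ ((i : ℕ) + j) := fun i j =>
    (h (i + j) (by omega)).congr (mul_branchKernel_mul_pow_ae g ξ ν s _).symm
  refine ⟨integrable_ensembleIntegrand h', ?_⟩
  rw [integral_ensembleIntegrand h']
  simp only [fun k => integral_congr_ae (mul_branchKernel_mul_pow_ae g ξ ν s k)]
  rfl

lemma hasDerivAt_det_hankel {m : ℕ → ℝ → ℂ} {D : ℕ → ℂ}
    (h : ∀ j, j + 2 ≤ 2 * N → HasDerivAt (m j) (D j) t) :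
    HasDerivAt (fun s => (hankel (fun j => m j s) N).det)
      (((hankel (fun j => m j t) N).adjugate * hankel D N).trace) t :=
  hasDerivAt_det fun i j => h (i + j) (by omega)

lemma differentiableAt_integral_ensembleIntegrand {E : ℝ → ℂ}
    (hE : ∀ᶠ s in 𝓝 t, E s = ∫ x, ensembleIntegrand N (fun x => g x * branchKernel ξ ν (s - x)) x)
    (hi : ∀ᶠ s in 𝓝 t, ∀ k, k + 2 ≤ 2 * N →
      Integrable fun x => g x * branchKernel ξ (ν + k) (s - x))
    (hD : ∀ k, k + 2 ≤ 2 * N → DifferentiableAt ℝ (branchMoment g ξ (ν + k)) t) :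
    DifferentiableAt ℝ E t := by
  have h := hasDerivAt_det_hankel (N := N) (m := fun k => branchMoment g ξ (ν + k))
    (D := fun k => deriv (branchMoment g ξ (ν + k)) t) fun k hk => (hD k hk).hasDerivAt
  refine (h.const_mul (N.factorial : ℂ)).differentiableAt.congr_of_eventuallyEq ?_
  filter_upwards [hE, hi] with s hs hs'
  rw [hs, (ensemble_of_integrable hs').2]

/-- The σ-functions of four averages with consecutive exponents solve the algebraic system. -/
theorem exists_isSystem_of_branchMoment {n : ℕ} (hγ₁ : (t : ℂ) ≠ γ₁) (hγ₂ : (t : ℂ) ≠ γ₂)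
    (hγ : γ₁ ≠ γ₂) {E : ℕ → ℝ → ℂ}
    (hE : ∀ k < 4, ∀ᶠ s in 𝓝 t, E k s
      = ∫ x, ensembleIntegrand (n + 1) (fun x => g x * branchKernel ξ (μ - 1 + k) (s - x)) x)
    (hi : ∀ᶠ s in 𝓝 t, ∀ k ≤ 2 * n + 3,
      Integrable fun x => g x * branchKernel ξ (μ - 1 + k) (s - x))
    (hD : ∀ k ≤ 2 * n + 3,
      HasMomentDeriv g ξ γ₁ γ₂ a₁ a₂ (μ - 1 + k) (if k = 2 * n + 3 then ε else 0) t)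
    (hR : ∀ j ≤ 2 * n + 2,
      (μ - 1 + j + 3 + a₁ + a₂) * branchMoment g ξ (μ - 1 + j + 2) t
        - ((μ - 1 + j + 1) * ((t - γ₁) + (t - γ₂)) + (a₁ + 1) * (t - γ₂) + (a₂ + 1) * (t - γ₁))
          * branchMoment g ξ (μ - 1 + j + 1) t
        + (μ - 1 + j + 1) * ((t - γ₁) * (t - γ₂)) * branchMoment g ξ (μ - 1 + j) t
        = if j = 2 * n + 2 then ε else 0)
    (h0 : ∀ k < 4, E k t ≠ 0) :
    ∃ q : ℕ → ℂ, ∃ p₁ p₂ y₁ y₂ w,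
      IsSystem ((n : ℂ) + 1) ((t - γ₁) + (t - γ₂)) ((t - γ₁) * (t - γ₂)) (a₁ + a₂)
        (a₁ * (t - γ₁) + a₂ * (t - γ₂)) μ (q 0) (q 1) (q 2) (q 3) p₁ p₂ y₁ y₂ w ∧
      ∀ k < 4, ((t - γ₁) * (t - γ₂)) * logDeriv (E k) t
        = hankelSigma ((n : ℂ) + 1) ((t - γ₁) + (t - γ₂)) (a₁ + a₂)
          (a₁ * (t - γ₁) + a₂ * (t - γ₂)) (μ - 1 + k) (q k) := by
  set m : ℕ → ℝ → ℂ := fun j => branchMoment g ξ (μ - 1 + j) with hm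
  set e₂ : ℂ := (t - γ₁) * (t - γ₂) with he₂
  have he : e₂ ≠ 0 := mul_ne_zero (sub_ne_zero.2 hγ₁) (sub_ne_zero.2 hγ₂)
  choose! D hD hD' using hD
  have hdet : ∀ k < 4, ∀ᶠ s in 𝓝 t,
      E k s = ((n + 1).factorial : ℂ) * (hankel (fun j => m (j + k) s) (n + 1)).det := by
    intro k hk
    filter_upwards [hE k hk, hi] with s hs hs'
    rw [hs, (ensemble_of_integrable fun j hj => ?_).2]
    · congr 4
      ext j
      simp only [hm]
      congr 1
      push_cast
      ring
    · have := hs' (j + k) (by omega)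
      push_cast at this
      rwa [add_assoc, add_comm (k : ℂ)]
  have hne : ∀ k < 4, (hankel (fun j => m (j + k) t) (n + 1)).det ≠ 0 := by
    intro k hk hz
    apply h0 k hk
    rw [(hdet k hk).self_of_nhds, hz, mul_zero]
  have hlog : ∀ k < 4, e₂ * logDeriv (E k) t * (hankel (fun j => m (j + k) t) (n + 1)).det
      = ((hankel (fun j => m (j + k) t) (n + 1)).adjugate
          * (e₂ • hankel (fun j => D (j + k)) (n + 1))).trace := by
    intro k hk
    have hd := (hasDerivAt_det_hankel (N := n + 1) (m := fun j => m (j + k))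
      (D := fun j => D (j + k)) (t := t) fun j hj => hD (j + k) (by omega)).const_mul
      ((n + 1).factorial : ℂ)
    rw [logDeriv_apply, Filter.EventuallyEq.deriv_eq (hdet k hk), hd.deriv, (hdet k hk).self_of_nhds, Matrix.mul_smul,
      Matrix.trace_smul, smul_eq_mul]
    have hf : ((n + 1).factorial : ℂ) ≠ 0 := by exact_mod_cast (n + 1).factorial_ne_zero
    field_simp [hne k hk]
  have hM : ∀ k : ℕ, k < 4 → IsHankelDeriv ((t : ℂ) - γ₁) (t - γ₂) a₁ a₂ (μ - 1 + k)
      (if k = 3 then ε else 0) (fun j => m (j + k) t)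
      (e₂ • hankel (fun j => D (j + k)) (n + 1)) := by
    intro k hk i j
    have h := hD' (i + j + k) (by omega)
    rw [Matrix.smul_apply, hankel, Matrix.of_apply, smul_eq_mul, he₂, h]
    have e1 : m ((i : ℕ) + j + 1 + k) t = branchMoment g ξ (μ - 1 + ((i + j + k : ℕ) : ℂ) + 1) t := by
      simp only [hm]; congr 1; push_cast; ring
    have e2 : m ((i : ℕ) + j + k) t = branchMoment g ξ (μ - 1 + ((i + j + k : ℕ) : ℂ)) t := rfl
    beta_reduce
    rw [e1, e2]
    congr 1
    · push_cast; ring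
    -- As `i, j ≤ n` and `k ≤ 3`, this forces `i = j = n` and `k = 3`: the defect sits in the last
    -- entry of the fourth matrix only.
    · by_cases hc : (i : ℕ) + j + k = 2 * n + 3
      · rw [if_pos hc, if_pos (by omega), if_pos (by omega)]
      · rw [if_neg hc]
        by_cases hk3 : k = 3
        · rw [if_neg (by omega)]
        · rw [if_neg hk3, ite_self]
  have e1 : (μ - 1 + ((1 : ℕ) : ℂ)) = μ := by push_cast; ring
  have e2 : (μ - 1 + ((2 : ℕ) : ℂ)) = μ + 1 := by push_cast; ring
  have e3 : (μ - 1 + ((3 : ℕ) : ℂ)) = μ + 2 := by push_cast; ring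
  have hM0 := hM 0 (by norm_num)
  have hM1 := hM 1 (by norm_num)
  have hM2 := hM 2 (by norm_num)
  have hM3 := hM 3 (by norm_num)
  rw [Nat.cast_zero, add_zero, if_neg (by norm_num)] at hM0
  rw [e1, if_neg (by norm_num)] at hM1
  rw [e2, if_neg (by norm_num)] at hM2
  rw [e3, if_pos rfl] at hM3
  obtain ⟨q₀, q₁, q₂, q₃, p₁, p₂, y₁, y₂, w, hs, t0, t1, t2, t3⟩ :=
    exists_isSystem (m := fun j => m j t) (sub_ne_zero.2 hγ₁) (sub_ne_zero.2 hγ₂)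
      (fun h => hγ (sub_right_injective h))
      (fun j hj => by
        have := hR j (by omega)
        rw [show 2 * (n + 1) = 2 * n + 2 by ring, ← this]
        have e1 : m (j + 1) t = branchMoment g ξ (μ - 1 + j + 1) t := by
          simp only [hm]; congr 1; push_cast; ring
        have e2 : m (j + 2) t = branchMoment g ξ (μ - 1 + j + 2) t := by
          simp only [hm]; congr 1; push_cast; ring
        rw [e1, e2]
        ring)
      (hne 0 (by norm_num)) (hne 1 (by norm_num)) (hne 2 (by norm_num)) (hne 3 (by norm_num))
      hM0 hM1 hM2 hM3
  refine ⟨fun k => if k = 0 then q₀ else if k = 1 then q₁ else if k = 2 then q₂ else q₃,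
    p₁, p₂, y₁, y₂, w, hs, fun k hk => ?_⟩
  refine mul_right_cancel₀ (hne k hk) ?_
  rw [hlog k hk, mul_comm _ (Matrix.det _)]
  interval_cases k
  · rw [Nat.cast_zero, add_zero]; exact t0
  · rw [e1]; exact t1
  · rw [e2]; exact t2
  · rw [e3]; exact t3

end Averages

/-! ### Uniform bounds for the integrands. -/

section Bounds

variable {g : ℝ → ℂ} {ξ ν : ℂ} {s t : ℝ}

lemma HasMomentDeriv.hasDerivAt {γ₁ γ₂ a₁ a₂ : ℂ} (hγ₁ : (t : ℂ) ≠ γ₁) (hγ₂ : (t : ℂ) ≠ γ₂)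
    (h : HasMomentDeriv g ξ γ₁ γ₂ a₁ a₂ ν 0 t)
    (hR : MomentRecurrence g ξ γ₁ γ₂ a₁ a₂ (ν - 1) t) :
    HasDerivAt (branchMoment g ξ ν) (ν * branchMoment g ξ (ν - 1) t) t := by
  obtain ⟨D, hD, hD'⟩ := h
  refine hD.congr_deriv ?_
  refine mul_left_cancel₀ (mul_ne_zero (sub_ne_zero.2 hγ₁) (sub_ne_zero.2 hγ₂)) ?_
  rw [hD']
  rw [MomentRecurrence, show ν - 1 + 2 = ν + 1 by ring, show ν - 1 + 1 = ν by ring] at hR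
  linear_combination -hR

/-- The sum of both endpoint values serves as one bound for either sign of `r`. -/
lemma abs_rpow_le {u r ε B : ℝ} (hε : 0 < ε) (hB : |u| ≤ B) (h : ε ≤ |u| ∨ 0 ≤ r) :
    |u| ^ r ≤ ε ^ r + B ^ r := by
  have hB0 : 0 ≤ B := (abs_nonneg u).trans hB
  rcases le_total 0 r with hr | hr
  · exact (Real.rpow_le_rpow (abs_nonneg u) hB hr).trans
      (le_add_of_nonneg_left (Real.rpow_nonneg hε.le r))
  · rcases h with h | h
    · exact (Real.rpow_le_rpow_of_nonpos hε h hr).trans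
        (le_add_of_nonneg_right (Real.rpow_nonneg hB0 r))
    · exact (Real.rpow_le_rpow (abs_nonneg u) hB h).trans
        (le_add_of_nonneg_left (Real.rpow_nonneg hε.le r))

lemma norm_mul_branchKernel_le {x ε B : ℝ} (hε : 0 < ε)
    (h : g x ≠ 0 → |s - x| ≤ B ∧ (ε ≤ |s - x| ∨ 0 ≤ ν.re)) :
    ‖g x * branchKernel ξ ν (s - x)‖
      ≤ ‖g x‖ * ((1 + ‖1 - ξ‖ * Real.exp (Real.pi * ν.im)) * (ε ^ ν.re + B ^ ν.re)) := by
  by_cases hx : g x = 0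
  · simp [hx]
  obtain ⟨h1, h2⟩ := h hx
  rw [norm_mul]
  exact mul_le_mul_of_nonneg_left ((norm_branchKernel_le ξ ν _).trans
    (mul_le_mul_of_nonneg_left (abs_rpow_le hε h1 h2) (by positivity))) (norm_nonneg _)

lemma integrableOn_mul_branchKernel (hg : Integrable g) {A : Set ℝ} (hA : MeasurableSet A)
    {ε B : ℝ} (hε : 0 < ε) (h : ∀ x ∈ A, g x ≠ 0 → |s - x| ≤ B ∧ ε ≤ |s - x|) :
    IntegrableOn (fun x => g x * branchKernel ξ ν (s - x)) A := by
  refine Integrable.mono' (hg.norm.integrableOn.mul_const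
    ((1 + ‖1 - ξ‖ * Real.exp (Real.pi * ν.im)) * (ε ^ ν.re + B ^ ν.re)))
    (aestronglyMeasurable_mul_branchKernel hg.1 ξ ν s).restrict
    ((ae_restrict_iff' hA).2 (Eventually.of_forall fun x hx => ?_))
  exact norm_mul_branchKernel_le hε fun h0 => ⟨(h x hx h0).1, Or.inl (h x hx h0).2⟩

end Bounds

/-! ### The Jacobi weight. -/

section Jacobi

/-- The density `x^a (1-x)^b` on `(0,T)`, extended by zero. -/
def jacobiDensity (a b : ℂ) (T x : ℝ) : ℂ :=
  if 0 < x ∧ x < T then (x : ℂ) ^ a * ((1 - x : ℝ) : ℂ) ^ b else 0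

/-- The truncation `T` is harmless for the averages near `s`, and the truncated density is
integrable. -/
structure IsJacobiCut (a b ξ : ℂ) (T s : ℝ) : Prop where
  re_a : -1 < a.re
  pos : 0 < T
  ne_zero : s ≠ 0
  ne : s ≠ T
  cut : (T = 1 ∧ -1 < b.re) ∨ (ξ = 1 ∧ T < 1 ∧ s < T)

variable {a b ξ ν μ : ℂ} {T s t x : ℝ}

lemma IsJacobiCut.le_one (h : IsJacobiCut a b ξ T s) : T ≤ 1 := by
  rcases h.cut with h | h
  · exact h.1.le
  · exact h.2.1.le

lemma IsJacobiCut.eventually (h : IsJacobiCut a b ξ T t) :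
    ∀ᶠ s in 𝓝 t, IsJacobiCut a b ξ T s ∧ (0 < s ∧ s < T → 0 < t ∧ t < T) := by
  have h1 : ∀ᶠ s in 𝓝 t, s ≠ 0 := isOpen_ne.mem_nhds h.ne_zero
  have h2 : ∀ᶠ s in 𝓝 t, s ≠ T := isOpen_ne.mem_nhds h.ne
  have h3 : ∀ᶠ s in 𝓝 t, t < T → s < T := by
    by_cases ht : t < T
    · filter_upwards [gt_mem_nhds ht] with s hs _ using hs
    · exact Eventually.of_forall fun s h => absurd h ht
  have h4 : ∀ᶠ s in 𝓝 t, T < t → T < s := by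
    by_cases ht : T < t
    · filter_upwards [lt_mem_nhds ht] with s hs _ using hs
    · exact Eventually.of_forall fun s h => absurd h ht
  have h5 : ∀ᶠ s in 𝓝 t, t < 0 → s < 0 := by
    by_cases ht : t < 0
    · filter_upwards [gt_mem_nhds ht] with s hs _ using hs
    · exact Eventually.of_forall fun s h => absurd h ht
  filter_upwards [h1, h2, h3, h4, h5] with s h1 h2 h3 h4 h5
  refine ⟨⟨h.re_a, h.pos, h1, h2, h.cut.imp_right fun hc => ⟨hc.1, hc.2.1, h3 hc.2.2⟩⟩, ?_⟩
  rintro ⟨hs, hs'⟩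
  constructor
  · by_contra hc
    exact hs.not_gt (h5 (lt_of_le_of_ne (not_lt.1 hc) h.ne_zero))
  · by_contra hc
    exact hs'.not_gt (h4 (lt_of_le_of_ne (not_lt.1 hc) h.ne.symm))

/-- If `x = 1` is not integrable, then `ξ = 1` and the weight vanishes beyond `t`; cutting halfway
between `max t 0` and `1` discards only zeros. -/
lemma exists_isJacobiCut (ht0 : t ≠ 0) (ht1 : t ≠ 1) (ha : -1 < a.re)
    (hb : -1 < b.re ∨ (ξ = 1 ∧ t < 1)) : ∃ T, IsJacobiCut a b ξ T t := by
  by_cases h : -1 < b.re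
  · exact ⟨1, ha, one_pos, ht0, ht1, Or.inl ⟨rfl, h⟩⟩
  · obtain ⟨hξ, ht⟩ := hb.resolve_left h
    have h1 : max t 0 < 1 := max_lt ht one_pos
    have h2 : t < (1 + max t 0) / 2 := by linarith [le_max_left t 0]
    exact ⟨(1 + max t 0) / 2, ha, by linarith [le_max_right t 0], ht0, h2.ne,
      Or.inr ⟨hξ, by linarith, h2⟩⟩

lemma jacobiWeight_eq (h : IsJacobiCut a b ξ T s) (ν : ℂ) :
    jacobiWeight a b ν ξ s = fun x => jacobiDensity a b T x * branchKernel ξ ν (s - x) := by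
  ext x
  unfold jacobiWeight jacobiDensity
  rw [← thinning_mul_branchPow]
  by_cases hx : 0 < x ∧ x < T
  · rw [if_pos hx, if_pos ⟨hx.1, hx.2.trans_le h.le_one⟩]
    ring
  · rw [if_neg hx, zero_mul]
    split_ifs with hx1
    swap
    · rfl
    have hT : T ≤ x := not_lt.1 fun h' => hx ⟨hx1.1, h'⟩
    rcases h.cut with ⟨hc, -⟩ | ⟨hc, -, hs⟩
    · exact absurd hx1.2 (not_lt.2 (hc ▸ hT))
    · rw [thinning, if_pos (hs.trans_le hT), hc]
      ring

lemma jacobiDensity_of_le_zero (hx : x ≤ 0) : jacobiDensity a b T x = 0 :=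
  if_neg fun h => hx.not_gt h.1

lemma jacobiDensity_of_le (hx : T ≤ x) : jacobiDensity a b T x = 0 :=
  if_neg fun h => hx.not_gt h.2

lemma jacobiDensity_ne_zero (hx : jacobiDensity a b T x ≠ 0) : 0 < x ∧ x < T := by
  by_contra h
  exact hx (if_neg h)

lemma jacobiDensity_eventuallyEq (h0 : 0 < x) (hT : x < T) :
    jacobiDensity a b T =ᶠ[𝓝 x] fun x => (x : ℂ) ^ a * ((1 - x : ℝ) : ℂ) ^ b := by
  filter_upwards [lt_mem_nhds h0, gt_mem_nhds hT] with y h1 h2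
  exact if_pos ⟨h1, h2⟩

lemma hasDerivAt_jacobiDensity (h0 : 0 < x) (hT : x < T) (h1 : T ≤ 1) :
    HasDerivAt (jacobiDensity a b T) (a * (x : ℂ) ^ (a - 1) * ((1 - x : ℝ) : ℂ) ^ b
      - (x : ℂ) ^ a * (b * ((1 - x : ℝ) : ℂ) ^ (b - 1))) x := by
  have h2 := (hasDerivAt_ofReal_cpow_of_pos (ν := b) (u := 1 - x) (by linarith)).comp_const_sub 1 x
  refine (((hasDerivAt_ofReal_cpow_of_pos (ν := a) h0).mul h2).congr_of_eventuallyEq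
    (jacobiDensity_eventuallyEq h0 hT)).congr_deriv ?_
  ring

lemma jacobiDensity_pearson (h0 : 0 < x) (hT : x < T) (h1 : T ≤ 1) :
    ((x : ℂ) - 0) * (x - 1) * (a * (x : ℂ) ^ (a - 1) * ((1 - x : ℝ) : ℂ) ^ b
      - (x : ℂ) ^ a * (b * ((1 - x : ℝ) : ℂ) ^ (b - 1)))
      = (a * (x - 1) + b * (x - 0)) * jacobiDensity a b T x := by
  have hx : (x : ℂ) ≠ 0 := by exact_mod_cast h0.ne'
  have hx1 : ((1 - x : ℝ) : ℂ) ≠ 0 := by exact_mod_cast (show (1 - x : ℝ) ≠ 0 by linarith)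
  rw [jacobiDensity, if_pos ⟨h0, hT⟩, cpow_sub _ _ hx, cpow_sub _ _ hx1, cpow_one, cpow_one]
  field_simp
  push_cast
  ring

lemma IsJacobiCut.integrable (h : IsJacobiCut a b ξ T s) : Integrable (jacobiDensity a b T) := by
  have key : IntegrableOn (fun x : ℝ => (x : ℂ) ^ a * ((1 - x : ℝ) : ℂ) ^ b) (Set.Ioo 0 T) := by
    rcases h.cut with ⟨hT, hb⟩ | ⟨-, hT, -⟩
    · have := betaIntegral_convergent (u := a + 1) (v := b + 1) (by simpa using by linarith [h.re_a])
        (by simpa using by linarith)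
      rw [intervalIntegrable_iff_integrableOn_Ioo_of_le zero_le_one] at this
      rw [hT]
      simpa using this
    · have := betaIntegral_convergent (u := a + 1) (v := 1) (by simpa using by linarith [h.re_a])
        (by simp)
      simp only [add_sub_cancel_right, sub_self, cpow_zero, mul_one] at this
      have h2 : IntervalIntegrable (fun x : ℝ => (x : ℂ) ^ a) volume 0 T :=
        this.mono_set (by
          rw [Set.uIcc_of_le h.pos.le, Set.uIcc_of_le zero_le_one]
          exact Set.Icc_subset_Icc_right hT.le)
      have h3 := h2.mul_continuousOn (g := fun x : ℝ => ((1 - x : ℝ) : ℂ) ^ b) (by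
        rw [Set.uIcc_of_le h.pos.le]
        intro x hx
        have hx1 : 0 < 1 - x := by linarith [hx.2]
        exact ((hasDerivAt_ofReal_cpow_of_pos (ν := b) hx1).comp_const_sub 1
          x).continuousAt.continuousWithinAt)
      rwa [intervalIntegrable_iff_integrableOn_Ioo_of_le h.pos.le] at h3
  rw [← integrable_indicator_iff measurableSet_Ioo] at key
  refine key.congr (Eventually.of_forall fun x => ?_)
  simp only [Set.indicator, Set.mem_Ioo, jacobiDensity]

lemma IsJacobiCut.integrable_mul (h : IsJacobiCut a b ξ T s) (hν : 0 < s ∧ s < T → -1 < ν.re) :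
    Integrable fun x => jacobiDensity a b T x * branchKernel ξ ν (s - x) := by
  have hB : ∀ x, jacobiDensity a b T x ≠ 0 → |s - x| ≤ |s| + 1 := by
    intro x hx
    have := jacobiDensity_ne_zero hx
    have := h.le_one
    refine (abs_sub s x).trans ?_
    rw [abs_of_pos (a := x) (by linarith)]
    linarith
  by_cases hs : 0 < s ∧ s < T
  · set δ := min s (T - s) / 2 with hδ
    have hδ0 : 0 < δ := by
      have : 0 < min s (T - s) := lt_min hs.1 (by linarith [hs.2])
      linarith
    have hδ1 : δ < s := by linarith [min_le_left s (T - s)]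
    have hδ2 : s + δ < T := by linarith [min_le_right s (T - s)]
    refine integrable_mul_branchKernel (hν hs) hδ0 (fun x hx => ?_) ?_
    · exact (hasDerivAt_jacobiDensity (by linarith [hx.1]) (by linarith [hx.2])
        h.le_one).continuousAt.continuousWithinAt
    · refine integrableOn_mul_branchKernel h.integrable measurableSet_Icc.compl hδ0
        fun x hx h0 => ⟨hB x h0, ?_⟩
      by_contra hc
      have := abs_lt.1 (not_le.1 hc)
      exact hx ⟨by linarith [this.2], by linarith [this.1]⟩
  · rw [← integrableOn_univ]
    rcases lt_or_gt_of_ne h.ne_zero with h0 | h0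
    · refine integrableOn_mul_branchKernel h.integrable MeasurableSet.univ (ε := -s) (by linarith)
        fun x _ hx => ⟨hB x hx, ?_⟩
      have := jacobiDensity_ne_zero hx
      rw [abs_of_neg (by linarith)]
      linarith
    · have hT : T < s := lt_of_le_of_ne (not_lt.1 fun hT => hs ⟨h0, hT⟩) h.ne.symm
      refine integrableOn_mul_branchKernel h.integrable MeasurableSet.univ (ε := s - T)
        (by linarith) fun x _ hx => ⟨hB x hx, ?_⟩
      have := jacobiDensity_ne_zero hx
      rw [abs_of_pos (by linarith)]
      linarith

/-- The extra factor `x` raises the exponent to `a + 1`, of positive real part, so the extension by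
zero, written with `max x 0`, is continuous. -/
lemma continuousAt_mul_jacobiDensity_zero (ha : -1 < a.re) (h0 : 0 < T) (h1 : T ≤ 1) :
    ContinuousAt (fun x : ℝ => ((x : ℂ) - 0) * (x - 1) * jacobiDensity a b T x) 0 := by
  have hc : ContinuousAt (fun x : ℝ => -(((max x 0 : ℝ) : ℂ) ^ (a + 1))
      * ((1 - x : ℝ) : ℂ) ^ (b + 1)) 0 := by
    refine ContinuousAt.mul ?_ ?_
    · exact ((continuous_ofReal_cpow_const (y := a + 1) (by simpa using by linarith)).comp
        (continuous_id.max continuous_const)).neg.continuousAt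
    · exact ((hasDerivAt_ofReal_cpow_of_pos (ν := b + 1) (u := 1 - 0)
        (by norm_num)).comp_const_sub 1 0).continuousAt
  refine hc.congr ?_
  filter_upwards [gt_mem_nhds h0] with x hx
  have ha1 : a + 1 ≠ 0 := fun h => by
    have := congrArg re h
    simp at this
    linarith
  rcases le_or_gt x 0 with hx0 | hx0
  · rw [jacobiDensity_of_le_zero hx0, max_eq_right hx0, ofReal_zero, zero_cpow ha1]
    ring
  · have hx1 : ((1 - x : ℝ) : ℂ) ≠ 0 := by exact_mod_cast (show (1 - x : ℝ) ≠ 0 by linarith)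
    rw [jacobiDensity, if_pos ⟨hx0, hx⟩, max_eq_left hx0.le,
      cpow_add _ _ (by exact_mod_cast hx0.ne'), cpow_add _ _ hx1, cpow_one, cpow_one]
    push_cast
    ring

lemma continuousAt_mul_jacobiDensity_one (hb : -1 < b.re) :
    ContinuousAt (fun x : ℝ => ((x : ℂ) - 0) * (x - 1) * jacobiDensity a b 1 x) 1 := by
  have hc : ContinuousAt (fun x : ℝ => -((x : ℂ) ^ (a + 1))
      * ((max (1 - x) 0 : ℝ) : ℂ) ^ (b + 1)) 1 := by
    refine ContinuousAt.mul ?_ ?_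
    · exact (hasDerivAt_ofReal_cpow_of_pos (ν := a + 1) one_pos).continuousAt.neg
    · exact ((continuous_ofReal_cpow_const (y := b + 1) (by simpa using by linarith)).comp
        ((continuous_const.sub continuous_id).max continuous_const)).continuousAt
  refine hc.congr ?_
  filter_upwards [lt_mem_nhds (zero_lt_one' ℝ)] with x hx
  have hb1 : b + 1 ≠ 0 := fun h => by
    have := congrArg re h
    simp at this
    linarith
  rcases le_or_gt 1 x with hx0 | hx0
  · rw [jacobiDensity_of_le hx0, max_eq_right (by linarith), ofReal_zero, zero_cpow hb1]
    ring
  · have hx1 : ((1 - x : ℝ) : ℂ) ≠ 0 := by exact_mod_cast (show (1 - x : ℝ) ≠ 0 by linarith)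
    rw [jacobiDensity, if_pos ⟨hx, hx0⟩, max_eq_left (by linarith),
      cpow_add _ _ (by exact_mod_cast hx.ne'), cpow_add _ _ hx1, cpow_one, cpow_one]
    push_cast
    ring

lemma IsJacobiCut.continuous (h : IsJacobiCut a b ξ T s) (hν : 0 < s ∧ s < T → 0 < ν.re) :
    Continuous fun x : ℝ =>
      ((x : ℂ) - 0) * (x - 1) * jacobiDensity a b T x * branchKernel ξ ν (s - x) := by
  have hk : ∀ x : ℝ, (x ≠ s ∨ 0 < ν.re) → ContinuousAt (fun x => branchKernel ξ ν (s - x)) x := by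
    rintro x (hx | hx)
    · exact ((hasDerivAt_branchKernel_of_ne (ξ := ξ) (ν := ν)
        (sub_ne_zero.2 hx.symm)).comp_const_sub s x).continuousAt
    · exact ((continuous_branchKernel hx).comp (continuous_const.sub continuous_id)).continuousAt
  have hz : ∀ x : ℝ, (∀ᶠ y in 𝓝 x, jacobiDensity a b T y * branchKernel ξ ν (s - y) = 0) →
      ContinuousAt (fun x : ℝ =>
        ((x : ℂ) - 0) * (x - 1) * jacobiDensity a b T x * branchKernel ξ ν (s - x)) x := by
    intro x hx
    refine (continuousAt_const (y := (0 : ℂ))).congr ?_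
    filter_upwards [hx] with y hy
    rw [mul_assoc, hy, mul_zero]
  refine continuous_iff_continuousAt.2 fun x => ?_
  rcases lt_trichotomy x 0 with hx | rfl | hx
  · refine hz x ?_
    filter_upwards [gt_mem_nhds hx] with y hy
    rw [jacobiDensity_of_le_zero hy.le, zero_mul]
  · exact (continuousAt_mul_jacobiDensity_zero h.re_a h.pos h.le_one).mul
      (hk 0 (Or.inl h.ne_zero.symm))
  · rcases lt_trichotomy x T with hxT | rfl | hxT
    · refine ContinuousAt.mul (ContinuousAt.mul ?_
        (hasDerivAt_jacobiDensity hx hxT h.le_one).continuousAt) (hk x ?_)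
      · fun_prop
      · by_cases hs : x = s
        · exact Or.inr (hν (hs ▸ ⟨hx, hxT⟩))
        · exact Or.inl hs
    · rcases h.cut with ⟨rfl, hb⟩ | ⟨rfl, hT, hs⟩
      · exact (continuousAt_mul_jacobiDensity_one hb).mul (hk 1 (Or.inl h.ne.symm))
      -- At a cut `T < 1` the density may jump, but `ξ = 1` and `s < T` make the kernel vanish
      -- nearby.
      · refine hz x ?_
        filter_upwards [lt_mem_nhds hs] with y hy
        rw [branchKernel_one_of_neg (by linarith), mul_zero]
    · refine hz x ?_
      filter_upwards [lt_mem_nhds hxT] with y hy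
      rw [jacobiDensity_of_le hy.le, zero_mul]

lemma IsJacobiCut.momentRecurrence (h : IsJacobiCut a b ξ T s)
    (hν : 0 < s ∧ s < T → -1 < ν.re) :
    MomentRecurrence (jacobiDensity a b T) ξ 0 1 a b ν s := by
  have h1 : 0 < s ∧ s < T → 0 < (ν + 1).re := fun hs => by
    have := hν hs
    rw [add_re, one_re]; linarith
  refine UnitaryEnsemble.momentRecurrence (S := {0, T}) (by simp) (fun x hx _ => ?_)
    (h.continuous h1) ?_ ?_ (h.integrable_mul hν) (h.integrable_mul fun hs => by
      linarith [h1 hs]) (h.integrable_mul fun hs => ?_)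
  · simp only [Set.mem_insert_iff, Set.mem_singleton_iff, not_or] at hx
    rcases lt_or_gt_of_ne hx.1 with h0 | h0
    · refine ⟨0, (hasDerivAt_const x (0 : ℂ)).congr_of_eventuallyEq ?_, ?_⟩
      · filter_upwards [gt_mem_nhds h0] with y hy using jacobiDensity_of_le_zero hy.le
      · rw [jacobiDensity_of_le_zero h0.le]; ring
    rcases lt_or_gt_of_ne hx.2 with hT | hT
    · exact ⟨_, hasDerivAt_jacobiDensity h0 hT h.le_one, jacobiDensity_pearson h0 hT h.le_one⟩
    · refine ⟨0, (hasDerivAt_const x (0 : ℂ)).congr_of_eventuallyEq ?_, ?_⟩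
      · filter_upwards [lt_mem_nhds hT] with y hy using jacobiDensity_of_le hy.le
      · rw [jacobiDensity_of_le hT.le]; ring
  · refine tendsto_const_nhds.congr' ?_
    filter_upwards [eventually_le_atBot 0] with y hy
    rw [jacobiDensity_of_le_zero hy, mul_zero, zero_mul]
  · refine tendsto_const_nhds.congr' ?_
    filter_upwards [eventually_ge_atTop T] with y hy
    rw [jacobiDensity_of_le hy, mul_zero, zero_mul]
  · have := hν hs
    have h2 : (2 : ℂ).re = 2 := rfl
    rw [add_re, h2]
    linarith

/-- If `t` lies in the support, the differentiated kernel is bounded because `1 < ν.re`. Otherwise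
nearby `s` keep the distance `ε`, half that of `t` to `{0, T}`, from the support, and `ν` is
unrestricted. -/
lemma IsJacobiCut.hasDerivAt_of_one_lt (h : IsJacobiCut a b ξ T t)
    (hν : 0 < t ∧ t < T → 1 < ν.re) :
    HasDerivAt (branchMoment (jacobiDensity a b T) ξ ν)
      (ν * branchMoment (jacobiDensity a b T) ξ (ν - 1) t) t := by
  have hd : 0 < min |t| |t - T| :=
    lt_min (abs_pos.2 h.ne_zero) (abs_pos.2 (sub_ne_zero.2 h.ne))
  set ε := min |t| |t - T| / 2 with hε
  have hε0 : 0 < ε := by linarith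
  set δ := min ε 1 with hδ
  have hδ0 : 0 < δ := lt_min hε0 one_pos
  have hν1 : 0 < t ∧ t < T → 0 ≤ (ν - 1).re := fun ht => by
    have := hν ht
    rw [sub_re, one_re]; linarith
  have hfar : ∀ s ∈ Metric.ball t δ, ∀ x, 0 < x ∧ x < T → ¬ (0 < t ∧ t < T) → ε ≤ |s - x| := by
    intro s hs x hx ht
    rw [Metric.mem_ball, Real.dist_eq, abs_lt] at hs
    have hδε : δ ≤ ε := min_le_left _ _
    rcases lt_or_gt_of_ne h.ne_zero with h0 | h0
    · have : ε ≤ |t| / 2 := by linarith [min_le_left |t| |t - T|]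
      rw [abs_of_neg h0] at this
      rw [abs_of_neg (by linarith)]
      linarith
    · have hT : T < t := lt_of_le_of_ne (not_lt.1 fun hT => ht ⟨h0, hT⟩) h.ne.symm
      have : ε ≤ |t - T| / 2 := by linarith [min_le_right |t| |t - T|]
      rw [abs_of_pos (by linarith)] at this
      rw [abs_of_pos (by linarith)]
      linarith
  refine hasDerivAt_branchMoment hδ0 h.integrable.1
    (b := fun x => ‖jacobiDensity a b T x‖ * ((1 + ‖1 - ξ‖ * Real.exp (Real.pi * (ν - 1).im))
      * (ε ^ (ν - 1).re + (|t| + 2) ^ (ν - 1).re))) (h.integrable.norm.mul_const _)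
    (fun s hs x => norm_mul_branchKernel_le hε0 fun hx => ?_)
    (h.integrable_mul fun ht => by linarith [hν ht]) (fun s hs x hx => ?_)
  · have hx' := jacobiDensity_ne_zero hx
    refine ⟨?_, ?_⟩
    · rw [Metric.mem_ball, Real.dist_eq] at hs
      have hδ1 : δ ≤ 1 := min_le_right _ _
      have h1 : |s - x| ≤ |s - t| + |t| + |x| := by
        have := abs_sub_le s t x
        have := abs_sub t x
        linarith
      rw [abs_of_pos hx'.1] at h1
      linarith [h.le_one]
    · by_cases ht : 0 < t ∧ t < T
      · exact Or.inr (hν1 ht)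
      · exact Or.inl (hfar s hs x hx' ht)
  · by_cases ht : 0 < t ∧ t < T
    · exact Or.inr (hν ht)
    · left
      rintro rfl
      have := hfar s hs s (jacobiDensity_ne_zero hx) ht
      rw [sub_self, abs_zero] at this
      linarith

lemma IsJacobiCut.ofReal_ne (h : IsJacobiCut a b ξ T t) (h1 : t ≠ 1) :
    (t : ℂ) ≠ 0 ∧ (t : ℂ) ≠ 1 :=
  ⟨by exact_mod_cast h.ne_zero, by exact_mod_cast h1⟩

lemma IsJacobiCut.hasMomentDeriv_of_eventually (h : IsJacobiCut a b ξ T t) (h1 : t ≠ 1)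
    (hν : -1 < ν.re)
    (hd1 : HasDerivAt (branchMoment (jacobiDensity a b T) ξ (ν + 1))
      ((ν + 1) * branchMoment (jacobiDensity a b T) ξ ν t) t) :
    HasMomentDeriv (jacobiDensity a b T) ξ 0 1 a b ν 0 t := by
  refine UnitaryEnsemble.hasMomentDeriv_of_eventually (fun h => by simp [h] at hν)
    (h.ofReal_ne h1).1 (h.ofReal_ne h1).2 ?_ hd1 ?_
  · filter_upwards [h.eventually] with s hs
    exact hs.1.momentRecurrence fun _ => hν
  · have := h.hasDerivAt_of_one_lt (ν := ν + 2) fun _ => by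
      rw [add_re, show (2 : ℂ).re = 2 from rfl]; linarith
    rwa [show ν + 2 - 1 = ν + 1 by ring] at this

/-- First descent: exponents `ν + 1`, `ν + 2` of real part above `1` give those with `0 < ν.re`. A
second descent, in `IsJacobiCut.hasMomentDeriv`, reaches `-1 < ν.re`. -/
lemma IsJacobiCut.hasDerivAt (h : IsJacobiCut a b ξ T t) (h1 : t ≠ 1)
    (hν : 0 < t ∧ t < T → 0 < ν.re) :
    HasDerivAt (branchMoment (jacobiDensity a b T) ξ ν)
      (ν * branchMoment (jacobiDensity a b T) ξ (ν - 1) t) t := by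
  by_cases ht : 0 < t ∧ t < T
  · refine (h.hasMomentDeriv_of_eventually h1 (by linarith [hν ht]) ?_).hasDerivAt
      (h.ofReal_ne h1).1 (h.ofReal_ne h1).2 (h.momentRecurrence fun _ => by
        rw [sub_re, one_re]; linarith [hν ht])
    have := h.hasDerivAt_of_one_lt (ν := ν + 1) fun _ => by
      rw [add_re, one_re]; linarith [hν ht]
    rwa [add_sub_cancel_right] at this
  · exact h.hasDerivAt_of_one_lt fun h => absurd h ht

lemma IsJacobiCut.hasMomentDeriv (h : IsJacobiCut a b ξ T t) (h1 : t ≠ 1)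
    (hν : 0 < t ∧ t < T → -1 < ν.re) :
    HasMomentDeriv (jacobiDensity a b T) ξ 0 1 a b ν 0 t := by
  by_cases ht : 0 < t ∧ t < T
  · refine h.hasMomentDeriv_of_eventually h1 (hν ht) ?_
    have := h.hasDerivAt h1 (ν := ν + 1) fun _ => by
      rw [add_re, one_re]; linarith [hν ht]
    rwa [add_sub_cancel_right] at this
  · exact (h.momentRecurrence fun h => absurd h ht).hasMomentDeriv
      (h.hasDerivAt h1 fun h => absurd h ht)

end Jacobi

/-! ### The Cauchy weight. -/

section Cauchy

/-- The density `(1+ix)^{-(η₁+iη₂)} (1-ix)^{-(η₁-iη₂)}` on the real line. -/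
def cauchyDensity (η₁ η₂ x : ℝ) : ℂ :=
  (1 + I * x) ^ (-((η₁ : ℂ) + I * η₂)) * (1 - I * x) ^ (-((η₁ : ℂ) - I * η₂))

variable {η₁ η₂ s t x : ℝ} {ξ ν μ : ℂ}

lemma cauchyWeight_eq (η₁ η₂ : ℝ) (ν ξ : ℂ) (s : ℝ) : cauchyWeight η₁ η₂ ν ξ s
    = fun x => cauchyDensity η₁ η₂ x * branchKernel ξ ν (s - x) := by
  ext x
  rw [← thinning_mul_branchPow, cauchyWeight, cauchyDensity]
  ring

lemma one_add_I_mul_mem_slitPlane (x : ℝ) : 1 + I * x ∈ slitPlane := Or.inl (by simp)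

lemma one_sub_I_mul_mem_slitPlane (x : ℝ) : 1 - I * x ∈ slitPlane := Or.inl (by simp)

lemma hasDerivAt_cauchyDensity (η₁ η₂ x : ℝ) : ∃ d, HasDerivAt (cauchyDensity η₁ η₂) d x ∧
    ((x : ℂ) - I) * (x - -I) * d = (-((η₁ : ℂ) + I * η₂) * (x - -I)
      + -((η₁ : ℂ) - I * η₂) * (x - I)) * cauchyDensity η₁ η₂ x := by
  have h1 := (((hasDerivAt_id (x : ℂ)).const_mul I).const_add 1).cpow_const
    (c := -((η₁ : ℂ) + I * η₂)) (one_add_I_mul_mem_slitPlane x)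
  have h2 := (((hasDerivAt_id (x : ℂ)).const_mul I).const_sub 1).cpow_const
    (c := -((η₁ : ℂ) - I * η₂)) (one_sub_I_mul_mem_slitPlane x)
  refine ⟨_, (h1.mul h2).comp_ofReal, ?_⟩
  have n1 : 1 + I * (x : ℂ) ≠ 0 := slitPlane_ne_zero (one_add_I_mul_mem_slitPlane x)
  have n2 : 1 - I * (x : ℂ) ≠ 0 := slitPlane_ne_zero (one_sub_I_mul_mem_slitPlane x)
  simp only [id_eq, cauchyDensity]
  rw [cpow_sub _ _ n1, cpow_sub _ _ n2, cpow_one, cpow_one]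
  have e1 : (x : ℂ) - I = -I * (1 + I * x) := by linear_combination x * I_sq
  have e2 : (x : ℂ) - -I = I * (1 - I * x) := by linear_combination x * I_sq
  rw [e1, e2]
  field_simp
  ring_nf
  rw [I_pow_three]
  ring

lemma continuous_cauchyDensity (η₁ η₂ : ℝ) : Continuous (cauchyDensity η₁ η₂) :=
  continuous_iff_continuousAt.2 fun x =>
    (hasDerivAt_cauchyDensity η₁ η₂ x).choose_spec.1.continuousAt

lemma norm_cpow_le_rpow_mul_exp {z w : ℂ} (hz : z ≠ 0) :
    ‖z ^ w‖ ≤ ‖z‖ ^ w.re * Real.exp (Real.pi * |w.im|) := by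
  rw [norm_cpow_of_ne_zero hz, div_eq_mul_inv, ← Real.exp_neg]
  refine mul_le_mul_of_nonneg_left (Real.exp_le_exp.2 ?_) (by positivity)
  refine (neg_le_abs _).trans ?_
  rw [abs_mul]
  exact mul_le_mul_of_nonneg_right (abs_arg_le_pi z) (abs_nonneg _)

lemma norm_cauchyDensity_le (η₁ η₂ x : ℝ) : ‖cauchyDensity η₁ η₂ x‖
    ≤ Real.exp (Real.pi * |η₂|) ^ 2 * (1 + x ^ 2) ^ (-η₁) := by
  have n1 : 1 + I * (x : ℂ) ≠ 0 := slitPlane_ne_zero (one_add_I_mul_mem_slitPlane x)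
  have n2 : 1 - I * (x : ℂ) ≠ 0 := slitPlane_ne_zero (one_sub_I_mul_mem_slitPlane x)
  have h1 := norm_cpow_le_rpow_mul_exp (w := -((η₁ : ℂ) + I * η₂)) n1
  have h2 := norm_cpow_le_rpow_mul_exp (w := -((η₁ : ℂ) - I * η₂)) n2
  have e1 : (-((η₁ : ℂ) + I * η₂)).re = -η₁ := by simp
  have e2 : (-((η₁ : ℂ) - I * η₂)).re = -η₁ := by simp
  have e3 : |(-((η₁ : ℂ) + I * η₂)).im| = |η₂| := by simp
  have e4 : |(-((η₁ : ℂ) - I * η₂)).im| = |η₂| := by simp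
  rw [e1, e3] at h1
  rw [e2, e4] at h2
  have e5 : ‖1 + I * (x : ℂ)‖ * ‖1 - I * (x : ℂ)‖ = 1 + x ^ 2 := by
    rw [← norm_mul, show (1 + I * (x : ℂ)) * (1 - I * x) = ((1 + x ^ 2 : ℝ) : ℂ) by
      push_cast; linear_combination -x ^ 2 * I_sq, norm_real, Real.norm_eq_abs,
      abs_of_pos (by positivity)]
  rw [cauchyDensity, norm_mul, ← e5, Real.mul_rpow (norm_nonneg _) (norm_nonneg _)]
  refine (mul_le_mul h1 h2 (norm_nonneg _) (by positivity)).trans_eq ?_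
  ring

/-- Rests on `(s - x)² ≤ (2 S² + 2)(1 + x²)`, uniformly in `|s| ≤ S`; `max ν.re 0` covers negative
exponents away from the singularity. -/
lemma norm_cauchyDensity_mul_le {S : ℝ} (η₁ η₂ : ℝ) (ξ ν : ℂ) (hS : |s| ≤ S)
    (h : 0 ≤ ν.re ∨ 1 ≤ |s - x|) :
    ‖cauchyDensity η₁ η₂ x * branchKernel ξ ν (s - x)‖
      ≤ Real.exp (Real.pi * |η₂|) ^ 2 * ((1 + ‖1 - ξ‖ * Real.exp (Real.pi * ν.im))
        * (2 * S ^ 2 + 2) ^ (max ν.re 0 / 2)) * (1 + x ^ 2) ^ (max ν.re 0 / 2 - η₁) := by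
  have h1 : |s - x| ^ ν.re ≤ |s - x| ^ max ν.re 0 := by
    rcases h with h | h
    · rw [max_eq_left h]
    · exact Real.rpow_le_rpow_of_exponent_le h (le_max_left _ _)
  have h2 : |s - x| ^ max ν.re 0
      ≤ (2 * S ^ 2 + 2) ^ (max ν.re 0 / 2) * (1 + x ^ 2) ^ (max ν.re 0 / 2) := by
    have : |s - x| ^ max ν.re 0 = (|s - x| ^ 2) ^ (max ν.re 0 / 2) := by
      rw [← Real.rpow_natCast, ← Real.rpow_mul (abs_nonneg _)]
      congr 1
      push_cast
      ring
    rw [this, ← Real.mul_rpow (by positivity) (by positivity), sq_abs]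
    refine Real.rpow_le_rpow (sq_nonneg _) ?_ (by positivity)
    have hs : s ^ 2 ≤ S ^ 2 := sq_le_sq' (by linarith [abs_le.1 hS]) (abs_le.1 hS).2
    nlinarith [sq_nonneg (s + x), sq_nonneg (S * x)]
  rw [norm_mul, sub_eq_add_neg (max ν.re 0 / 2), Real.rpow_add (by positivity)]
  refine (mul_le_mul (norm_cauchyDensity_le η₁ η₂ x) ((norm_branchKernel_le ξ ν _).trans
    (mul_le_mul_of_nonneg_left (h1.trans h2) (by positivity))) (norm_nonneg _)
    (by positivity)).trans_eq ?_
  ring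

lemma integrable_one_add_sq_rpow {r : ℝ} (h : r < -(1 / 2)) :
    Integrable fun x : ℝ => (1 + x ^ 2) ^ r := by
  have := integrable_rpow_neg_one_add_norm_sq (E := ℝ) (μ := volume) (r := -(2 * r))
    (by simp; linarith)
  simpa using this

lemma tendsto_one_add_sq_rpow {r : ℝ} (h : r < 0) {l : Filter ℝ}
    (hl : Tendsto (fun x : ℝ => 1 + x ^ 2) l atTop) :
    Tendsto (fun x : ℝ => (1 + x ^ 2) ^ r) l (𝓝 0) := by
  have := (tendsto_rpow_neg_atTop (y := -r) (by linarith)).comp hl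
  rwa [neg_neg] at this

lemma max_half_sub_lt {r η : ℝ} (hη : 1 < 2 * η) (h : r < 2 * η - 1) :
    max r 0 / 2 - η < -(1 / 2) := by
  have : max r 0 < 2 * η - 1 := max_lt h (by linarith)
  linarith

lemma integrable_cauchyDensity_mul (hη : 1 < 2 * η₁) (h1 : -1 < ν.re) (h2 : ν.re < 2 * η₁ - 1) :
    Integrable fun x => cauchyDensity η₁ η₂ x * branchKernel ξ ν (s - x) := by
  refine integrable_mul_branchKernel h1 one_pos (continuous_cauchyDensity η₁ η₂).continuousOn ?_
  refine Integrable.mono' ((integrable_one_add_sq_rpow (max_half_sub_lt hη h2)).const_mul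
    (Real.exp (Real.pi * |η₂|) ^ 2 * ((1 + ‖1 - ξ‖ * Real.exp (Real.pi * ν.im))
        * (2 * |s| ^ 2 + 2) ^ (max ν.re 0 / 2)))).integrableOn
    (aestronglyMeasurable_mul_branchKernel
      (continuous_cauchyDensity η₁ η₂).aestronglyMeasurable ξ ν s).restrict
    ((ae_restrict_iff' measurableSet_Icc.compl).2 (Eventually.of_forall fun x hx => ?_))
  refine norm_cauchyDensity_mul_le η₁ η₂ ξ ν le_rfl (Or.inr ?_)
  by_contra hc
  have := abs_lt.1 (not_le.1 hc)
  exact hx ⟨by linarith [this.2], by linarith [this.1]⟩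

lemma tendsto_cauchyDensity_mul (h1 : 0 ≤ ν.re) (h2 : ν.re < 2 * η₁ - 2) {l : Filter ℝ}
    (hl : Tendsto (fun x : ℝ => 1 + x ^ 2) l atTop) :
    Tendsto (fun x : ℝ => ((x : ℂ) - I) * (x - -I) * cauchyDensity η₁ η₂ x
      * branchKernel ξ ν (s - x)) l (𝓝 0) := by
  set C := Real.exp (Real.pi * |η₂|) ^ 2 * ((1 + ‖1 - ξ‖ * Real.exp (Real.pi * ν.im))
        * (2 * |s| ^ 2 + 2) ^ (ν.re / 2)) with hC
  have h3 := (tendsto_one_add_sq_rpow (r := ν.re / 2 - η₁ + 1) (by linarith) hl).const_mul C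
  rw [mul_zero] at h3
  refine squeeze_zero_norm (fun x => ?_) h3
  have h4 := norm_cauchyDensity_mul_le (x := x) η₁ η₂ ξ ν (le_refl |s|) (Or.inl h1)
  rw [max_eq_left h1] at h4
  have e : ((x : ℂ) - I) * (x - -I) = ((1 + x ^ 2 : ℝ) : ℂ) := by
    push_cast; linear_combination -I_sq
  rw [mul_assoc, norm_mul, e, norm_real, Real.norm_eq_abs, abs_of_pos (by positivity : 0 < 1 + x ^ 2),
    Real.rpow_add_one (by positivity)]
  refine (mul_le_mul_of_nonneg_left h4 (by positivity)).trans_eq ?_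
  rw [hC]
  ring

lemma tendsto_one_add_sq_atTop : Tendsto (fun x : ℝ => 1 + x ^ 2) atTop atTop :=
  tendsto_atTop_add_const_left _ _ (tendsto_pow_atTop two_ne_zero)

lemma tendsto_one_add_sq_atBot : Tendsto (fun x : ℝ => 1 + x ^ 2) atBot atTop := by
  have := tendsto_one_add_sq_atTop.comp tendsto_neg_atBot_atTop
  simpa [Function.comp_def] using this

lemma re_add_two (ν : ℂ) : (ν + 2).re = ν.re + 2 := by
  rw [add_re, show (2 : ℂ).re = 2 from rfl]

/-- The upper bound is exactly what makes the highest moment, of exponent `ν + 2`, pass the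
integrability criterion and the boundary terms decay. -/
lemma momentRecurrence_cauchyDensity (h1 : -1 < ν.re) (h2 : ν.re < 2 * η₁ - 3) :
    MomentRecurrence (cauchyDensity η₁ η₂) ξ I (-I) (-((η₁ : ℂ) + I * η₂))
      (-((η₁ : ℂ) - I * η₂)) ν s := by
  have h3 : 0 < (ν + 1).re := by rw [add_re, one_re]; linarith
  have h4 : (ν + 1).re < 2 * η₁ - 2 := by rw [add_re, one_re]; linarith
  refine momentRecurrence Set.countable_empty (fun x _ _ => hasDerivAt_cauchyDensity η₁ η₂ x) ?_
    (tendsto_cauchyDensity_mul h3.le h4 tendsto_one_add_sq_atBot)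
    (tendsto_cauchyDensity_mul h3.le h4 tendsto_one_add_sq_atTop)
    (integrable_cauchyDensity_mul (by linarith) h1 (by linarith))
    (integrable_cauchyDensity_mul (by linarith) (by linarith) (by linarith))
    (integrable_cauchyDensity_mul (by linarith) (by rw [re_add_two]; linarith)
      (by rw [re_add_two]; linarith))
  have hk : Continuous fun x : ℝ => branchKernel ξ (ν + 1) (s - x) :=
    (continuous_branchKernel h3).comp (continuous_const.sub continuous_id)
  have hg := continuous_cauchyDensity η₁ η₂
  fun_prop

lemma hasDerivAt_branchMoment_cauchyDensity_of_one_lt (h1 : 1 < ν.re) (h2 : ν.re < 2 * η₁ - 1) :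
    HasDerivAt (branchMoment (cauchyDensity η₁ η₂) ξ ν)
      (ν * branchMoment (cauchyDensity η₁ η₂) ξ (ν - 1) t) t := by
  have h3 : 0 < (ν - 1).re := by rw [sub_re, one_re]; linarith
  refine hasDerivAt_branchMoment one_pos (continuous_cauchyDensity η₁ η₂).aestronglyMeasurable
    ((integrable_one_add_sq_rpow (max_half_sub_lt (r := (ν - 1).re) (η := η₁) (by linarith)
      (by rw [sub_re, one_re]; linarith))).const_mul
    (Real.exp (Real.pi * |η₂|) ^ 2 * ((1 + ‖1 - ξ‖ * Real.exp (Real.pi * (ν - 1).im))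
        * (2 * (|t| + 1) ^ 2 + 2) ^ (max (ν - 1).re 0 / 2))))
    (fun s hs x => norm_cauchyDensity_mul_le η₁ η₂ ξ (ν - 1) ?_ (Or.inl h3.le))
    (integrable_cauchyDensity_mul (by linarith) (by linarith) h2) fun _ _ _ _ => Or.inr h1
  rw [Metric.mem_ball, Real.dist_eq] at hs
  have := abs_sub_abs_le_abs_sub s t
  linarith

lemma ofReal_ne_I (t : ℝ) : (t : ℂ) ≠ I := fun h => by simpa using congrArg im h

lemma ofReal_ne_neg_I (t : ℝ) : (t : ℂ) ≠ -I := fun h => by simpa using congrArg im h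

lemma hasDerivAt_branchMoment_cauchyDensity (h1 : 0 < ν.re) (h2 : ν.re < 2 * η₁ - 1)
    (h3 : 1 < ν.re ∨ ν.re < 2 * η₁ - 3) :
    HasDerivAt (branchMoment (cauchyDensity η₁ η₂) ξ ν)
      (ν * branchMoment (cauchyDensity η₁ η₂) ξ (ν - 1) t) t := by
  rcases h3 with h3 | h3
  · exact hasDerivAt_branchMoment_cauchyDensity_of_one_lt h3 h2
  have d1 := hasDerivAt_branchMoment_cauchyDensity_of_one_lt (ν := ν + 1) (η₁ := η₁) (η₂ := η₂)
    (ξ := ξ) (t := t) (by rw [add_re, one_re]; linarith) (by rw [add_re, one_re]; linarith)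
  have d2 := hasDerivAt_branchMoment_cauchyDensity_of_one_lt (ν := ν + 2) (η₁ := η₁) (η₂ := η₂)
    (ξ := ξ) (t := t) (by rw [re_add_two]; linarith) (by rw [re_add_two]; linarith)
  rw [add_sub_cancel_right] at d1
  rw [show ν + 2 - 1 = ν + 1 by ring] at d2
  exact (hasMomentDeriv_of_eventually (fun h => by simp [h] at h1; linarith) (ofReal_ne_I t)
    (ofReal_ne_neg_I t) (Eventually.of_forall fun s => momentRecurrence_cauchyDensity
    (by linarith) h3) d1 d2).hasDerivAt (ofReal_ne_I t) (ofReal_ne_neg_I t)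
    (momentRecurrence_cauchyDensity (by rw [sub_re, one_re]; linarith)
      (by rw [sub_re, one_re]; linarith))

lemma hasMomentDeriv_cauchyDensity (h1 : 0 < ν.re) (h2 : ν.re < 2 * η₁ - 2)
    (h3 : 1 < ν.re ∨ ν.re < 2 * η₁ - 3) :
    HasMomentDeriv (cauchyDensity η₁ η₂) ξ I (-I) (-((η₁ : ℂ) + I * η₂))
      (-((η₁ : ℂ) - I * η₂)) ν 0 t :=
  (momentRecurrence_cauchyDensity (by rw [sub_re, one_re]; linarith)
    (by rw [sub_re, one_re]; linarith)).hasMomentDeriv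
    (hasDerivAt_branchMoment_cauchyDensity h1 (by linarith) h3)

lemma hasMomentDeriv_cauchyDensity_of_neg_one_lt (h1 : -1 < ν.re) (h2 : ν.re < 2 * η₁ - 4) :
    HasMomentDeriv (cauchyDensity η₁ η₂) ξ I (-I) (-((η₁ : ℂ) + I * η₂))
      (-((η₁ : ℂ) - I * η₂)) ν 0 t := by
  have d1 := hasDerivAt_branchMoment_cauchyDensity (ν := ν + 1) (η₁ := η₁) (η₂ := η₂)
    (ξ := ξ) (t := t) (by rw [add_re, one_re]; linarith) (by rw [add_re, one_re]; linarith)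
    (Or.inr (by rw [add_re, one_re]; linarith))
  have d2 := hasDerivAt_branchMoment_cauchyDensity_of_one_lt (ν := ν + 2) (η₁ := η₁) (η₂ := η₂)
    (ξ := ξ) (t := t) (by rw [re_add_two]; linarith) (by rw [re_add_two]; linarith)
  rw [add_sub_cancel_right] at d1
  rw [show ν + 2 - 1 = ν + 1 by ring] at d2
  exact hasMomentDeriv_of_eventually (fun h => by simp [h] at h1) (ofReal_ne_I t)
    (ofReal_ne_neg_I t) (Eventually.of_forall fun s => momentRecurrence_cauchyDensity
    (by linarith) (by linarith)) d1 d2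

end Cauchy

/-! ### Analytic continuation in the parameter `t`. -/

section Continuation

/-- Infinite meromorphic order at one point propagates over a preconnected set, so poles on the way
do no harm; continuity at `z` turns vanishing nearby into vanishing at `z`. -/
lemma eq_zero_of_isPreconnected {Ω : Set ℂ} (hΩ : IsPreconnected Ω) {G : ℂ → ℂ}
    (hG : MeromorphicOn G Ω) {t z : ℂ} (ht : t ∈ Ω) (hz : z ∈ Ω)
    (h0 : ∃ᶠ w in 𝓝[≠] t, G w = 0) (hc : ContinuousAt G z) : G z = 0 := by
  have h1 : meromorphicOrderAt G t = ⊤ := by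
    rw [meromorphicOrderAt_eq_top_iff]
    exact (hG t ht).frequently_zero_iff_eventuallyEq_zero.1 h0
  have h2 : meromorphicOrderAt G z = ⊤ := by
    by_contra h
    exact hG.meromorphicOrderAt_ne_top_of_isPreconnected hΩ hz ht h h1
  rw [meromorphicOrderAt_eq_top_iff] at h2
  refine tendsto_nhds_unique (hc.tendsto.mono_left nhdsWithin_le_nhds) ?_ (l := 𝓝[≠] z)
  exact tendsto_const_nhds.congr' (h2.mono fun w hw => hw.symm)

/-- Relations between logarithmic derivatives on the real line persist under analytic
continuation. -/
lemma relation_of_isPreconnected {Φ : ℂ → (Fin 4 → ℂ) → ℂ}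
    (hm : ∀ (L : Fin 4 → ℂ → ℂ) (w : ℂ), (∀ k, MeromorphicAt (L k) w) →
      MeromorphicAt (fun z => Φ z fun k => L k z) w)
    (hc : ∀ (L : Fin 4 → ℂ → ℂ) (w : ℂ), (∀ k, ContinuousAt (L k) w) →
      ContinuousAt (fun z => Φ z fun k => L k z) w)
    {Ω : Set ℂ} (hΩo : IsOpen Ω) (hΩ : IsPreconnected Ω) {t : ℝ} (ht : (t : ℂ) ∈ Ω)
    {f : Fin 4 → ℂ → ℂ} {A : Fin 4 → ℝ → ℂ} (hf : ∀ k, DifferentiableOn ℂ (f k) Ω)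
    (hfA : ∀ k, ∀ᶠ s : ℝ in 𝓝 t, f k s = A k s)
    (hA : ∀ᶠ s : ℝ in 𝓝 t, (∀ k, A k s ≠ 0) → Φ s (fun k => logDeriv (A k) s) = 0)
    {z : ℂ} (hz : z ∈ Ω) (h0 : ∀ k, f k z ≠ 0) : Φ z (fun k => logDeriv (f k) z) = 0 := by
  have han : ∀ k, AnalyticOnNhd ℂ (f k) Ω := fun k => (hf k).analyticOnNhd hΩo
  refine eq_zero_of_isPreconnected (G := fun z => Φ z fun k => logDeriv (f k) z) hΩ
    (fun w hw => hm _ w fun k => ?_) ht hz ?_ (hc _ z fun k => ?_)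
  · exact (han k w hw).meromorphicAt.deriv.div (han k w hw).meromorphicAt
  -- Being nonzero at `z`, no `f k` vanishes identically near `t`, so its zeros there are isolated;
  -- the averages may still vanish at `t` itself.
  · have h1 : ∀ k, ∀ᶠ w in 𝓝[≠] (t : ℂ), f k w ≠ 0 := by
      intro k
      refine (han k t ht).eventually_eq_zero_or_eventually_ne_zero.resolve_left fun h => h0 k ?_
      exact (han k).eqOn_zero_of_preconnected_of_eventuallyEq_zero hΩ ht h hz
    have h2 : Tendsto (fun s : ℝ => (s : ℂ)) (𝓝[≠] t) (𝓝[≠] (t : ℂ)) :=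
      tendsto_nhdsWithin_iff.2 ⟨continuous_ofReal.continuousAt.tendsto.mono_left
        nhdsWithin_le_nhds, eventually_mem_nhdsWithin.mono fun s hs => by
          simpa using hs⟩
    refine h2.frequently (Eventually.frequently ?_)
    have h3 := h2.eventually (eventually_all.2 h1)
    have h4 := (eventually_all.2 fun k => (hfA k).eventually_nhds).filter_mono
      (nhdsWithin_le_nhds (s := {t}ᶜ))
    have h5 : ∀ᶠ s : ℝ in 𝓝[≠] t, (s : ℂ) ∈ Ω :=
      (h2.mono_right nhdsWithin_le_nhds).eventually (hΩo.mem_nhds ht)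
    filter_upwards [h3, h4, h5, hA.filter_mono nhdsWithin_le_nhds] with s h3 h4 h5 h6
    have h7 : ∀ k, logDeriv (A k) s = logDeriv (f k) s := by
      intro k
      have hd := ((hf k).differentiableAt (hΩo.mem_nhds h5)).hasDerivAt.comp_ofReal
      have := hd.congr_of_eventuallyEq ((h4 k).mono fun x hx => hx.symm)
      rw [logDeriv_apply, logDeriv_apply, this.deriv, (h4 k).self_of_nhds]
    simp only [← h7]
    exact h6 fun k => by rw [← (h4 k).self_of_nhds]; exact h3 k
  · exact (han k z hz).deriv.continuousAt.div (han k z hz).continuousAt (h0 k)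

/-- The four shifted parameters as a family. -/
def shiftTuple (μ : ℂ) : Fin 4 → ℂ := ![μ - 1, μ, μ + 1, μ + 2]

lemma shiftTuple_mem (μ : ℂ) (k : Fin 4) : shiftTuple μ k ∈ shifts μ := by
  fin_cases k <;> simp [shiftTuple, shifts]

lemma forall_shifts {p : ℂ → Prop} {μ : ℂ} :
    (∀ ν ∈ shifts μ, p ν) ↔ ∀ k < 4, p (μ - 1 + (k : ℕ)) := by
  have e1 : μ - 1 + ((1 : ℕ) : ℂ) = μ := by push_cast; ring
  have e2 : μ - 1 + ((2 : ℕ) : ℂ) = μ + 1 := by push_cast; ring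
  have e3 : μ - 1 + ((3 : ℕ) : ℂ) = μ + 2 := by push_cast; ring
  constructor
  · intro h k hk
    interval_cases k
    · rw [Nat.cast_zero, add_zero]; exact h _ (by simp [shifts])
    · rw [e1]; exact h _ (by simp [shifts])
    · rw [e2]; exact h _ (by simp [shifts])
    · rw [e3]; exact h _ (by simp [shifts])
  · rintro h ν (rfl | rfl | rfl | rfl)
    · simpa using h 0 (by norm_num)
    · simpa only [e1] using h 1 (by norm_num)
    · simpa only [e2] using h 2 (by norm_num)
    · simpa only [e3] using h 3 (by norm_num)

lemma ensembleIntegrand_zero (w : ℝ → ℂ) (x : Fin 0 → ℝ) : ensembleIntegrand 0 w x = 1 := by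
  simp [ensembleIntegrand, vandermondeSq]

end Continuation

/-! ### The Jacobi case of the theorem. -/

section JacobiAverage

variable {N : ℕ} {a b μ ξ ν : ℂ} {t T : ℝ}

lemma IsJacobiCut.of_regular (hμ : 0 < μ.re ∨ t < 0 ∨ 1 < t) (h : IsJacobiCut a b ξ T t)
    (ht : 0 < t ∧ t < T) : 0 < μ.re := by
  have := h.le_one
  rcases hμ with h | h | h
  · exact h
  · linarith [ht.1]
  · linarith [ht.2]

lemma jacobiAverage_eq (h : IsJacobiCut a b ξ T t) (N : ℕ) (ν : ℂ) : jacobiAverage N a b ν ξ t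
    = ∫ x, ensembleIntegrand N (fun x => jacobiDensity a b T x * branchKernel ξ ν (t - x)) x := by
  rw [jacobiAverage, jacobiWeight_eq h]

lemma IsJacobiCut.re_add_natCast (hμ : 0 < t ∧ t < T → 0 < μ.re) (k : ℕ) :
    0 < t ∧ t < T → -1 < (μ - 1 + k).re := fun ht => by
  have := hμ ht
  rw [add_re, sub_re, one_re, natCast_re]
  have : (0 : ℝ) ≤ k := Nat.cast_nonneg k
  linarith

lemma IsJacobiCut.integrable_and_differentiableAt (h : IsJacobiCut a b ξ T t) (h1 : t ≠ 1)
    (hμ : 0 < t ∧ t < T → 0 < μ.re) (N k : ℕ) :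
    Integrable (ensembleIntegrand N (jacobiWeight a b (μ - 1 + k) ξ t)) ∧
      DifferentiableAt ℝ (fun s : ℝ => jacobiAverage N a b (μ - 1 + k) ξ s) t := by
  have hk : ∀ j : ℕ, μ - 1 + (k : ℂ) + j = μ - 1 + ((k + j : ℕ) : ℂ) := fun j => by
    push_cast; ring
  constructor
  · rw [jacobiWeight_eq h]
    refine (ensemble_of_integrable fun j _ => ?_).1
    rw [hk]
    exact h.integrable_mul (re_add_natCast hμ _)
  · refine differentiableAt_integral_ensembleIntegrand (N := N) (g := jacobiDensity a b T) (ξ := ξ)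
      (ν := μ - 1 + k) ?_ ?_ fun j _ => ?_
    · filter_upwards [h.eventually] with s hs
      rw [jacobiAverage_eq hs.1]
    · filter_upwards [h.eventually] with s hs j _
      rw [hk]
      exact hs.1.integrable_mul (re_add_natCast (fun h => hμ (hs.2 h)) _)
    · rw [hk]
      exact (h.hasMomentDeriv h1 (re_add_natCast hμ _)).choose_spec.1.differentiableAt

lemma IsJacobiCut.jacobiRecurrence (h : IsJacobiCut a b ξ T t) (h1 : t ≠ 1)
    (hμ : 0 < t ∧ t < T → 0 < μ.re) (h0 : ∀ ν ∈ shifts μ, jacobiAverage N a b ν ξ t ≠ 0) :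
    JacobiRecurrence N a b μ t (UJ N a b (μ - 1) ξ t) (UJ N a b μ ξ t)
      (UJ N a b (μ + 1) ξ t) (UJ N a b (μ + 2) ξ t) := by
  rcases N with - | n
  -- There are no orthogonal polynomials for `N = 0`; the average is constant and the equation is a
  -- polynomial identity.
  · have hc : ∀ ν, logDeriv (fun s : ℝ => jacobiAverage 0 a b ν ξ s) t = 0 := fun ν => by
      simp [jacobiAverage, ensembleIntegrand_zero, logDeriv_apply]
    unfold JacobiRecurrence UJ jacobiSigma esymTwo esymTwo'
    simp only [hc, Nat.cast_zero]
    ring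
  · rw [forall_shifts] at h0
    obtain ⟨q, p₁, p₂, y₁, y₂, w, hs, hq⟩ := exists_isSystem_of_branchMoment (n := n)
      (g := jacobiDensity a b T) (ξ := ξ) (a₁ := a) (a₂ := b) (μ := μ) (ε := 0)
      (E := fun k s => jacobiAverage (n + 1) a b (μ - 1 + k) ξ s)
      (h.ofReal_ne h1).1 (h.ofReal_ne h1).2 zero_ne_one
      (fun k _ => h.eventually.mono fun s hs => jacobiAverage_eq hs.1 _ _)
      (h.eventually.mono fun s hs k _ =>
        hs.1.integrable_mul (re_add_natCast (fun h => hμ (hs.2 h)) _))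
      (fun k _ => by
        rw [ite_self]
        exact h.hasMomentDeriv h1 (re_add_natCast hμ _))
      (fun j _ => by
        rw [ite_self]
        exact h.momentRecurrence (re_add_natCast hμ _)) h0
    have ht : (t : ℂ) * (t - 1) ≠ 0 := mul_ne_zero (h.ofReal_ne h1).1
      (sub_ne_zero.2 (h.ofReal_ne h1).2)
    have e : (t : ℂ) + (t - 1) = 2 * t - 1 := by ring
    simp only [sub_zero, e] at hs hq
    have q0 := hq 0 (by norm_num)
    have q1 := hq 1 (by norm_num)
    have q2 := hq 2 (by norm_num)
    have q3 := hq 3 (by norm_num)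
    rw [Nat.cast_zero, add_zero] at q0
    rw [Nat.cast_one, sub_add_cancel] at q1
    rw [show μ - 1 + ((2 : ℕ) : ℂ) = μ + 1 by push_cast; ring] at q2
    rw [show μ - 1 + ((3 : ℕ) : ℂ) = μ + 2 by push_cast; ring] at q3
    rw [← Nat.cast_add_one] at hs q0 q1 q2 q3
    exact jacobiRecurrence_of_isSystem ht hs q0 q1 q2 q3

lemma jacobiRecurrence_real (h0 : t ≠ 0) (h1 : t ≠ 1) (ha : -1 < a.re)
    (hb : -1 < b.re ∨ (ξ = 1 ∧ t < 1)) (hμ : 0 < μ.re ∨ t < 0 ∨ 1 < t)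
    (hE : ∀ ν ∈ shifts μ, jacobiAverage N a b ν ξ t ≠ 0) :
    JacobiRecurrence N a b μ t (UJ N a b (μ - 1) ξ t) (UJ N a b μ ξ t)
      (UJ N a b (μ + 1) ξ t) (UJ N a b (μ + 2) ξ t) := by
  obtain ⟨T, hT⟩ := exists_isJacobiCut h0 h1 ha hb
  exact hT.jacobiRecurrence h1 (hT.of_regular hμ) hE

/-- The conditions on `t` are open, so the equation holds on a real neighbourhood, as the identity
theorem requires. -/
lemma eventually_jacobi_regular (h0 : t ≠ 0) (h1 : t ≠ 1)
    (hb : -1 < b.re ∨ (ξ = 1 ∧ t < 1)) (hμ : 0 < μ.re ∨ t < 0 ∨ 1 < t) :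
    ∀ᶠ s in 𝓝 t, s ≠ 0 ∧ s ≠ 1 ∧ (-1 < b.re ∨ (ξ = 1 ∧ s < 1)) ∧
      (0 < μ.re ∨ s < 0 ∨ 1 < s) := by
  refine Eventually.and (isOpen_ne.mem_nhds h0) (Eventually.and (isOpen_ne.mem_nhds h1)
    (Eventually.and ?_ ?_))
  · rcases hb with hb | ⟨hξ, ht⟩
    · exact Eventually.of_forall fun _ => Or.inl hb
    · exact (gt_mem_nhds ht).mono fun s hs => Or.inr ⟨hξ, hs⟩
  · rcases hμ with h | h | h
    · exact Eventually.of_forall fun _ => Or.inl h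
    · exact (gt_mem_nhds h).mono fun s hs => Or.inr (Or.inl hs)
    · exact (lt_mem_nhds h).mono fun s hs => Or.inr (Or.inr hs)

/-- The difference of the two sides of the Jacobi recurrence. -/
def jacobiDefect (N : ℕ) (a b μ t Ud U U₁ U₂ : ℂ) : ℂ :=
  ((N + a + μ + 1) * U - (N + a + μ) * U₁ + 1 / 4 * (a - b) ^ 2 * t
      - 1 / 4 * (a ^ 2 + b ^ 2) - 1 / 4 * (a + b) * N)
    * ((N + b + μ + 1) * U - (N + b + μ) * U₁ + 1 / 4 * (a - b) ^ 2 * t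
      + 1 / 2 * a * b + 1 / 4 * (a + b) * N)
    * (U₁ - Ud + (2 * N + 2 * μ + a + b) * (t - 1 / 2))
    * (U₂ - U + (2 * N + 2 * μ + 2 + a + b) * (t - 1 / 2))
  - t * (t - 1)
    * ((N + a + μ) * (N + b + μ) * (U₁ - Ud) - (2 * N + 2 * μ + a + b) * U
      - 1 / 4 * (a - b) ^ 2 * (2 * N + 2 * μ + a + b) * t
      + 1 / 4 * (b - a) * (2 * N * b + (b - a) * μ + b * (a + b)))
    * ((N + a + μ + 1) * (N + b + μ + 1) * (U₂ - U) - (2 * N + 2 * μ + 2 + a + b) * U₁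
      - 1 / 4 * (a - b) ^ 2 * (2 * N + 2 * μ + 2 + a + b) * t
      + 1 / 4 * (b - a) * (2 * N * b + (b - a) * (μ + 1) + b * (a + b)))

lemma jacobiRecurrence_iff {t Ud U U₁ U₂ : ℂ} : JacobiRecurrence N a b μ t Ud U U₁ U₂
    ↔ jacobiDefect N a b μ t Ud U U₁ U₂ = 0 :=
  sub_eq_zero.symm

lemma jacobiRecurrence_complex (h0 : t ≠ 0) (h1 : t ≠ 1) (ha : -1 < a.re)
    (hb : -1 < b.re ∨ (ξ = 1 ∧ t < 1)) (hμ : 0 < μ.re ∨ t < 0 ∨ 1 < t) {Ω : Set ℂ}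
    {E : ℂ → ℂ → ℂ} (hΩo : IsOpen Ω) (hΩ : IsPreconnected Ω) (ht : (t : ℂ) ∈ Ω)
    (hE : ∀ ν ∈ shifts μ, DifferentiableOn ℂ (E ν) Ω ∧
      ∀ᶠ s : ℝ in 𝓝 t, E ν (s : ℂ) = jacobiAverage N a b ν ξ s) {z : ℂ} (hz : z ∈ Ω)
    (hEz : ∀ ν ∈ shifts μ, E ν z ≠ 0) :
    JacobiRecurrence N a b μ z
      (jacobiSigma N a b (μ - 1) z (logDeriv (E (μ - 1)) z))
      (jacobiSigma N a b μ z (logDeriv (E μ) z))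
      (jacobiSigma N a b (μ + 1) z (logDeriv (E (μ + 1)) z))
      (jacobiSigma N a b (μ + 2) z (logDeriv (E (μ + 2)) z)) := by
  have := relation_of_isPreconnected (Φ := fun z L => jacobiDefect N a b μ z
      (jacobiSigma N a b (μ - 1) z (L 0)) (jacobiSigma N a b μ z (L 1))
      (jacobiSigma N a b (μ + 1) z (L 2)) (jacobiSigma N a b (μ + 2) z (L 3)))
    (f := fun k => E (shiftTuple μ k))
    (A := fun k s => jacobiAverage N a b (shiftTuple μ k) ξ s) ?_ ?_ hΩo hΩ ht
    (fun k => (hE _ (shiftTuple_mem μ k)).1) (fun k => (hE _ (shiftTuple_mem μ k)).2)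
    ((eventually_jacobi_regular h0 h1 hb hμ).mono fun s hs hne => jacobiRecurrence_iff.1
      (jacobiRecurrence_real hs.1 hs.2.1 ha hs.2.2.1 hs.2.2.2 (by
        rintro ν (rfl | rfl | rfl | rfl)
        exacts [hne 0, hne 1, hne 2, hne 3]))) hz (fun k => hEz _ (shiftTuple_mem μ k))
  · exact jacobiRecurrence_iff.2 this
  · intro L w hL
    have := hL 0
    have := hL 1
    have := hL 2
    have := hL 3
    unfold jacobiDefect jacobiSigma
    fun_prop
  · intro L w hL
    have := hL 0
    have := hL 1
    have := hL 2
    have := hL 3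
    unfold jacobiDefect jacobiSigma
    fun_prop

end JacobiAverage

/-! ### The Cauchy case of the theorem. -/

section CauchyAverage

variable {N n : ℕ} {η₁ η₂ t : ℝ} {μ ξ : ℂ}

/-- The left-hand side of the three-term recurrence of the moments. -/
def momentDefect (g : ℝ → ℂ) (ξ γ₁ γ₂ a₁ a₂ ν : ℂ) (t : ℝ) : ℂ :=
  (ν + 3 + a₁ + a₂) * branchMoment g ξ (ν + 2) t
    - ((ν + 1) * ((t - γ₁) + (t - γ₂)) + (a₁ + 1) * (t - γ₂) + (a₂ + 1) * (t - γ₁))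
      * branchMoment g ξ (ν + 1) t
    + (ν + 1) * ((t - γ₁) * (t - γ₂)) * branchMoment g ξ ν t

lemma hasMomentDeriv_momentDefect {g : ℝ → ℂ} {γ₁ γ₂ a₁ a₂ ν : ℂ}
    (h : HasDerivAt (branchMoment g ξ (ν + 1)) ((ν + 1) * branchMoment g ξ ν t) t) :
    HasMomentDeriv g ξ γ₁ γ₂ a₁ a₂ (ν + 1) (momentDefect g ξ γ₁ γ₂ a₁ a₂ ν t) t := by
  refine ⟨_, h, ?_⟩
  rw [momentDefect, show ν + 1 + 1 = ν + 2 by ring]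
  ring

lemma re_sub_one_add_natCast (μ : ℂ) (k : ℕ) : (μ - 1 + k).re = μ.re - 1 + k := by
  rw [add_re, sub_re, one_re, natCast_re]

/-- At `k = 2 n + 3` the derivative formula contains the moment of exponent `μ + 2 n + 3`, which may
diverge. Whatever value the integral then has, the same value enters `momentDefect` and cancels. The
cases `k = 0` and `k = 1` descend from larger exponents; for `k ≥ 2` the real part exceeds `1`. -/
lemma hasMomentDeriv_cauchyDensity_natCast (h0 : 0 < μ.re) (h1 : μ.re + 2 * n + 3 < 2 * η₁)
    {k : ℕ} (hk : k ≤ 2 * n + 3) :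
    HasMomentDeriv (cauchyDensity η₁ η₂) ξ I (-I) (-((η₁ : ℂ) + I * η₂))
      (-((η₁ : ℂ) - I * η₂)) (μ - 1 + k) (if k = 2 * n + 3 then momentDefect (cauchyDensity η₁ η₂)
        ξ I (-I) (-((η₁ : ℂ) + I * η₂)) (-((η₁ : ℂ) - I * η₂)) (μ - 1 + (2 * n + 2 : ℕ)) t
        else 0) t := by
  have hn : (0 : ℝ) ≤ n := Nat.cast_nonneg n
  split_ifs with h
  · have e : μ - 1 + (k : ℂ) = μ - 1 + (2 * n + 2 : ℕ) + 1 := by rw [h]; push_cast; ring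
    rw [e]
    refine hasMomentDeriv_momentDefect ?_
    have hre : (μ - 1 + ((2 * n + 2 : ℕ) : ℂ) + 1).re = μ.re + 2 * n + 2 := by
      rw [add_re, re_sub_one_add_natCast, one_re]; push_cast; ring
    have := hasDerivAt_branchMoment_cauchyDensity_of_one_lt (η₁ := η₁) (η₂ := η₂) (ξ := ξ) (t := t)
      (ν := μ - 1 + ((2 * n + 2 : ℕ) : ℂ) + 1) (by rw [hre]; linarith) (by rw [hre]; linarith)
    rwa [add_sub_cancel_right] at this
  · have hk' : (k : ℝ) ≤ 2 * n + 2 := by exact_mod_cast (by omega : k ≤ 2 * n + 2)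
    rcases Nat.lt_trichotomy k 1 with hk1 | rfl | hk1
    · obtain rfl : k = 0 := by omega
      apply hasMomentDeriv_cauchyDensity_of_neg_one_lt <;> rw [re_sub_one_add_natCast] <;>
        push_cast <;> linarith
    · apply hasMomentDeriv_cauchyDensity
      · rw [re_sub_one_add_natCast]; push_cast; linarith
      · rw [re_sub_one_add_natCast]; push_cast; linarith
      · right
        rw [re_sub_one_add_natCast]; push_cast; linarith
    · have : (2 : ℝ) ≤ k := by exact_mod_cast hk1
      apply hasMomentDeriv_cauchyDensity
      · rw [re_sub_one_add_natCast]; linarith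
      · rw [re_sub_one_add_natCast]; linarith
      · left
        rw [re_sub_one_add_natCast]; linarith

lemma integrable_cauchyDensity_natCast (h0 : 0 < μ.re) (h1 : μ.re + 2 * n + 3 < 2 * η₁)
    {k : ℕ} (hk : k ≤ 2 * n + 3) (s : ℝ) :
    Integrable fun x => cauchyDensity η₁ η₂ x * branchKernel ξ (μ - 1 + k) (s - x) := by
  have hn : (0 : ℝ) ≤ n := Nat.cast_nonneg n
  have hk' : (k : ℝ) ≤ 2 * n + 3 := by exact_mod_cast hk
  have hk0 : (0 : ℝ) ≤ k := Nat.cast_nonneg k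
  apply integrable_cauchyDensity_mul
  · linarith
  · rw [re_sub_one_add_natCast]; linarith
  · rw [re_sub_one_add_natCast]; linarith

lemma cauchyAverage_eq (N : ℕ) (η₁ η₂ : ℝ) (ν ξ : ℂ) (s : ℝ) : cauchyAverage N η₁ η₂ ν ξ s
    = ∫ x, ensembleIntegrand N (fun x => cauchyDensity η₁ η₂ x * branchKernel ξ ν (s - x)) x := by
  rw [cauchyAverage, cauchyWeight_eq]

lemma cauchy_integrable_and_differentiableAt (h0 : 0 < μ.re) (h1 : μ.re + 2 * N + 1 < 2 * η₁)
    {k : ℕ} (hk : k < 4) :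
    Integrable (ensembleIntegrand N (cauchyWeight η₁ η₂ (μ - 1 + k) ξ t)) ∧
      DifferentiableAt ℝ (fun s : ℝ => cauchyAverage N η₁ η₂ (μ - 1 + k) ξ s) t := by
  have hk' : ∀ j : ℕ, μ - 1 + (k : ℂ) + j = μ - 1 + ((k + j : ℕ) : ℂ) := fun j => by
    push_cast; ring
  have hn : ∀ j : ℕ, j + 2 ≤ 2 * N →
      ∃ n : ℕ, μ.re + 2 * n + 3 < 2 * η₁ ∧ k + j ≤ 2 * n + 3 := fun j hj => by
    obtain ⟨n, rfl⟩ : ∃ n, N = n + 1 := ⟨N - 1, by omega⟩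
    refine ⟨n, ?_, by omega⟩
    push_cast at h1
    linarith
  have hi : ∀ s : ℝ, ∀ j : ℕ, j + 2 ≤ 2 * N →
      Integrable fun x => cauchyDensity η₁ η₂ x * branchKernel ξ (μ - 1 + k + j) (s - x) :=
    fun s j hj => by
      obtain ⟨n, hn1, hn2⟩ := hn j hj
      rw [hk']
      exact integrable_cauchyDensity_natCast h0 hn1 hn2 s
  constructor
  · rw [cauchyWeight_eq]
    exact (ensemble_of_integrable (hi t)).1
  · refine differentiableAt_integral_ensembleIntegrand (N := N) (g := cauchyDensity η₁ η₂) (ξ := ξ)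
      (ν := μ - 1 + k) (Eventually.of_forall fun s => cauchyAverage_eq _ _ _ _ _ s)
      (Eventually.of_forall hi) fun j hj => ?_
    obtain ⟨n, hn1, hn2⟩ := hn j hj
    rw [hk']
    exact (hasMomentDeriv_cauchyDensity_natCast h0 hn1 hn2).choose_spec.1.differentiableAt

lemma ofReal_sq_add_one_ne_zero (t : ℝ) : (t : ℂ) ^ 2 + 1 ≠ 0 := by
  exact_mod_cast (by positivity : t ^ 2 + 1 ≠ 0)

lemma cauchyRecurrence_real (h0 : 0 < μ.re) (h1 : μ.re + 2 * N + 1 < 2 * η₁)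
    (hE : ∀ ν ∈ shifts μ, cauchyAverage N η₁ η₂ ν ξ t ≠ 0) :
    CauchyRecurrence N η₁ η₂ μ t (UCy N η₁ η₂ (μ - 1) ξ t) (UCy N η₁ η₂ μ ξ t)
      (UCy N η₁ η₂ (μ + 1) ξ t) (UCy N η₁ η₂ (μ + 2) ξ t) := by
  have ht := ofReal_sq_add_one_ne_zero t
  rcases N with - | n
  · have hc : ∀ ν, logDeriv (fun s : ℝ => cauchyAverage 0 η₁ η₂ ν ξ s) t = 0 := fun ν => by
      simp [cauchyAverage, ensembleIntegrand_zero, logDeriv_apply]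
    unfold CauchyRecurrence UCy
    simp only [hc, cauchySigma_eq ht, esymTwo', Nat.cast_zero]
    ring
  · rw [forall_shifts] at hE
    have h1' : μ.re + 2 * n + 3 < 2 * η₁ := by push_cast at h1; linarith
    obtain ⟨q, p₁, p₂, y₁, y₂, w, hs, hq⟩ := exists_isSystem_of_branchMoment (n := n)
      (g := cauchyDensity η₁ η₂) (ξ := ξ) (a₁ := -((η₁ : ℂ) + I * η₂))
      (a₂ := -((η₁ : ℂ) - I * η₂)) (μ := μ)
      (E := fun k s => cauchyAverage (n + 1) η₁ η₂ (μ - 1 + k) ξ s)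
      (ofReal_ne_I t) (ofReal_ne_neg_I t) (self_ne_neg.2 I_ne_zero)
      (fun k _ => Eventually.of_forall fun s => cauchyAverage_eq _ _ _ _ _ s)
      (Eventually.of_forall fun s k hk => integrable_cauchyDensity_natCast h0 h1' hk s)
      (fun k hk => hasMomentDeriv_cauchyDensity_natCast h0 h1' hk)
      (fun j hj => by
        split_ifs with h
        -- At the top index the recurrence is the definition of the defect; below it the decay
        -- suffices for a true recurrence.
        · rw [h]; rfl
        · have hj' : (j : ℝ) ≤ 2 * n + 1 := by exact_mod_cast (by omega : j ≤ 2 * n + 1)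
          have hj0 : (0 : ℝ) ≤ j := Nat.cast_nonneg j
          apply momentRecurrence_cauchyDensity <;> rw [re_sub_one_add_natCast] <;> linarith) hE
    have e1 : (t : ℂ) - I + (t - -I) = 2 * t := by ring
    have e2 : ((t : ℂ) - I) * (t - -I) = t ^ 2 + 1 := by linear_combination -I_sq
    have e3 : -((η₁ : ℂ) + I * η₂) + -((η₁ : ℂ) - I * η₂) = -2 * η₁ := by ring
    have e4 : -((η₁ : ℂ) + I * η₂) * (t - I) + -((η₁ : ℂ) - I * η₂) * (t - -I)
        = -2 * (η₁ * t + η₂) := by linear_combination 2 * η₂ * I_sq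
    simp only [e1, e2, e3, e4] at hs hq
    have q0 := hq 0 (by norm_num)
    have q1 := hq 1 (by norm_num)
    have q2 := hq 2 (by norm_num)
    have q3 := hq 3 (by norm_num)
    rw [Nat.cast_zero, add_zero] at q0
    rw [Nat.cast_one, sub_add_cancel] at q1
    rw [show μ - 1 + ((2 : ℕ) : ℂ) = μ + 1 by push_cast; ring] at q2
    rw [show μ - 1 + ((3 : ℕ) : ℂ) = μ + 2 by push_cast; ring] at q3
    rw [← Nat.cast_add_one] at hs q0 q1 q2 q3
    exact cauchyRecurrence_of_isSystem ht hs q0 q1 q2 q3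

/-- The difference of the two sides of the Cauchy recurrence. -/
def cauchyDefect (N : ℕ) (η₁ η₂ : ℝ) (μ t Ud U U₁ U₂ : ℂ) : ℂ :=
  ((N + μ + 1 - 2 * η₁) * U - (N + μ - 2 * η₁) * U₁ + η₁ ^ 2 * t + η₂ * (N - η₁))
    * ((N + μ + 1) * U - (N + μ) * U₁ + η₁ ^ 2 * t - η₂ * (N - η₁))
    * (U₁ - Ud + 2 * (N + μ - η₁) * t)
    * (U₂ - U + 2 * (N + μ + 1 - η₁) * t)
  - (1 + t ^ 2)
    * ((N + μ) * (N + μ - 2 * η₁) * (U₁ - Ud) - 2 * (N + μ - η₁) * U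
      - 2 * η₁ ^ 2 * (N + μ - η₁) * t - 2 * η₁ * η₂ * (N - η₁))
    * ((N + μ + 1) * (N + μ + 1 - 2 * η₁) * (U₂ - U) - 2 * (N + μ + 1 - η₁) * U₁
      - 2 * η₁ ^ 2 * (N + μ + 1 - η₁) * t - 2 * η₁ * η₂ * (N - η₁))

lemma cauchyRecurrence_iff {t Ud U U₁ U₂ : ℂ} : CauchyRecurrence N η₁ η₂ μ t Ud U U₁ U₂
    ↔ cauchyDefect N η₁ η₂ μ t Ud U U₁ U₂ = 0 :=
  sub_eq_zero.symm

/-- The polynomial form of `cauchySigma`. -/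
def cauchySigmaPoly (N : ℕ) (η₁ η₂ : ℝ) (μ t L : ℂ) : ℂ :=
  esymTwo' (N - η₁) η₁ (-μ + η₁ - N) * t - η₂ * (η₁ - μ) + (t ^ 2 + 1) * L

lemma cauchyRecurrence_complex (h0 : 0 < μ.re) (h1 : μ.re + 2 * N + 1 < 2 * η₁) {Ω : Set ℂ}
    {E : ℂ → ℂ → ℂ} (hΩo : IsOpen Ω) (hΩ : IsPreconnected Ω) (ht : (t : ℂ) ∈ Ω)
    (hE : ∀ ν ∈ shifts μ, DifferentiableOn ℂ (E ν) Ω ∧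
      ∀ᶠ s : ℝ in 𝓝 t, E ν (s : ℂ) = cauchyAverage N η₁ η₂ ν ξ s) {z : ℂ} (hz : z ∈ Ω)
    (hz1 : z ^ 2 + 1 ≠ 0) (hEz : ∀ ν ∈ shifts μ, E ν z ≠ 0) :
    CauchyRecurrence N η₁ η₂ μ z
      (cauchySigma N η₁ η₂ (μ - 1) z (logDeriv (E (μ - 1)) z))
      (cauchySigma N η₁ η₂ μ z (logDeriv (E μ) z))
      (cauchySigma N η₁ η₂ (μ + 1) z (logDeriv (E (μ + 1)) z))
      (cauchySigma N η₁ η₂ (μ + 2) z (logDeriv (E (μ + 2)) z)) := by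
  -- The polynomial form is continued, because the regularity of `Φ` is required at every point,
  -- `±I` included.
  have := relation_of_isPreconnected (Φ := fun z L => cauchyDefect N η₁ η₂ μ z
      (cauchySigmaPoly N η₁ η₂ (μ - 1) z (L 0)) (cauchySigmaPoly N η₁ η₂ μ z (L 1))
      (cauchySigmaPoly N η₁ η₂ (μ + 1) z (L 2)) (cauchySigmaPoly N η₁ η₂ (μ + 2) z (L 3)))
    (f := fun k => E (shiftTuple μ k))
    (A := fun k s => cauchyAverage N η₁ η₂ (shiftTuple μ k) ξ s) ?_ ?_ hΩo hΩ ht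
    (fun k => (hE _ (shiftTuple_mem μ k)).1) (fun k => (hE _ (shiftTuple_mem μ k)).2)
    (Eventually.of_forall fun s hne => ?_) hz (fun k => hEz _ (shiftTuple_mem μ k))
  · simp only [cauchySigma_eq hz1]
    exact cauchyRecurrence_iff.2 this
  · intro L w hL
    have := hL 0
    have := hL 1
    have := hL 2
    have := hL 3
    unfold cauchyDefect cauchySigmaPoly
    fun_prop
  · intro L w hL
    have := hL 0
    have := hL 1
    have := hL 2
    have := hL 3
    unfold cauchyDefect cauchySigmaPoly
    fun_prop
  · have := cauchyRecurrence_real (t := s) (ξ := ξ) (η₂ := η₂) h0 h1 (by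
      rintro ν (rfl | rfl | rfl | rfl)
      exacts [hne 0, hne 1, hne 2, hne 3])
    simp only [UCy, cauchySigma_eq (ofReal_sq_add_one_ne_zero s)] at this
    exact cauchyRecurrence_iff.1 this

end CauchyAverage

end UnitaryEnsemble

end

theorem mainTheorem7 :
    -- Jacobi case
    (∀ (N : ℕ) (a b μ ξ : ℂ) (t : ℝ), t ≠ 0 → t ≠ 1 →
      -- convergence of the integrals at the four parameter values
      -1 < a.re → (-1 < b.re ∨ (ξ = 1 ∧ t < 1)) → (0 < μ.re ∨ t < 0 ∨ 1 < t) →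
      (∀ ν ∈ shifts μ,
        Integrable (ensembleIntegrand N (jacobiWeight a b ν ξ t)) ∧
        DifferentiableAt ℝ (fun s : ℝ => jacobiAverage N a b ν ξ s) t) ∧
      ((∀ ν ∈ shifts μ, jacobiAverage N a b ν ξ t ≠ 0) →
        JacobiRecurrence N a b μ t (UJ N a b (μ - 1) ξ t) (UJ N a b μ ξ t)
          (UJ N a b (μ + 1) ξ t) (UJ N a b (μ + 2) ξ t)) ∧
      -- the equation persists for complex `t` under analytic continuation of the averages
      (∀ (Ω : Set ℂ) (E : ℂ → ℂ → ℂ), IsOpen Ω → IsPreconnected Ω → (t : ℂ) ∈ Ω →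
        (∀ ν ∈ shifts μ, DifferentiableOn ℂ (E ν) Ω ∧
          ∀ᶠ s : ℝ in 𝓝 t, E ν (s : ℂ) = jacobiAverage N a b ν ξ s) →
        ∀ z ∈ Ω, (∀ ν ∈ shifts μ, E ν z ≠ 0) →
          JacobiRecurrence N a b μ z
            (jacobiSigma N a b (μ - 1) z (logDeriv (E (μ - 1)) z))
            (jacobiSigma N a b μ z (logDeriv (E μ) z))
            (jacobiSigma N a b (μ + 1) z (logDeriv (E (μ + 1)) z))
            (jacobiSigma N a b (μ + 2) z (logDeriv (E (μ + 2)) z)))) ∧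
    -- Cauchy case
    (∀ (N : ℕ) (η₁ η₂ : ℝ) (μ ξ : ℂ) (t : ℝ),
      -- convergence of the integrals at the four parameter values
      0 < μ.re → μ.re + 2 * N + 1 < 2 * η₁ →
      (∀ ν ∈ shifts μ,
        Integrable (ensembleIntegrand N (cauchyWeight η₁ η₂ ν ξ t)) ∧
        DifferentiableAt ℝ (fun s : ℝ => cauchyAverage N η₁ η₂ ν ξ s) t) ∧
      ((∀ ν ∈ shifts μ, cauchyAverage N η₁ η₂ ν ξ t ≠ 0) →
        CauchyRecurrence N η₁ η₂ μ t (UCy N η₁ η₂ (μ - 1) ξ t) (UCy N η₁ η₂ μ ξ t)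
          (UCy N η₁ η₂ (μ + 1) ξ t) (UCy N η₁ η₂ (μ + 2) ξ t)) ∧
      (∀ (Ω : Set ℂ) (E : ℂ → ℂ → ℂ), IsOpen Ω → IsPreconnected Ω → (t : ℂ) ∈ Ω →
        (∀ ν ∈ shifts μ, DifferentiableOn ℂ (E ν) Ω ∧
          ∀ᶠ s : ℝ in 𝓝 t, E ν (s : ℂ) = cauchyAverage N η₁ η₂ ν ξ s) →
        ∀ z ∈ Ω, z ^ 2 + 1 ≠ 0 → (∀ ν ∈ shifts μ, E ν z ≠ 0) →
          CauchyRecurrence N η₁ η₂ μ z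
            (cauchySigma N η₁ η₂ (μ - 1) z (logDeriv (E (μ - 1)) z))
            (cauchySigma N η₁ η₂ μ z (logDeriv (E μ) z))
            (cauchySigma N η₁ η₂ (μ + 1) z (logDeriv (E (μ + 1)) z))
            (cauchySigma N η₁ η₂ (μ + 2) z (logDeriv (E (μ + 2)) z)))) := by
  refine ⟨fun N a b μ ξ t h0 h1 ha hb hμ => ⟨?_, ?_, ?_⟩,
    fun N η₁ η₂ μ ξ t h0 h1 => ⟨?_, ?_, ?_⟩⟩
  · obtain ⟨T, hT⟩ := UnitaryEnsemble.exists_isJacobiCut h0 h1 ha hb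
    exact UnitaryEnsemble.forall_shifts.2 fun k _ =>
      hT.integrable_and_differentiableAt h1 (hT.of_regular hμ) N k
  · exact UnitaryEnsemble.jacobiRecurrence_real h0 h1 ha hb hμ
  · exact fun Ω E hΩo hΩ ht hE z hz hEz =>
      UnitaryEnsemble.jacobiRecurrence_complex h0 h1 ha hb hμ hΩo hΩ ht hE hz hEz
  · exact UnitaryEnsemble.forall_shifts.2 fun k hk =>
      UnitaryEnsemble.cauchy_integrable_and_differentiableAt h0 h1 hk
  · exact UnitaryEnsemble.cauchyRecurrence_real h0 h1
  · exact fun Ω E hΩo hΩ ht hE z hz hz1 hEz =>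
      UnitaryEnsemble.cauchyRecurrence_complex h0 h1 hΩo hΩ ht hE hz hz1 hEz
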